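/- **Lemma 4.3.** Let $\mathbb T^2=\mathbb R^2/\mathbb Z^2$, let $\mathbb S^2$ be the space of symmetric $2\times2$ matrices with the Frobenius norm, and let $f:\mathbb T^2\to\mathbb R$. Set $$\mathcal V=\Big\{D^2v:\ v\in H^2(\mathbb T^2),\ \int_{\mathbb T^2}v=0\Big\},$$ $$\mathcal B=\big\{\mathbf Q\in L^2(\mathbb T^2,\mathbb S^2):\ \det(\mathbf I+\mathbf Q(x))=f(x)\text{ and }\mathbf I+\mathbf Q(x)\text{ is positive definite for a.e. }x\big\}.$$ Let $\Pi_{\mathcal V}$ and $\Pi_{\mathcal B}$ be the metric (nearest point) projections onto these sets in $L^2(\mathbb T^2,\mathbb S^2)$, and let $T=\Pi_{\mathcal B}\circ\Pi_{\mathcal V}$. For $m\in\mathbb N$ write $|\mathbf A|_m=\big(\sum_{|\alpha|=m}\|D^\alpha\mathbf A\|_{L^2}^2\big)^{1/2}$, and let $\|\mathbf A\|_{H^{3/2}}^2=\sum_{k\in\mathbb Z^2}(1+|2\pi k|^2)^{3/2}|\widehat{\mathbf A}(k)|^2$. Let $\mathbf P\in\mathcal B\cap\mathcal V\cap H^2(\mathbb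 T^2,\mathbb S^2)$ be such that $\mathbf I+\mathbf P$ is uniformly elliptic, i.e. there are $\nu_1,\nu_2>0$ with $$\nu_1|\xi|^2\le\xi^{T}(\mathbf I+\mathbf P(x))\,\xi\le\nu_2|\xi|^2\qquad\text{for all }\xi\in\mathbb R^2\text{ and a.e. }x\in\mathbb T^2.$$ Then there are $\varepsilon,\delta,C>0$ such that, for every $\mathbf X\in H^2(\mathbb T^2,\mathbb S^2)$ with $\|\mathbf X-\mathbf P\|_{H^{3/2}}<\delta$, the map $T$ is well defined at $\mathbf X$ (there is exactly one point of $\mathcal V$ nearest to $\mathbf X$, and exactly one point of $\mathcal B$ nearest to $\Pi_{\mathcal V}(\mathbf X)$), $T(\mathbf X)\in H^2(\mathbb T^2,\mathbb S^2)$, and $$|T(\mathbf X)-T(\mathbf P)|_m\le(1-\varepsilon)\,|\mathbf X-\mathbf P|_m+C\qquad\text{for } m=1\text{ and }m=2.$$ -/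

import Mathlib

open MeasureTheory
open scoped ENNReal ContDiff Matrix

noncomputable section

namespace MongeAmpereTorus

/-! ### The torus and symmetric matrices -/

/-- The two-dimensional torus `ℝ² / ℤ²`. -/
abbrev T2 : Type := UnitAddTorus (Fin 2)

/-- Lebesgue measure on the torus (Haar measure of total mass one). -/
abbrev torusMeasure : Measure T2 := Measure.pi fun _ : Fin 2 => AddCircle.haarAddCircle

/-- The symmetric `2 × 2` matrices, as a subspace of the `2 × 2` arrays of real numbers with the
Euclidean structure on the entries, which is the Frobenius structure `A : B = tr (Aᵀ B)`. -/
def symSubmodule : Submodule ℝ (EuclideanSpace ℝ (Fin 2 × Fin 2)) where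
  carrier := {A | ∀ i j, A (i, j) = A (j, i)}
  add_mem' := by
    intro A B hA hB i j
    simp [hA i j, hB i j]
  zero_mem' := by
    intro i j
    simp
  smul_mem' := by
    intro c A hA i j
    simp [hA i j]

/-- The space `𝕊²` of symmetric `2 × 2` matrices with the Frobenius inner product. -/
abbrev SymMat : Type := symSubmodule

/-- A symmetric array, regarded as a matrix. -/
def toMat (A : SymMat) : Matrix (Fin 2) (Fin 2) ℝ :=
  Matrix.of fun i j => (A : EuclideanSpace ℝ (Fin 2 × Fin 2)) (i, j)

/-- The norm of `SymMat` is the Frobenius norm. -/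
theorem norm_sq_eq_trace (A : SymMat) : ‖A‖ ^ 2 = ((toMat A)ᵀ * toMat A).trace := by
  rw [Submodule.coe_norm, EuclideanSpace.norm_sq_eq, Fintype.sum_prod_type_right]
  simp [Matrix.trace, Matrix.mul_apply, toMat, sq]

theorem isSymm_toMat (A : SymMat) : (toMat A).IsSymm := by
  ext i j
  exact A.2 j i

/-- The space `L²(𝕋²; 𝕊²)`. -/
abbrev MatField : Type := Lp SymMat 2 torusMeasure

/-! ### Weak derivatives and Sobolev spaces of integer order -/

/-- The covering map `ℝ² → 𝕋²`. -/
def toTorus (y : Fin 2 → ℝ) : T2 := fun i => (y i : UnitAddCircle)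

/-- Smooth functions on the torus: those whose periodic lift to `ℝ²` is `C^∞`. -/
def SmoothOnTorus (φ : T2 → ℝ) : Prop :=
  ContDiff ℝ ∞ fun y : Fin 2 → ℝ => φ (toTorus y)

/-- The classical partial derivative `∂ᵢ φ` of a function on the torus. -/
def partialDeriv (i : Fin 2) (φ : T2 → ℝ) (x : T2) : ℝ :=
  deriv (fun t : ℝ => φ (x + Pi.single i (t : UnitAddCircle))) 0

/-- The classical derivative `D^α φ = ∂₁^{α₁} ∂₂^{α₂} φ`. -/
def multiDeriv (α : ℕ × ℕ) (φ : T2 → ℝ) : T2 → ℝ :=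
  (partialDeriv 0)^[α.1] ((partialDeriv 1)^[α.2] φ)

section Sobolev

variable {E : Type*} [NormedAddCommGroup E] [NormedSpace ℝ E]

/-- `w` is the weak derivative `D^α u` on the torus (used for square-integrable `u`, `w`). -/
def IsWeakDeriv (α : ℕ × ℕ) (u w : T2 → E) : Prop :=
  ∀ φ : T2 → ℝ, SmoothOnTorus φ →
    ∫ x, multiDeriv α φ x • u x ∂torusMeasure =
      (-1 : ℝ) ^ (α.1 + α.2) • ∫ x, φ x • w x ∂torusMeasure

/-- `u ∈ H^m(𝕋²; E)`: all weak derivatives of order at most `m` exist in `L²`. -/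
def MemH (m : ℕ) (u : Lp E 2 torusMeasure) : Prop :=
  ∀ α : ℕ × ℕ, α.1 + α.2 ≤ m → ∃ w : Lp E 2 torusMeasure, IsWeakDeriv α u w

open Classical in
/-- The weak derivative `D^α u ∈ L²` (zero if it does not exist). -/
def weakDeriv (α : ℕ × ℕ) (u : Lp E 2 torusMeasure) : Lp E 2 torusMeasure :=
  if h : ∃ w : Lp E 2 torusMeasure, IsWeakDeriv α u w then h.choose else 0

/-- The seminorm `|u|_m = (∑_{|α| = m} ‖D^α u‖²_{L²})^{1/2}`, for `u ∈ H^m`. -/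
def seminormH (m : ℕ) (u : Lp E 2 torusMeasure) : ℝ :=
  √(∑ α ∈ Finset.HasAntidiagonal.antidiagonal m, ‖weakDeriv α u‖ ^ 2)

end Sobolev

/-! ### Sobolev norms of real order -/

/-- The norm of `H^s(𝕋²; 𝕊²)`, with value `∞` outside the space:
`‖X‖²_{H^s} = ∑_{k ∈ ℤ²} (1 + |2πk|²)^s |X̂(k)|²`, where `|X̂(k)|` is the Frobenius norm. -/
def sobolevNorm (s : ℝ) (X : MatField) : ℝ≥0∞ :=
  (∑' k : Fin 2 → ℤ, ENNReal.ofReal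
    ((1 + (2 * Real.pi) ^ 2 * ∑ i, (k i : ℝ) ^ 2) ^ s *
      ∑ i, ∑ j, ‖UnitAddTorus.mFourierCoeff (fun x => ((toMat (X x) i j : ℝ) : ℂ)) k‖ ^ 2))
    ^ (1 / 2 : ℝ)

/-! ### The constraint sets and the iteration map -/

/-- The multi-index of the partial derivative `∂ᵢ`. -/
def unitIndex (i : Fin 2) : ℕ × ℕ := if i = 0 then (1, 0) else (0, 1)

/-- `X = D²v` in the weak sense. -/
def IsHessian (v : Lp ℝ 2 torusMeasure) (X : MatField) : Prop :=
  ∀ i j : Fin 2, IsWeakDeriv (unitIndex i + unitIndex j) v fun x => toMat (X x) i j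

/-- `𝒱`: the Hessians of functions `v ∈ H²(𝕋²)` with mean zero. -/
def setV : Set MatField :=
  {X | ∃ v : Lp ℝ 2 torusMeasure,
    MemH 2 v ∧ ∫ x, v x ∂torusMeasure = 0 ∧ IsHessian v X}

/-- `ℬ`: the fields `Q ∈ L²(𝕋²; 𝕊²)` with `det (I + Q) = f` and `I + Q` symmetric positive
definite almost everywhere. -/
def setB (f : T2 → ℝ) : Set MatField :=
  {Q | ∀ᵐ x ∂torusMeasure, (1 + toMat (Q x)).det = f x ∧ (1 + toMat (Q x)).PosDef}

/-- Uniform ellipticity of a matrix field on the torus. -/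
def UniformlyElliptic (A : T2 → Matrix (Fin 2) (Fin 2) ℝ) : Prop :=
  ∃ ν₁ ν₂ : ℝ, 0 < ν₁ ∧ 0 < ν₂ ∧ ∀ᵐ x ∂torusMeasure, ∀ ξ : Fin 2 → ℝ,
    ν₁ * (ξ ⬝ᵥ ξ) ≤ ξ ⬝ᵥ (A x *ᵥ ξ) ∧ ξ ⬝ᵥ (A x *ᵥ ξ) ≤ ν₂ * (ξ ⬝ᵥ ξ)

/-- `Y` is a point of `S` nearest to `X` in the `L²` norm. -/
def IsNearestPoint (S : Set MatField) (X Y : MatField) : Prop :=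
  Y ∈ S ∧ ∀ Z ∈ S, ‖X - Y‖ ≤ ‖X - Z‖

open Classical in
/-- The `L²` metric projection `Π_S` onto `S` (a nearest point, and zero if there is none). -/
def metricProj (S : Set MatField) (X : MatField) : MatField :=
  if h : ∃ Y, IsNearestPoint S X Y then h.choose else 0

/-- The iteration map `T = Π_ℬ ∘ Π_𝒱`. -/
def iterMap (f : T2 → ℝ) (X : MatField) : MatField :=
  metricProj (setB f) (metricProj setV X)

end MongeAmpereTorus

end

/-! Write `Y` for the projection of `X` onto the Hessians and `Z` for the projection of `Y` onto the
determinant constraint. At frequency k a Hessian has a Fourier coefficient proportional to k⊗k, so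
the first projection is a Fourier multiplier that shrinks the spectrum frequency by frequency
(`exists_orthogonal_hessian`). It decreases every Sobolev seminorm, and Y = P + D with D the
projection of X − P. In dimension two the H^{3/2} norm controls the sup norm (`sqrt_pw_summable`),
so |D| ≤ η with η as small as desired.

The second projection then acts pointwise: I + Y = (I + Z) + t cof(I + Z) with det(I + Z) = f and
|t| ≤ 2η/ν (`exists_critical_near`), and such a critical point is the strict minimiser
(`critical_gap`, `levelSet_gap`). Differentiating, and neglecting terms of size t, the derivative of
Z is the component of the derivative of Y orthogonal to cof(I + Z), plus a normal component fixed by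
the derivative of f = det(I + P), which is data (`linear_bound`).

The crux is that this tangential projection strictly contracts Hessians in L². Pointwise, |tan H|² ≤
(1 − c)|H|² − c' det H with c and c' constant in x (`Ell.norm_tanProj_sq_le`), and det H has mean
zero when H is a Hessian (`hessians_inner`). This gives a factor θ < 1 (`exists_tanProj_field`). It
applies because differences of Hessians are Hessians.

As Z is not known to be differentiable, everything is done with finite differences, and bounds
uniform in the step are converted into weak derivatives (`hasDeriv_of_tendsto`). Second differences
produce errors quadratic in first differences (`critical_second_difference`). A discrete
Gagliardo–Nirenberg inequality (`exists_sq_diff`) bounds them by η times second differences of D,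
absorbed into the gap 1 − θ for small η, plus terms in P alone, which go into the additive constant.
-/

noncomputable section

namespace MongeAmpereTorus

open UnitAddTorus ComplexConjugate

/-! ### Fourier series of real square-integrable functions -/

/-- The Fourier coefficients of a real-valued function on the torus. -/
def fc (g : T2 → ℝ) (k : Fin 2 → ℤ) : ℂ := mFourierCoeff (fun x => (g x : ℂ)) k

/-- A real `L²` function, regarded as a complex one. -/
def cplx (u : Lp ℝ 2 torusMeasure) : Lp ℂ 2 torusMeasure := Complex.ofRealCLM.compLp u

theorem coeFn_cplx (u : Lp ℝ 2 torusMeasure) :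
    cplx u =ᵐ[torusMeasure] fun x => ((u x : ℝ) : ℂ) :=
  Complex.ofRealCLM.coeFn_compLp' u

theorem fc_congr {g g' : T2 → ℝ} (h : g =ᵐ[torusMeasure] g') (k : Fin 2 → ℤ) :
    fc g k = fc g' k := by
  refine integral_congr_ae ?_
  filter_upwards [h] with x hx
  rw [hx]

theorem mFourierCoeff_congr {g g' : T2 → ℂ} (h : g =ᵐ[torusMeasure] g') (k : Fin 2 → ℤ) :
    mFourierCoeff g k = mFourierCoeff g' k := by
  refine integral_congr_ae ?_
  filter_upwards [h] with x hx
  rw [hx]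

theorem mFourierCoeff_cplx (u : Lp ℝ 2 torusMeasure) (k : Fin 2 → ℤ) :
    mFourierCoeff (cplx u) k = fc u k :=
  mFourierCoeff_congr (coeFn_cplx u) k

theorem fc_eq_repr (u : Lp ℝ 2 torusMeasure) (k : Fin 2 → ℤ) :
    fc u k = (mFourierBasis (d := Fin 2)).repr (cplx u) k := by
  rw [mFourierBasis_repr]
  exact (mFourierCoeff_cplx u k).symm

theorem cplx_add (u v : Lp ℝ 2 torusMeasure) : cplx (u + v) = cplx u + cplx v := by
  apply Lp.ext
  filter_upwards [coeFn_cplx (u + v), coeFn_cplx u, coeFn_cplx v, Lp.coeFn_add u v,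
    Lp.coeFn_add (cplx u) (cplx v)] with x h1 h2 h3 h4 h5
  rw [h1, h5, h4, Pi.add_apply, Pi.add_apply, h2, h3]
  simp

theorem cplx_smul (c : ℝ) (u : Lp ℝ 2 torusMeasure) : cplx (c • u) = (c : ℂ) • cplx u := by
  apply Lp.ext
  filter_upwards [coeFn_cplx (c • u), coeFn_cplx u, Lp.coeFn_smul c u,
    Lp.coeFn_smul (c : ℂ) (cplx u)] with x h1 h2 h3 h4
  rw [h1, h4, h3, Pi.smul_apply, Pi.smul_apply, h2]
  simp

theorem fc_add (u v : Lp ℝ 2 torusMeasure) (k : Fin 2 → ℤ) :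
    fc (u + v : Lp ℝ 2 torusMeasure) k = fc u k + fc v k := by
  simp only [fc_eq_repr, cplx_add]
  rw [map_add]; rfl

theorem fc_smul (c : ℝ) (u : Lp ℝ 2 torusMeasure) (k : Fin 2 → ℤ) :
    fc (c • u : Lp ℝ 2 torusMeasure) k = c * fc u k := by
  simp only [fc_eq_repr, cplx_smul]
  rw [map_smul]; rfl

theorem fc_sub (u v : Lp ℝ 2 torusMeasure) (k : Fin 2 → ℤ) :
    fc (u - v : Lp ℝ 2 torusMeasure) k = fc u k - fc v k := by
  rw [sub_eq_add_neg, ← neg_one_smul ℝ v, fc_add, fc_smul]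
  push_cast; ring

theorem fc_neg_freq (g : T2 → ℝ) (k : Fin 2 → ℤ) : fc g (-k) = conj (fc g k) := by
  unfold fc mFourierCoeff
  rw [← integral_conj]
  congr 1
  ext x
  simp only [smul_eq_mul, map_mul, Complex.conj_ofReal, mFourier_neg, Complex.conj_conj]

theorem inner_eq_integral_mul (u v : Lp ℝ 2 torusMeasure) :
    inner ℝ u v = ∫ x, u x * v x ∂torusMeasure := by
  rw [L2.inner_def]
  congr 1
  ext x
  simp [mul_comm]

theorem hasSum_fc_mul (u v : Lp ℝ 2 torusMeasure) :
    HasSum (fun k => conj (fc u k) * fc v k) ((inner ℝ u v : ℝ) : ℂ) := by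
  have h := hasSum_prod_mFourierCoeff (d := Fin 2) (cplx u) (cplx v)
  have e : ∫ t, conj (cplx u t) * cplx v t ∂torusMeasure = ((inner ℝ u v : ℝ) : ℂ) := by
    rw [inner_eq_integral_mul, ← integral_complex_ofReal]
    refine integral_congr_ae ?_
    filter_upwards [coeFn_cplx u, coeFn_cplx v] with x h1 h2
    rw [h1, h2]; simp
  rw [← e]
  simp only [mFourierCoeff_cplx] at h
  exact h

theorem hasSum_fc_sq (u : Lp ℝ 2 torusMeasure) :
    HasSum (fun k => ‖fc u k‖ ^ 2) (‖u‖ ^ 2) := by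
  have h := Complex.hasSum_re (hasSum_fc_mul u u)
  simpa [← Complex.normSq_eq_conj_mul_self, Complex.normSq_eq_norm_sq,
    real_inner_self_eq_norm_sq, ← Complex.ofReal_pow] using h

theorem eq_of_fc_eq {u v : Lp ℝ 2 torusMeasure} (h : ∀ k, fc u k = fc v k) : u = v := by
  have h1 := hasSum_fc_sq (u - v)
  simp only [fc_sub, h, sub_self, norm_zero, ne_eq, OfNat.ofNat_ne_zero, not_false_eq_true,
    zero_pow] at h1
  have h2 := h1.unique hasSum_zero
  rw [← sub_eq_zero, ← norm_eq_zero]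
  exact pow_eq_zero_iff two_ne_zero |>.1 h2

/-- Riesz–Fischer gives a complex function; its real part has coefficients (a(k) + conj a(−k)) / 2,
which is a(k) by Hermitian symmetry. -/
theorem exists_fc_eq (a : (Fin 2 → ℤ) → ℂ) (ha : Summable fun k => ‖a k‖ ^ 2)
    (hs : ∀ k, a (-k) = conj (a k)) : ∃ u : Lp ℝ 2 torusMeasure, ∀ k, fc u k = a k := by
  have hm : Memℓp a 2 := by
    rw [memℓp_gen_iff (by norm_num)]
    simpa using ha
  let F : Lp ℂ 2 torusMeasure := (mFourierBasis (d := Fin 2)).repr.symm ⟨a, hm⟩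
  have hF : ∀ k, mFourierCoeff F k = a k := fun k => by
    have := mFourierBasis_repr F k
    rw [← this]
    simp only [F]
    rw [LinearIsometryEquiv.apply_symm_apply]
  refine ⟨Complex.reCLM.compLp F, fun k => ?_⟩
  have h1 : (fun x => ((Complex.reCLM.compLp F x : ℝ) : ℂ)) =ᵐ[torusMeasure]
      fun x => (F x + conj (F x)) / 2 := by
    filter_upwards [Complex.reCLM.coeFn_compLp F] with x hx
    rw [hx]
    simp [Complex.add_conj]
  have hi : Integrable (fun x => mFourier (-k) x • F x) torusMeasure := by
    have := (Lp.memLp F).integrable (by norm_num)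
    refine this.bdd_mul (c := 1) (mFourier (-k)).continuous.aestronglyMeasurable ?_
    exact .of_forall fun x => ((mFourier (-k)).norm_coe_le_norm x).trans mFourier_norm.le
  have hi' : Integrable (fun x => mFourier (-k) x • conj (F x)) torusMeasure := by
    have := (Lp.memLp F).integrable (by norm_num)
    have : Integrable (fun x => conj (F x)) torusMeasure :=
      Complex.conjCLE.toContinuousLinearMap.integrable_comp this
    refine this.bdd_mul (c := 1) (mFourier (-k)).continuous.aestronglyMeasurable ?_
    exact .of_forall fun x => ((mFourier (-k)).norm_coe_le_norm x).trans mFourier_norm.le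
  have h2 : mFourierCoeff (fun x => conj (F x)) k = a k := by
    have := hF (-k)
    rw [hs] at this
    rw [← Complex.conj_conj (a k), ← this]
    unfold mFourierCoeff
    rw [← integral_conj]
    congr 1
    ext x
    simp only [smul_eq_mul, map_mul, mFourier_neg, Complex.conj_conj]
  unfold fc
  rw [mFourierCoeff_congr h1]
  have h3 : mFourierCoeff (fun x => (F x + conj (F x)) / 2) k =
      (mFourierCoeff F k + mFourierCoeff (fun x => conj (F x)) k) / 2 := by
    have e : mFourierCoeff F k + mFourierCoeff (fun x => conj (F x)) k =
        ∫ x, (mFourier (-k) x • F x + mFourier (-k) x • conj (F x)) ∂torusMeasure :=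
      (integral_add hi hi').symm
    rw [e, ← integral_div]
    refine integral_congr_ae (.of_forall fun x => ?_)
    simp only [smul_eq_mul]; ring
  rw [h3, h2, hF]; ring

/-- An absolutely summable Fourier series converges uniformly to a continuous function, which agrees
with `u` almost everywhere because the series also converges to `u` in L². -/
theorem ae_abs_le_tsum_fc {u : Lp ℝ 2 torusMeasure} (h : Summable fun k => ‖fc u k‖) :
    ∀ᵐ x ∂torusMeasure, |u x| ≤ ∑' k, ‖fc u k‖ := by
  have hs : Summable fun k => fc u k • mFourier (d := Fin 2) k := by
    refine .of_norm ?_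
    simpa only [norm_smul, mFourier_norm, mul_one] using h
  obtain ⟨G, hG⟩ := hs
  have h1 := hasSum_mFourier_series_L2 (d := Fin 2) (cplx u)
  have h2 := hG.mapL (ContinuousMap.toLp (E := ℂ) 2 torusMeasure ℂ)
  simp only [mFourierCoeff_cplx] at h1
  have h3 : ContinuousMap.toLp (E := ℂ) 2 torusMeasure ℂ G = cplx u := by
    refine h2.unique ?_
    simp only [map_smul]
    exact h1
  have h4 := ContinuousMap.coeFn_toLp (p := 2) (𝕜 := ℂ) torusMeasure G
  rw [h3] at h4
  filter_upwards [h4, coeFn_cplx u] with x h5 h6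
  have : ‖(u x : ℂ)‖ ≤ ‖G‖ := by
    rw [← h6, h5]
    exact G.norm_coe_le_norm x
  have hn : ‖G‖ ≤ ∑' k, ‖fc u k‖ := by
    rw [← hG.tsum_eq]
    refine (norm_tsum_le_tsum_norm ?_).trans ?_ <;>
      simp only [norm_smul, mFourier_norm, mul_one]
    · exact h
    · exact le_rfl
  simpa using this.trans hn

/-! ### Translations -/

instance : (torusMeasure).IsAddLeftInvariant := by
  unfold torusMeasure; infer_instance

instance : (torusMeasure).IsAddRightInvariant := by
  unfold torusMeasure; infer_instance

theorem measurePreserving_shift (h : T2) :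
    MeasurePreserving (fun x : T2 => x + h) torusMeasure torusMeasure :=
  measurePreserving_add_right torusMeasure h

section

variable {E : Type*} [NormedAddCommGroup E]

/-- Translation of an `L²` field. -/
def shift (h : T2) : Lp E 2 torusMeasure →+ Lp E 2 torusMeasure :=
  Lp.compMeasurePreserving (fun x => x + h) (measurePreserving_shift h)

theorem coeFn_shift (h : T2) (u : Lp E 2 torusMeasure) :
    shift h u =ᵐ[torusMeasure] fun x => u (x + h) :=
  Lp.coeFn_compMeasurePreserving u (measurePreserving_shift h)

theorem ae_shift {p : T2 → Prop} (h : T2) (hp : ∀ᵐ x ∂torusMeasure, p x) :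
    ∀ᵐ x ∂torusMeasure, p (x + h) :=
  (measurePreserving_shift h).quasiMeasurePreserving.ae hp

/-- The first difference `u(x + h) - u(x)`. -/
def diff (h : T2) (u : Lp E 2 torusMeasure) : Lp E 2 torusMeasure := shift h u - u

theorem coeFn_diff (h : T2) (u : Lp E 2 torusMeasure) :
    diff h u =ᵐ[torusMeasure] fun x => u (x + h) - u x := by
  filter_upwards [Lp.coeFn_sub (shift h u) u, coeFn_shift h u] with x h1 h2
  rw [diff, h1, Pi.sub_apply, h2]

theorem coeFn_diff_diff (h h' : T2) (u : Lp E 2 torusMeasure) :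
    diff h (diff h' u) =ᵐ[torusMeasure]
      fun x => u (x + (h + h')) - u (x + h) - u (x + h') + u x := by
  filter_upwards [coeFn_diff h (diff h' u), coeFn_diff h' u,
    ae_shift h (coeFn_diff h' u)] with x h1 h2 h3
  rw [h1, h2, h3, add_assoc]
  abel

end

theorem mFourier_apply_add (k : Fin 2 → ℤ) (x h : T2) :
    mFourier k (x + h) = mFourier k x * mFourier k h := by
  simp only [mFourier, ContinuousMap.coe_mk, ← Finset.prod_mul_distrib]
  refine Finset.prod_congr rfl fun i _ => ?_
  simp [fourier_apply, smul_add, AddCircle.toCircle_add]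

theorem mFourier_mul_conj (k : Fin 2 → ℤ) (x : T2) : mFourier k x * conj (mFourier k x) = 1 := by
  rw [← mFourier_neg, ← mFourier_add, add_neg_cancel, mFourier_zero]; rfl

theorem fc_comp_add (h : T2) (g : T2 → ℝ) (k : Fin 2 → ℤ) :
    fc (fun x => g (x + h)) k = mFourier k h * fc g k := by
  have h1 : fc g k = ∫ x, mFourier (-k) (x + h) • ((g (x + h) : ℝ) : ℂ) ∂torusMeasure :=
    (integral_add_right_eq_self (μ := torusMeasure)
      (fun x => mFourier (-k) x • ((g x : ℝ) : ℂ)) h).symm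
  rw [h1, ← integral_const_mul]
  refine integral_congr_ae (.of_forall fun x => ?_)
  simp only [smul_eq_mul]
  rw [mFourier_apply_add, mFourier_neg (n := k) (x := h)]
  linear_combination (-(mFourier (-k) x * (g (x + h) : ℂ))) * mFourier_mul_conj k h

theorem fc_shift (h : T2) (u : Lp ℝ 2 torusMeasure) (k : Fin 2 → ℤ) :
    fc (shift h u) k = mFourier k h * fc u k := by
  rw [fc_congr (coeFn_shift h u), fc_comp_add]

theorem fc_diff (h : T2) (u : Lp ℝ 2 torusMeasure) (k : Fin 2 → ℤ) :
    fc (diff h u) k = (mFourier k h - 1) * fc u k := by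
  rw [diff, fc_sub, fc_shift]; ring

end MongeAmpereTorus

end

noncomputable section

namespace MongeAmpereTorus

open UnitAddTorus ComplexConjugate

/-! ### Smooth functions on the torus -/

/-- The translation by `t` in the `i`-th coordinate direction. -/
def axis (i : Fin 2) (t : ℝ) : T2 := Pi.single i (t : UnitAddCircle)

theorem toTorus_add (y z : Fin 2 → ℝ) : toTorus (y + z) = toTorus y + toTorus z := by
  ext i; simp [toTorus]

theorem toTorus_single (i : Fin 2) (t : ℝ) : toTorus (t • Pi.single i (1 : ℝ)) = axis i t := by
  ext j
  by_cases h : j = i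
  · subst h; simp [toTorus, axis]
  · simp [toTorus, axis, h]

theorem isOpenQuotientMap_toTorus : IsOpenQuotientMap toTorus := by
  have : IsOpenQuotientMap (Pi.map fun (_ : Fin 2) (t : ℝ) => (t : UnitAddCircle)) :=
    IsOpenQuotientMap.piMap fun _ => QuotientAddGroup.isOpenQuotientMap_mk
  exact this

theorem toTorus_surjective : Function.Surjective toTorus := isOpenQuotientMap_toTorus.surjective

theorem SmoothOnTorus.continuous {φ : T2 → ℝ} (h : SmoothOnTorus φ) : Continuous φ :=
  isOpenQuotientMap_toTorus.isQuotientMap.continuous_iff.2 (ContDiff.continuous h)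

theorem SmoothOnTorus.hasDerivAt {φ : T2 → ℝ} (h : SmoothOnTorus φ) (i : Fin 2)
    (y : Fin 2 → ℝ) (t : ℝ) :
    HasDerivAt (fun s : ℝ => φ (toTorus y + axis i s))
      (fderiv ℝ (fun z => φ (toTorus z)) (y + t • Pi.single i (1 : ℝ)) (Pi.single i 1)) t := by
  have h1 : HasFDerivAt (fun z => φ (toTorus z))
      (fderiv ℝ (fun z => φ (toTorus z)) (y + t • Pi.single i (1 : ℝ)))
      (y + t • Pi.single i (1 : ℝ)) :=
    ((ContDiff.differentiable h (by simp)) _).hasFDerivAt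
  have h2 : HasDerivAt (fun s : ℝ => y + s • (Pi.single i (1 : ℝ) : Fin 2 → ℝ))
      (Pi.single i 1) t := by
    simpa using ((hasDerivAt_id t).smul_const (Pi.single i (1 : ℝ) : Fin 2 → ℝ)).const_add y
  have h3 := h1.comp_hasDerivAt t h2
  refine h3.congr_of_eventuallyEq (.of_forall fun s => ?_)
  simp only [Function.comp]
  rw [toTorus_add, toTorus_single]

theorem SmoothOnTorus.partialDeriv_toTorus {φ : T2 → ℝ} (h : SmoothOnTorus φ) (i : Fin 2)
    (y : Fin 2 → ℝ) :
    partialDeriv i φ (toTorus y) = fderiv ℝ (fun z => φ (toTorus z)) y (Pi.single i 1) := by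
  have := (h.hasDerivAt i y 0).deriv
  simpa [partialDeriv, axis] using this

theorem SmoothOnTorus.partialDeriv {φ : T2 → ℝ} (h : SmoothOnTorus φ) (i : Fin 2) :
    SmoothOnTorus (partialDeriv i φ) := by
  unfold SmoothOnTorus
  simp only [h.partialDeriv_toTorus]
  have : ContDiff ℝ ∞ (fderiv ℝ fun z => φ (toTorus z)) := ContDiff.fderiv_right h (by simp)
  exact this.clm_apply contDiff_const

theorem SmoothOnTorus.hasDerivAt_axis {φ : T2 → ℝ} (h : SmoothOnTorus φ) (i : Fin 2)
    (x : T2) (t : ℝ) :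
    HasDerivAt (fun s : ℝ => φ (x + axis i s))
      (MongeAmpereTorus.partialDeriv i φ (x + axis i t)) t := by
  obtain ⟨y, rfl⟩ := toTorus_surjective x
  have := h.hasDerivAt i y t
  rwa [← toTorus_single, ← toTorus_add, h.partialDeriv_toTorus]

theorem SmoothOnTorus.multiDeriv {φ : T2 → ℝ} (h : SmoothOnTorus φ) (α : ℕ × ℕ) :
    SmoothOnTorus (multiDeriv α φ) := by
  have key : ∀ (i : Fin 2) (n : ℕ) (ψ : T2 → ℝ), SmoothOnTorus ψ →
      SmoothOnTorus ((MongeAmpereTorus.partialDeriv i)^[n] ψ) := by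
    intro i n
    induction n with
    | zero => exact fun ψ hψ => hψ
    | succ n ih => exact fun ψ hψ => ih _ (hψ.partialDeriv i)
  exact key 0 _ _ (key 1 _ _ h)

theorem mFourier_axis (k : Fin 2 → ℤ) (i : Fin 2) (t : ℝ) :
    mFourier k (axis i t) = Complex.exp (2 * Real.pi * Complex.I * k i * t) := by
  simp only [mFourier, ContinuousMap.coe_mk, axis]
  rw [Finset.prod_eq_single i]
  · rw [Pi.single_eq_same, fourier_coe_apply]
    simp
  · intro j _ hj
    rw [Pi.single_eq_of_ne hj]; simp
  · simp

/-- The Fourier symbol of `∂ᵢ`. -/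
def sym1 (i : Fin 2) (k : Fin 2 → ℤ) : ℂ := 2 * Real.pi * Complex.I * k i

/-- The Fourier symbol of `D^α`. -/
def sym (α : ℕ × ℕ) (k : Fin 2 → ℤ) : ℂ := sym1 0 k ^ α.1 * sym1 1 k ^ α.2

theorem conj_sym1 (i : Fin 2) (k : Fin 2 → ℤ) : conj (sym1 i k) = -sym1 i k := by
  have : conj (2 : ℂ) = 2 := map_ofNat _ 2
  simp [sym1, this]

theorem conj_sym (α : ℕ × ℕ) (k : Fin 2 → ℤ) :
    conj (sym α k) = (-1) ^ (α.1 + α.2) * sym α k := by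
  simp only [sym, map_mul, map_pow, conj_sym1, pow_add]
  rw [neg_pow (sym1 0 k), neg_pow (sym1 1 k)]; ring

theorem sym_neg (α : ℕ × ℕ) (k : Fin 2 → ℤ) : sym α (-k) = (-1) ^ (α.1 + α.2) * sym α k := by
  have h : ∀ i, sym1 i (-k) = -sym1 i k := fun i => by simp [sym1]
  simp only [sym, h, pow_add]
  rw [neg_pow (sym1 0 k), neg_pow (sym1 1 k)]; ring

theorem hasDerivAt_mFourier_axis (k : Fin 2 → ℤ) (i : Fin 2) (x : T2) (t : ℝ) :
    HasDerivAt (fun s : ℝ => mFourier k (x + axis i s)) (sym1 i k * mFourier k (x + axis i t))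
      t := by
  have h1 : HasDerivAt (fun s : ℝ => Complex.exp (2 * Real.pi * Complex.I * k i * s))
      (Complex.exp (2 * Real.pi * Complex.I * k i * t) * (2 * Real.pi * Complex.I * k i)) t := by
    have := ((Complex.ofRealCLM.hasDerivAt (x := t)).const_mul
      (2 * Real.pi * Complex.I * k i : ℂ)).cexp
    simpa using this
  simp only [mFourier_apply_add, mFourier_axis]
  refine (h1.const_mul (mFourier k x)).congr_deriv ?_
  simp only [sym1]; ring

/-! ### Trigonometric test functions -/

/-- The test function `Re (c e_k)`. -/
def trigTest (k : Fin 2 → ℤ) (c : ℂ) (x : T2) : ℝ := (c * mFourier k x).re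

theorem smoothOnTorus_trigTest (k : Fin 2 → ℤ) (c : ℂ) : SmoothOnTorus (trigTest k c) := by
  have h : ∀ y : Fin 2 → ℝ, trigTest k c (toTorus y) =
      (c * ∏ i, Complex.exp (2 * Real.pi * Complex.I * k i * (y i : ℝ))).re := by
    intro y
    simp only [trigTest, mFourier, ContinuousMap.coe_mk, toTorus]
    congr 2
    refine Finset.prod_congr rfl fun i _ => ?_
    rw [fourier_coe_apply]; simp
  unfold SmoothOnTorus
  simp only [h]
  refine Complex.reCLM.contDiff.comp (contDiff_const.mul (contDiff_prod fun i _ => ?_))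
  refine Complex.contDiff_exp.comp (contDiff_const.mul (Complex.ofRealCLM.contDiff.comp ?_))
  exact contDiff_apply ℝ ℝ i

theorem partialDeriv_trigTest (i : Fin 2) (k : Fin 2 → ℤ) (c : ℂ) :
    partialDeriv i (trigTest k c) = trigTest k (sym1 i k * c) := by
  ext x
  have h := ((hasDerivAt_mFourier_axis k i x 0).const_mul c)
  have h2 := (Complex.reCLM.hasFDerivAt.comp_hasDerivAt (0 : ℝ) h).deriv
  have e : x + axis i 0 = x := by simp [axis]
  rw [e] at h2
  refine h2.trans ?_
  simp only [Complex.reCLM_apply, trigTest]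
  congr 1; ring

theorem multiDeriv_trigTest (α : ℕ × ℕ) (k : Fin 2 → ℤ) (c : ℂ) :
    multiDeriv α (trigTest k c) = trigTest k (sym α k * c) := by
  have key : ∀ (i : Fin 2) (n : ℕ) (c : ℂ),
      (partialDeriv i)^[n] (trigTest k c) = trigTest k (sym1 i k ^ n * c) := by
    intro i n
    induction n with
    | zero => intro c; simp
    | succ n ih =>
      intro c
      rw [Function.iterate_succ_apply, partialDeriv_trigTest, ih, pow_succ, mul_assoc]
  rw [multiDeriv, key, key, sym, mul_assoc]

theorem integral_trigTest_mul (k : Fin 2 → ℤ) (c : ℂ) (u : Lp ℝ 2 torusMeasure) :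
    ∫ x, trigTest k c x • u x ∂torusMeasure = (c * fc u (-k)).re := by
  have hi : Integrable (fun x => mFourier (-(-k)) x • ((u x : ℝ) : ℂ)) torusMeasure := by
    have : Integrable (fun x => ((u x : ℝ) : ℂ)) torusMeasure :=
      ((Lp.memLp u).integrable (by norm_num)).ofReal
    refine this.bdd_mul (c := 1) (mFourier _).continuous.aestronglyMeasurable ?_
    exact .of_forall fun x => ((mFourier _).norm_coe_le_norm x).trans mFourier_norm.le
  have h1 : c * fc u (-k) = ∫ x, c * (mFourier (-(-k)) x • ((u x : ℝ) : ℂ)) ∂torusMeasure := by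
    rw [integral_const_mul]; rfl
  rw [h1]
  have h2 := Complex.reCLM.integral_comp_comm (hi.const_mul c)
  simp only [Complex.reCLM_apply] at h2
  rw [← h2]
  refine integral_congr_ae (.of_forall fun x => ?_)
  simp only [trigTest, neg_neg, smul_eq_mul, ← mul_assoc]
  rw [Complex.re_mul_ofReal]

/-! ### Weak derivatives and Fourier coefficients -/

/-- Instead of integrating by parts, the k-th coefficient of the translate of φ by t along axis i is
computed in two ways: translation multiplies it by an explicit exponential in t, and differentiation
under the integral at t = 0 gives the coefficient of the derivative. -/
theorem SmoothOnTorus.fc_partialDeriv {φ : T2 → ℝ} (h : SmoothOnTorus φ) (i : Fin 2)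
    (k : Fin 2 → ℤ) : fc (MongeAmpereTorus.partialDeriv i φ) k = sym1 i k * fc φ k := by
  have hc := h.continuous
  have hc' := (h.partialDeriv i).continuous
  obtain ⟨B, hB⟩ := isCompact_univ.exists_bound_of_continuousOn (f := MongeAmpereTorus.partialDeriv i φ)
    hc'.continuousOn
  have hcont : ∀ {ψ : T2 → ℝ} (a : T2), Continuous ψ →
      Continuous fun x => mFourier (-k) x * ((ψ (x + a) : ℝ) : ℂ) := fun a hψ =>
    (mFourier (-k)).continuous.mul
      (Complex.continuous_ofReal.comp (hψ.comp (continuous_id.add continuous_const)))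
  have key := hasDerivAt_integral_of_dominated_loc_of_deriv_le (μ := torusMeasure)
    (F := fun (t : ℝ) x => mFourier (-k) x * ((φ (x + axis i t) : ℝ) : ℂ))
    (F' := fun (t : ℝ) x => mFourier (-k) x *
      ((MongeAmpereTorus.partialDeriv i φ (x + axis i t) : ℝ) : ℂ))
    (x₀ := 0) (s := Set.univ) (bound := fun _ => B) Filter.univ_mem
    (.of_forall fun t => (hcont _ hc).aestronglyMeasurable)
    ((hcont _ hc).integrable_of_hasCompactSupport (HasCompactSupport.of_compactSpace _))
    (hcont _ hc').aestronglyMeasurable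
    (.of_forall fun x t _ => ?_) (integrable_const B)
    (.of_forall fun x t _ => ?_)
  · have h1 : ∀ t : ℝ, ∫ x, mFourier (-k) x * ((φ (x + axis i t) : ℝ) : ℂ) ∂torusMeasure =
        mFourier k (0 + axis i t) * fc φ k := fun t => by
      rw [zero_add, ← fc_comp_add]; rfl
    have h2 := (hasDerivAt_mFourier_axis k i 0 0).mul_const (fc φ k)
    have h3 := key.2
    simp only [h1] at h3
    have h4 := h3.unique h2
    have e : axis i 0 = 0 := by simp [axis]
    simp only [e, add_zero] at h4
    have e2 : mFourier k (0 : T2) = 1 := by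
      have := mFourier_axis k i 0
      rw [e] at this; rw [this]; simp
    rw [e2, mul_one] at h4
    exact h4
  · rw [norm_mul, Complex.norm_real]
    have := (mFourier (-k)).norm_coe_le_norm x
    rw [mFourier_norm] at this
    have h5 := hB (x + axis i t) (Set.mem_univ _)
    calc _ ≤ 1 * B := mul_le_mul this h5 (norm_nonneg _) zero_le_one
      _ = B := one_mul B
  · exact ((h.hasDerivAt_axis i x t).ofReal_comp).const_mul _

theorem SmoothOnTorus.fc_multiDeriv {φ : T2 → ℝ} (h : SmoothOnTorus φ) (α : ℕ × ℕ)
    (k : Fin 2 → ℤ) : fc (MongeAmpereTorus.multiDeriv α φ) k = sym α k * fc φ k := by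
  have key : ∀ (i : Fin 2) (n : ℕ) (ψ : T2 → ℝ), SmoothOnTorus ψ →
      SmoothOnTorus ((MongeAmpereTorus.partialDeriv i)^[n] ψ) ∧
      fc ((MongeAmpereTorus.partialDeriv i)^[n] ψ) k = sym1 i k ^ n * fc ψ k := by
    intro i n
    induction n with
    | zero => exact fun ψ hψ => ⟨hψ, by simp⟩
    | succ n ih =>
      intro ψ hψ
      have := ih _ (hψ.partialDeriv i)
      rw [Function.iterate_succ_apply]
      refine ⟨this.1, ?_⟩
      rw [this.2, hψ.fc_partialDeriv, pow_succ, mul_assoc]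
  rw [MongeAmpereTorus.multiDeriv, (key 0 _ _ (key 1 _ _ h).1).2, (key 1 _ _ h).2, sym, mul_assoc]

theorem SmoothOnTorus.memLp {φ : T2 → ℝ} (h : SmoothOnTorus φ) : MemLp φ 2 torusMeasure :=
  h.continuous.memLp_of_hasCompactSupport (HasCompactSupport.of_compactSpace _)

theorem integral_smul_eq_inner {φ : T2 → ℝ} (h : MemLp φ 2 torusMeasure)
    (u : Lp ℝ 2 torusMeasure) :
    ∫ x, φ x • u x ∂torusMeasure = inner ℝ (h.toLp φ) u := by
  rw [inner_eq_integral_mul]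
  refine integral_congr_ae ?_
  filter_upwards [h.coeFn_toLp] with x hx
  rw [hx, smul_eq_mul]

/-- Testing against Re(c e₋ₖ) with c = 1 and c = −i recovers the real and imaginary parts of the
k-th coefficient identity. Conversely, Parseval turns the coefficient identities into the identity
for any smooth test function. -/
theorem isWeakDeriv_iff {α : ℕ × ℕ} {u w : Lp ℝ 2 torusMeasure} :
    IsWeakDeriv α u w ↔ ∀ k, fc w k = sym α k * fc u k := by
  constructor
  · intro h k
    have h1 : ∀ c : ℂ, (c * (sym α (-k) * fc u k)).re =
        (c * ((-1) ^ (α.1 + α.2) * fc w k)).re := fun c => by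
      have := h _ (smoothOnTorus_trigTest (-k) c)
      rw [multiDeriv_trigTest, integral_trigTest_mul, integral_trigTest_mul, neg_neg] at this
      rw [show c * (sym α (-k) * fc u k) = sym α (-k) * c * fc u k by ring, this, smul_eq_mul,
        ← Complex.re_ofReal_mul]
      congr 1; push_cast; ring
    have h2 : sym α (-k) * fc u k = (-1) ^ (α.1 + α.2) * fc w k := by
      apply Complex.ext
      · simpa using h1 1
      · simpa using h1 (-Complex.I)
    rw [sym_neg] at h2
    have h3 : ((-1 : ℂ) ^ (α.1 + α.2)) * (-1) ^ (α.1 + α.2) = 1 := by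
      rw [← mul_pow]; simp
    linear_combination (-1 : ℂ) ^ (α.1 + α.2) * (-h2) + (sym α k * fc u k - fc w k) * h3
  · intro h φ hφ
    rw [integral_smul_eq_inner (hφ.multiDeriv α).memLp, integral_smul_eq_inner hφ.memLp]
    have h1 := hasSum_fc_mul ((hφ.multiDeriv α).memLp.toLp _) u
    have h2 := (hasSum_fc_mul (hφ.memLp.toLp _) w).mul_left ((-1 : ℂ) ^ (α.1 + α.2))
    have h3 : ∀ k, conj (fc ((hφ.multiDeriv α).memLp.toLp _) k) * fc u k =
        (-1 : ℂ) ^ (α.1 + α.2) * (conj (fc (hφ.memLp.toLp _) k) * fc w k) := fun k => by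
      rw [fc_congr (MemLp.coeFn_toLp _), fc_congr (MemLp.coeFn_toLp _), hφ.fc_multiDeriv, h k,
        map_mul, conj_sym]
      ring
    simp only [h3] at h1
    have := h1.unique h2
    rw [smul_eq_mul]
    exact_mod_cast this

theorem IsWeakDeriv.congr {E : Type*} [NormedAddCommGroup E] [NormedSpace ℝ E] {α : ℕ × ℕ}
    {u u' w w' : T2 → E} (h : IsWeakDeriv α u w) (hu : u =ᵐ[torusMeasure] u')
    (hw : w =ᵐ[torusMeasure] w') : IsWeakDeriv α u' w' := by
  intro φ hφ
  have e1 : ∫ x, multiDeriv α φ x • u' x ∂torusMeasure =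
      ∫ x, multiDeriv α φ x • u x ∂torusMeasure := by
    refine integral_congr_ae ?_
    filter_upwards [hu] with x hx
    rw [hx]
  have e2 : ∫ x, φ x • w' x ∂torusMeasure = ∫ x, φ x • w x ∂torusMeasure := by
    refine integral_congr_ae ?_
    filter_upwards [hw] with x hx
    rw [hx]
  rw [e1, e2]
  exact h φ hφ

end MongeAmpereTorus

end

noncomputable section

set_option linter.unusedSectionVars false

namespace MongeAmpereTorus

open UnitAddTorus ComplexConjugate

/-! ### Matrix fields and their entries -/

/-- A Euclidean model of the space of symmetric `2 × 2` matrices with the Frobenius structure. -/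
class SymSpace (E : Type) [NormedAddCommGroup E] [InnerProductSpace ℝ E] where
  /-- the `(i, j)` entry -/
  entL : Fin 2 → Fin 2 → E →L[ℝ] ℝ
  /-- the matrix with entries `p`, `q`, `q`, `r` -/
  mkSym : ℝ → ℝ → ℝ → E
  entL_symm : ∀ i j A, entL i j A = entL j i A
  entL_mkSym : ∀ p q r i j, entL i j (mkSym p q r) = !![p, q; q, r] i j
  inner_eq_sum_entL : ∀ A B : E, inner ℝ A B = ∑ i, ∑ j, entL i j A * entL i j B

open SymSpace

variable {E : Type} [NormedAddCommGroup E] [InnerProductSpace ℝ E] [SymSpace E]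

theorem norm_sq_eq_sum_entL (A : E) : ‖A‖ ^ 2 = ∑ i, ∑ j, entL i j A ^ 2 := by
  rw [← real_inner_self_eq_norm_sq, inner_eq_sum_entL]
  simp only [sq]

theorem SymSpace.ext_entL {A B : E} (h : ∀ i j, entL i j A = entL i j B) : A = B := by
  rw [← sub_eq_zero, ← norm_eq_zero]
  have : ‖A - B‖ ^ 2 = 0 := by
    rw [norm_sq_eq_sum_entL]; simp [h]
  exact pow_eq_zero_iff two_ne_zero |>.1 this

/-- The scalar field of the `(i, j)` entries of a matrix field. -/
def ent (i j : Fin 2) (X : Lp E 2 torusMeasure) : Lp ℝ 2 torusMeasure := (entL i j).compLp X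

theorem coeFn_ent (i j : Fin 2) (X : Lp E 2 torusMeasure) :
    ent i j X =ᵐ[torusMeasure] fun x => entL i j (X x) :=
  (entL i j).coeFn_compLp' X

theorem ent_symm (i j : Fin 2) (X : Lp E 2 torusMeasure) : ent i j X = ent j i X := by
  apply Lp.ext
  filter_upwards [coeFn_ent i j X, coeFn_ent j i X] with x h1 h2
  rw [h1, h2, entL_symm]

theorem ent_sub (i j : Fin 2) (X Y : Lp E 2 torusMeasure) : ent i j (X - Y) = ent i j X - ent i j Y := by
  apply Lp.ext
  filter_upwards [coeFn_ent i j X, coeFn_ent i j Y, coeFn_ent i j (X - Y), Lp.coeFn_sub X Y,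
    Lp.coeFn_sub (ent i j X) (ent i j Y)] with x h1 h2 h3 h4 h5
  rw [h3, h5, h4, Pi.sub_apply, Pi.sub_apply, h1, h2, map_sub]

theorem ent_diff (i j : Fin 2) (h : T2) (X : Lp E 2 torusMeasure) :
    ent i j (diff h X) = diff h (ent i j X) := by
  apply Lp.ext
  filter_upwards [coeFn_ent i j (diff h X), coeFn_diff h X, coeFn_diff h (ent i j X),
    coeFn_ent i j X, ae_shift h (coeFn_ent i j X)] with x h1 h2 h3 h4 h5
  rw [h1, h2, h3, h4, h5, map_sub]

theorem eq_of_ent_eq {X Y : Lp E 2 torusMeasure} (h : ∀ i j, ent i j X = ent i j Y) : X = Y := by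
  apply Lp.ext
  have : ∀ᵐ x ∂torusMeasure, ∀ i j, entL i j (X x) = entL i j (Y x) := by
    rw [ae_all_iff]; intro i
    rw [ae_all_iff]; intro j
    filter_upwards [coeFn_ent i j X, coeFn_ent i j Y] with x h1 h2
    rw [← h1, ← h2, h]
  filter_upwards [this] with x hx
  exact SymSpace.ext_entL hx

theorem exists_field (a : Fin 2 → Fin 2 → Lp ℝ 2 torusMeasure) (hs : ∀ i j, a i j = a j i) :
    ∃ X : Lp E 2 torusMeasure, ∀ i j, ent i j X = a i j := by
  let S (B : E) : ℝ →L[ℝ] E := ContinuousLinearMap.toSpanSingleton ℝ B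
  refine ⟨(S (mkSym 1 0 0)).compLp (a 0 0) + (S (mkSym 0 1 0)).compLp (a 0 1) +
    (S (mkSym 0 0 1)).compLp (a 1 1), fun i j => ?_⟩
  apply Lp.ext
  filter_upwards [coeFn_ent i j ((S (mkSym 1 0 0)).compLp (a 0 0) +
    (S (mkSym 0 1 0)).compLp (a 0 1) + (S (mkSym 0 0 1)).compLp (a 1 1)),
    Lp.coeFn_add ((S (mkSym 1 0 0)).compLp (a 0 0) + (S (mkSym 0 1 0)).compLp (a 0 1))
      ((S (mkSym 0 0 1)).compLp (a 1 1)),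
    Lp.coeFn_add ((S (mkSym 1 0 0)).compLp (a 0 0)) ((S (mkSym 0 1 0)).compLp (a 0 1)),
    (S (mkSym 1 0 0)).coeFn_compLp' (a 0 0), (S (mkSym 0 1 0)).coeFn_compLp' (a 0 1),
    (S (mkSym 0 0 1)).coeFn_compLp' (a 1 1)] with x h1 h2 h3 h4 h5 h6
  rw [h1, h2, Pi.add_apply, h3, Pi.add_apply, h4, h5, h6]
  simp only [S, ContinuousLinearMap.toSpanSingleton_apply, map_add, map_smul, entL_mkSym]
  fin_cases i <;> fin_cases j <;> simp
  rw [hs]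

theorem inner_eq_sum_ent (X Y : Lp E 2 torusMeasure) :
    inner ℝ X Y = ∑ i, ∑ j, inner ℝ (ent i j X) (ent i j Y) := by
  have h : ∀ i j, inner ℝ (ent i j X) (ent i j Y) =
      ∫ x, entL i j (X x) * entL i j (Y x) ∂torusMeasure := fun i j => by
    rw [inner_eq_integral_mul]
    refine integral_congr_ae ?_
    filter_upwards [coeFn_ent i j X, coeFn_ent i j Y] with x h1 h2
    rw [h1, h2]
  have hi : ∀ i j, Integrable (fun x => entL i j (X x) * entL i j (Y x)) torusMeasure :=
    fun i j => by
      refine (L2.integrable_inner (𝕜 := ℝ) (ent i j Y) (ent i j X)).congr ?_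
      filter_upwards [coeFn_ent i j X, coeFn_ent i j Y] with x h1 h2
      rw [h1, h2]; simp
  simp only [h]
  rw [L2.inner_def]
  simp only [inner_eq_sum_entL]
  rw [integral_finsetSum _ fun i _ => integrable_finsetSum _ fun j _ => hi i j]
  exact Finset.sum_congr rfl fun i _ => integral_finsetSum _ fun j _ => hi i j

/-- The power spectrum of a matrix field. -/
def pw (X : Lp E 2 torusMeasure) (k : Fin 2 → ℤ) : ℝ := ∑ i, ∑ j, ‖fc (ent i j X) k‖ ^ 2

theorem pw_nonneg (X : Lp E 2 torusMeasure) (k : Fin 2 → ℤ) : 0 ≤ pw X k := by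
  unfold pw; positivity

theorem hasSum_pw (X : Lp E 2 torusMeasure) : HasSum (pw X) (‖X‖ ^ 2) := by
  rw [← real_inner_self_eq_norm_sq, inner_eq_sum_ent]
  refine hasSum_sum fun i _ => hasSum_sum fun j _ => ?_
  rw [real_inner_self_eq_norm_sq]
  exact hasSum_fc_sq _

theorem hasSum_inner_ent (X Y : Lp E 2 torusMeasure) :
    HasSum (fun k => ∑ i, ∑ j, conj (fc (ent i j X) k) * fc (ent i j Y) k)
      ((inner ℝ X Y : ℝ) : ℂ) := by
  rw [inner_eq_sum_ent]
  push_cast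
  exact hasSum_sum fun i _ => hasSum_sum fun j _ => hasSum_fc_mul _ _

theorem pw_diff (h : T2) (X : Lp E 2 torusMeasure) (k : Fin 2 → ℤ) :
    pw (diff h X) k = ‖mFourier k h - 1‖ ^ 2 * pw X k := by
  simp only [pw, ent_diff, fc_diff, norm_mul, mul_pow, Finset.mul_sum]

/-! ### Weak derivatives of matrix fields -/

theorem integrable_smooth_smul {φ : T2 → ℝ} (h : SmoothOnTorus φ) (X : Lp E 2 torusMeasure) :
    Integrable (fun x => φ x • X x) torusMeasure := by
  obtain ⟨B, hB⟩ := isCompact_univ.exists_bound_of_continuousOn (f := φ) h.continuous.continuousOn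
  exact ((Lp.memLp X).integrable (by norm_num)).bdd_smul B
    h.continuous.aestronglyMeasurable (.of_forall fun x => hB x (Set.mem_univ x))

theorem isWeakDeriv_iff_ent [CompleteSpace E] {α : ℕ × ℕ} {X W : Lp E 2 torusMeasure} :
    IsWeakDeriv α X W ↔ ∀ i j, IsWeakDeriv α (ent i j X) (ent i j W) := by
  have key : ∀ (φ : T2 → ℝ) (i j) (Z : Lp E 2 torusMeasure), SmoothOnTorus φ →
      ∫ x, φ x • ent i j Z x ∂torusMeasure = entL i j (∫ x, φ x • Z x ∂torusMeasure) := by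
    intro φ i j Z hφ
    rw [← (entL i j).integral_comp_comm (integrable_smooth_smul hφ Z)]
    refine integral_congr_ae ?_
    filter_upwards [coeFn_ent i j Z] with x hx
    rw [hx, map_smul]
  constructor
  · intro h i j φ hφ
    rw [key _ _ _ _ (hφ.multiDeriv α), key _ _ _ _ hφ, h φ hφ, map_smul]
  · intro h φ hφ
    refine SymSpace.ext_entL fun i j => ?_
    rw [map_smul, ← key _ _ _ _ (hφ.multiDeriv α), ← key _ _ _ _ hφ]
    exact h i j φ hφ

variable [CompleteSpace E]

theorem isWeakDeriv_field_iff {α : ℕ × ℕ} {X W : Lp E 2 torusMeasure} :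
    IsWeakDeriv α X W ↔ ∀ i j k, fc (ent i j W) k = sym α k * fc (ent i j X) k := by
  rw [isWeakDeriv_iff_ent]
  exact forall_congr' fun i => forall_congr' fun j => isWeakDeriv_iff

theorem exists_isWeakDeriv {α : ℕ × ℕ} {u : Lp ℝ 2 torusMeasure}
    (h : Summable fun k => ‖sym α k‖ ^ 2 * ‖fc u k‖ ^ 2) :
    ∃ w : Lp ℝ 2 torusMeasure, IsWeakDeriv α u w := by
  obtain ⟨w, hw⟩ := exists_fc_eq (fun k => sym α k * fc u k) (by simpa [mul_pow] using h)
    fun k => by rw [sym_neg, fc_neg_freq, map_mul, conj_sym]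
  exact ⟨w, isWeakDeriv_iff.2 hw⟩

theorem exists_isWeakDeriv_field {α : ℕ × ℕ} {X : Lp E 2 torusMeasure}
    (h : Summable fun k => ‖sym α k‖ ^ 2 * pw X k) : ∃ W : Lp E 2 torusMeasure, IsWeakDeriv α X W := by
  have h1 : ∀ i j, ∃ w : Lp ℝ 2 torusMeasure, IsWeakDeriv α (ent i j X) w := fun i j => by
    refine exists_isWeakDeriv (h.of_nonneg_of_le (fun k => by positivity) fun k => ?_)
    refine mul_le_mul_of_nonneg_left ?_ (by positivity)
    refine le_trans ?_ (Finset.single_le_sum (f := fun i => ∑ j, ‖fc (ent i j X) k‖ ^ 2)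
      (fun _ _ => by positivity) (Finset.mem_univ i))
    exact Finset.single_le_sum (f := fun j => ‖fc (ent i j X) k‖ ^ 2)
      (fun _ _ => by positivity) (Finset.mem_univ j)
  choose w hw using h1
  obtain ⟨W, hW⟩ := exists_field (E := E) w fun i j => eq_of_fc_eq fun k => by
    rw [isWeakDeriv_iff.1 (hw i j), isWeakDeriv_iff.1 (hw j i), ent_symm]
  refine ⟨W, isWeakDeriv_iff_ent.2 fun i j => ?_⟩
  rw [hW]; exact hw i j

theorem pw_isWeakDeriv {α : ℕ × ℕ} {X W : Lp E 2 torusMeasure} (h : IsWeakDeriv α X W) (k : Fin 2 → ℤ) :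
    pw W k = ‖sym α k‖ ^ 2 * pw X k := by
  simp only [pw, isWeakDeriv_field_iff.1 h, norm_mul, mul_pow, Finset.mul_sum]

/-- `D^α X` exists in `L²`. -/
def HasDeriv (α : ℕ × ℕ) (X : Lp E 2 torusMeasure) : Prop := ∃ W : Lp E 2 torusMeasure, IsWeakDeriv α X W

theorem HasDeriv.spec {α : ℕ × ℕ} {X : Lp E 2 torusMeasure} (h : HasDeriv α X) :
    IsWeakDeriv α X (weakDeriv α X) := by
  have : weakDeriv α X = h.choose := dif_pos h
  rw [this]
  exact h.choose_spec

theorem HasDeriv.hasSum {α : ℕ × ℕ} {X : Lp E 2 torusMeasure} (h : HasDeriv α X) :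
    HasSum (fun k => ‖sym α k‖ ^ 2 * pw X k) (‖weakDeriv α X‖ ^ 2) := by
  have := hasSum_pw (weakDeriv α X)
  rwa [show pw (weakDeriv α X) = _ from funext (pw_isWeakDeriv h.spec)] at this

theorem HasDeriv.weakDeriv_eq {α : ℕ × ℕ} {X W : Lp E 2 torusMeasure} (h : IsWeakDeriv α X W) :
    weakDeriv α X = W := by
  have h1 := HasDeriv.spec ⟨W, h⟩
  refine eq_of_ent_eq fun i j => eq_of_fc_eq fun k => ?_
  rw [isWeakDeriv_field_iff.1 h1, isWeakDeriv_field_iff.1 h]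

theorem IsWeakDeriv.sub {α : ℕ × ℕ} {X Y W W' : Lp E 2 torusMeasure} (h : IsWeakDeriv α X W)
    (h' : IsWeakDeriv α Y W') :
    IsWeakDeriv α (X - Y : Lp E 2 torusMeasure) (W - W' : Lp E 2 torusMeasure) := by
  rw [isWeakDeriv_field_iff] at *
  intro i j k
  rw [ent_sub, ent_sub, fc_sub, fc_sub, h, h']; ring

theorem HasDeriv.sub {α : ℕ × ℕ} {X Y : Lp E 2 torusMeasure} (h : HasDeriv α X) (h' : HasDeriv α Y) :
    HasDeriv α (X - Y) := ⟨_, h.spec.sub h'.spec⟩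

theorem HasDeriv.weakDeriv_sub {α : ℕ × ℕ} {X Y : Lp E 2 torusMeasure} (h : HasDeriv α X)
    (h' : HasDeriv α Y) : weakDeriv α (X - Y) = weakDeriv α X - weakDeriv α Y :=
  HasDeriv.weakDeriv_eq (h.spec.sub h'.spec)

/-- Monotonicity of derivatives with respect to the power spectrum. -/
theorem HasDeriv.of_pw_le {α : ℕ × ℕ} {X Y : Lp E 2 torusMeasure} (h : HasDeriv α X)
    (hp : ∀ k, pw Y k ≤ pw X k) : HasDeriv α Y ∧ ‖weakDeriv α Y‖ ≤ ‖weakDeriv α X‖ := by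
  have hle : ∀ k, ‖sym α k‖ ^ 2 * pw Y k ≤ ‖sym α k‖ ^ 2 * pw X k := fun k =>
    mul_le_mul_of_nonneg_left (hp k) (by positivity)
  have h1 : HasDeriv α Y := exists_isWeakDeriv_field
    (h.hasSum.summable.of_nonneg_of_le (fun k => mul_nonneg (by positivity) (pw_nonneg _ _)) hle)
  refine ⟨h1, ?_⟩
  have := hasSum_le hle h1.hasSum h.hasSum
  exact (sq_le_sq₀ (norm_nonneg _) (norm_nonneg _)).1 this

/-- The multi-index of `∂ᵢ ∂ⱼ`. -/
def pairIndex (i j : Fin 2) : ℕ × ℕ := unitIndex i + unitIndex j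

theorem sym_unitIndex (i : Fin 2) (k : Fin 2 → ℤ) : sym (unitIndex i) k = sym1 i k := by
  fin_cases i <;> simp [unitIndex, sym]

theorem sym_add (α β : ℕ × ℕ) (k : Fin 2 → ℤ) : sym (α + β) k = sym α k * sym β k := by
  simp [sym, pow_add]; ring

theorem sym_pairIndex (i j : Fin 2) (k : Fin 2 → ℤ) :
    sym (pairIndex i j) k = sym1 i k * sym1 j k := by
  rw [pairIndex, sym_add, sym_unitIndex, sym_unitIndex]

/-! ### Difference quotients -/

theorem norm_exp_mul_I_sub_one_le (t : ℝ) : ‖Complex.exp (t * Complex.I) - 1‖ ≤ |t| := by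
  rw [mul_comm]; exact Real.norm_exp_I_mul_ofReal_sub_one_le

theorem norm_mFourier_axis_sub_one_le (k : Fin 2 → ℤ) (i : Fin 2) (t : ℝ) :
    ‖mFourier k (axis i t) - 1‖ ≤ |t| * ‖sym1 i k‖ := by
  rw [mFourier_axis]
  have := norm_exp_mul_I_sub_one_le (2 * Real.pi * k i * t)
  have e : (2 * Real.pi * Complex.I * k i * t : ℂ) =
      ((2 * Real.pi * k i * t : ℝ) : ℂ) * Complex.I := by push_cast; ring
  rw [e]
  refine this.trans (le_of_eq ?_)
  simp [sym1, abs_mul]; ring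

theorem tendsto_mFourier_axis (k : Fin 2 → ℤ) (i : Fin 2) :
    Filter.Tendsto (fun t : ℝ => ‖mFourier k (axis i t) - 1‖ / t)
      (nhdsWithin 0 (Set.Ioi 0)) (nhds ‖sym1 i k‖) := by
  have h := (hasDerivAt_mFourier_axis k i 0 0).tendsto_slope_zero_right
  have e : axis i 0 = 0 := by simp [axis]
  have e2 : mFourier k (0 : T2) = 1 := by
    have := mFourier_axis k i 0
    rw [e] at this; rw [this]; simp
  simp only [zero_add, e, e2, mul_one] at h
  refine (h.norm).congr' ?_
  filter_upwards [self_mem_nhdsWithin] with t ht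
  rw [norm_smul, norm_inv, Real.norm_of_nonneg (le_of_lt ht)]
  field_simp

theorem norm_diff_le {X : Lp E 2 torusMeasure} {i : Fin 2} (h : HasDeriv (unitIndex i) X) (t : ℝ) :
    ‖diff (axis i t) X‖ ≤ |t| * ‖weakDeriv (unitIndex i) X‖ := by
  refine (sq_le_sq₀ (norm_nonneg _) (by positivity)).1 ?_
  rw [mul_pow]
  refine hasSum_le (fun k => ?_) (hasSum_pw _) (h.hasSum.mul_left (|t| ^ 2))
  rw [pw_diff, sym_unitIndex, ← mul_assoc, ← mul_pow]
  gcongr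
  · exact pw_nonneg _ _
  · exact norm_mFourier_axis_sub_one_le k i t

theorem norm_diff_diff_le {X : Lp E 2 torusMeasure} {i j : Fin 2} (h : HasDeriv (pairIndex i j) X) (t : ℝ) :
    ‖diff (axis i t) (diff (axis j t) X)‖ ≤ t ^ 2 * ‖weakDeriv (pairIndex i j) X‖ := by
  refine (sq_le_sq₀ (norm_nonneg _) (by positivity)).1 ?_
  rw [mul_pow]
  refine hasSum_le (fun k => ?_) (hasSum_pw _) (h.hasSum.mul_left ((t ^ 2) ^ 2))
  rw [pw_diff, pw_diff, sym_pairIndex, ← mul_assoc, ← mul_assoc, ← mul_pow, ← mul_pow, norm_mul]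
  have hle : ‖mFourier k (axis i t) - 1‖ * ‖mFourier k (axis j t) - 1‖ ≤
      t ^ 2 * (‖sym1 i k‖ * ‖sym1 j k‖) :=
    calc _ ≤ (|t| * ‖sym1 i k‖) * (|t| * ‖sym1 j k‖) := by
          gcongr <;> exact norm_mFourier_axis_sub_one_le k _ t
      _ = _ := by rw [← sq_abs t]; ring
  exact mul_le_mul_of_nonneg_right (pow_le_pow_left₀ (by positivity) hle 2) (pw_nonneg _ _)

/-- Fatou on the Fourier side: the multipliers `m t` of the difference quotients converge to the
symbol, and a bound on finite partial sums uniform in t passes to the limit with the same constant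
M. -/
theorem hasDeriv_of_tendsto {α : ℕ × ℕ} {X : Lp E 2 torusMeasure} {M : ℝ} (hM : 0 ≤ M)
    (m : ℝ → (Fin 2 → ℤ) → ℝ)
    (hm : ∀ k, Filter.Tendsto (fun t => m t k) (nhdsWithin 0 (Set.Ioi 0)) (nhds ‖sym α k‖))
    (hb : ∀ᶠ t in nhdsWithin (0 : ℝ) (Set.Ioi 0), ∀ s : Finset (Fin 2 → ℤ),
      ∑ k ∈ s, m t k ^ 2 * pw X k ≤ M ^ 2) :
    HasDeriv α X ∧ ‖weakDeriv α X‖ ≤ M := by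
  have h1 : ∀ s : Finset (Fin 2 → ℤ), ∑ k ∈ s, ‖sym α k‖ ^ 2 * pw X k ≤ M ^ 2 := fun s => by
    refine le_of_tendsto (tendsto_finsetSum s fun k _ => ((hm k).pow 2).mul_const _)
      (hb.mono fun t ht => ht s)
  have h2 : HasDeriv α X := exists_isWeakDeriv_field
    (summable_of_sum_le (fun k => mul_nonneg (by positivity) (pw_nonneg _ _)) h1)
  refine ⟨h2, (sq_le_sq₀ (norm_nonneg _) hM).1 ?_⟩
  exact hasSum_le_of_sum_le h2.hasSum h1

theorem hasDeriv_of_norm_diff_le {X : Lp E 2 torusMeasure} {i : Fin 2} {M : ℝ} (hM : 0 ≤ M)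
    (h : ∀ t : ℝ, 0 < t → ‖diff (axis i t) X‖ ≤ t * M) :
    HasDeriv (unitIndex i) X ∧ ‖weakDeriv (unitIndex i) X‖ ≤ M := by
  refine hasDeriv_of_tendsto hM (fun t k => ‖mFourier k (axis i t) - 1‖ / t) (fun k => ?_) ?_
  · rw [sym_unitIndex]; exact tendsto_mFourier_axis k i
  · filter_upwards [self_mem_nhdsWithin] with t (ht : 0 < t) s
    have h1 := sum_le_hasSum s (fun k _ => pw_nonneg _ k) (hasSum_pw (diff (axis i t) X))
    have h2 : ‖diff (axis i t) X‖ ^ 2 ≤ (t * M) ^ 2 := by gcongr; exact h t ht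
    have h3 : ∑ k ∈ s, (‖mFourier k (axis i t) - 1‖ / t) ^ 2 * pw X k =
        (∑ k ∈ s, pw (diff (axis i t) X) k) / t ^ 2 := by
      rw [Finset.sum_div]
      exact Finset.sum_congr rfl fun k _ => by rw [pw_diff]; ring
    rw [h3, div_le_iff₀ (by positivity)]
    linarith [mul_pow t M 2, mul_comm (M ^ 2) (t ^ 2)]

theorem hasDeriv_of_norm_diff_diff_le {X : Lp E 2 torusMeasure} {i j : Fin 2} {M : ℝ} (hM : 0 ≤ M)
    (h : ∀ t : ℝ, 0 < t → ‖diff (axis i t) (diff (axis j t) X)‖ ≤ t ^ 2 * M) :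
    HasDeriv (pairIndex i j) X ∧ ‖weakDeriv (pairIndex i j) X‖ ≤ M := by
  refine hasDeriv_of_tendsto hM (fun t k => ‖mFourier k (axis i t) - 1‖ / t *
    (‖mFourier k (axis j t) - 1‖ / t)) (fun k => ?_) ?_
  · rw [sym_pairIndex, norm_mul]
    exact (tendsto_mFourier_axis k i).mul (tendsto_mFourier_axis k j)
  · filter_upwards [self_mem_nhdsWithin] with t (ht : 0 < t) s
    have h1 := sum_le_hasSum s (fun k _ => pw_nonneg _ k)
      (hasSum_pw (diff (axis i t) (diff (axis j t) X)))
    have h2 : ‖diff (axis i t) (diff (axis j t) X)‖ ^ 2 ≤ (t ^ 2 * M) ^ 2 := by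
      gcongr; exact h t ht
    have h3 : ∑ k ∈ s, (‖mFourier k (axis i t) - 1‖ / t * (‖mFourier k (axis j t) - 1‖ / t)) ^ 2
        * pw X k = (∑ k ∈ s, pw (diff (axis i t) (diff (axis j t) X)) k) / (t ^ 2) ^ 2 := by
      rw [Finset.sum_div]
      exact Finset.sum_congr rfl fun k _ => by rw [pw_diff, pw_diff]; ring
    rw [h3, div_le_iff₀ (by positivity)]
    linarith [mul_pow (t ^ 2) M 2, mul_comm (M ^ 2) ((t ^ 2) ^ 2)]

/-- The symbols of the differences with steps h' and −h' are complex conjugates. Summation by parts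
in `exists_sq_diff` produces the step −h, which is removed by this lemma. -/
theorem diff_neg_norm (h h' : T2) (X : Lp E 2 torusMeasure) :
    ‖diff h (diff (-h') X)‖ = ‖diff h (diff h' X)‖ := by
  have : ∀ k, pw (diff h (diff (-h') X)) k = pw (diff h (diff h' X)) k := fun k => by
    have e : mFourier k (-h') = conj (mFourier k h') := by
      rw [← mFourier_neg]
      simp only [mFourier, ContinuousMap.coe_mk]
      refine Finset.prod_congr rfl fun i _ => ?_
      simp [fourier_apply]
    have e2 : ‖mFourier k (-h') - 1‖ = ‖mFourier k h' - 1‖ := by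
      rw [e, ← RCLike.norm_conj (mFourier k h' - 1), map_sub, map_one]
    rw [pw_diff, pw_diff, pw_diff, pw_diff, e2]
  have h1 := hasSum_pw (diff h (diff (-h') X))
  rw [funext this] at h1
  have := h1.unique (hasSum_pw _)
  exact (sq_eq_sq₀ (norm_nonneg _) (norm_nonneg _)).1 this

/-- The second difference in a diagonal direction. -/
theorem norm_diff_diff_add_le {X : Lp E 2 torusMeasure} {i j : Fin 2} (hii : HasDeriv (pairIndex i i) X)
    (hij : HasDeriv (pairIndex i j) X) (hjj : HasDeriv (pairIndex j j) X) (t : ℝ) :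
    ‖diff (axis i t + axis j t) (diff (axis i t + axis j t) X)‖ ≤
      t ^ 2 * (‖weakDeriv (pairIndex i i) X‖ + 2 * ‖weakDeriv (pairIndex i j) X‖ +
        ‖weakDeriv (pairIndex j j) X‖) := by
  have h1 : ∀ (a b : T2) (u : Lp E 2 torusMeasure), diff (a + b) u = shift b (diff a u) + diff b u := by
    intro a b u
    have : shift (a + b) u = shift b (shift a u) := by
      apply Lp.ext
      filter_upwards [coeFn_shift (a + b) u, coeFn_shift b (shift a u),
        ae_shift b (coeFn_shift a u)] with x e1 e2 e3
      rw [e1, e2, e3]; congr 1; abel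
    simp only [diff, this, map_sub]; abel
  have hc : ∀ (a b : T2) (u : Lp E 2 torusMeasure), shift a (shift b u) = shift b (shift a u) := by
    intro a b u
    apply Lp.ext
    filter_upwards [coeFn_shift a (shift b u), coeFn_shift b (shift a u),
        ae_shift b (coeFn_shift a u), ae_shift a (coeFn_shift b u)] with x e1 e2 e3 e4
    rw [e1, e2, e3, e4]; congr 1; abel
  have hd : ∀ (a b : T2) (u : Lp E 2 torusMeasure), diff a (shift b u) = shift b (diff a u) := by
    intro a b u
    simp only [diff, map_sub, hc a b u]
  have hdc : ∀ (a b : T2) (u : Lp E 2 torusMeasure), diff a (diff b u) = diff b (diff a u) := by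
    intro a b u
    simp only [diff, map_sub, hc a b u]; abel
  have hn : ∀ (b : T2) (u : Lp E 2 torusMeasure), ‖shift b u‖ = ‖u‖ := fun b u =>
    Lp.norm_compMeasurePreserving u (measurePreserving_shift b)
  have hda : ∀ (a : T2) (u v : Lp E 2 torusMeasure), diff a (u + v) = diff a u + diff a v := by
    intro a u v; simp only [diff, map_add]; abel
  set a := axis i t
  set b := axis j t
  -- This is the square of Δ_{a+b} = S_b Δ_a + Δ_b, where S_b is the translation; the operators
  -- commute and S_b is an isometry.
  have e : diff (a + b) (diff (a + b) X) =
      shift b (shift b (diff a (diff a X))) + shift b (diff a (diff b X)) +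
        shift b (diff a (diff b X)) + diff b (diff b X) := by
    rw [h1 a b X, h1 a b, hda, hda, map_add, hd, hd b b, hdc b a X]; abel
  rw [e]
  have n1 := norm_diff_diff_le hii t
  have n2 := norm_diff_diff_le hij t
  have n3 := norm_diff_diff_le hjj t
  calc _ ≤ ‖shift b (shift b (diff a (diff a X)))‖ + ‖shift b (diff a (diff b X))‖ +
        ‖shift b (diff a (diff b X))‖ + ‖diff b (diff b X)‖ := norm_add₄_le
    _ ≤ _ := by rw [hn, hn, hn]; linarith

end MongeAmpereTorus

end

noncomputable section

set_option linter.unusedSectionVars false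

namespace MongeAmpereTorus

open UnitAddTorus ComplexConjugate SymSpace

variable {E : Type} [NormedAddCommGroup E] [InnerProductSpace ℝ E] [SymSpace E] [CompleteSpace E]

/-! ### The space of Hessians -/

/-- The Hessians of mean-zero `H²` functions. -/
def hessians (E : Type) [NormedAddCommGroup E] [InnerProductSpace ℝ E] [SymSpace E] :
    Set (Lp E 2 torusMeasure) :=
  {X | ∃ v : Lp ℝ 2 torusMeasure, MemH 2 v ∧ ∫ x, v x ∂torusMeasure = 0 ∧
    ∀ i j : Fin 2, IsWeakDeriv (pairIndex i j) v fun x => entL i j (X x)}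

theorem isWeakDeriv_entL_iff {α : ℕ × ℕ} {v : Lp ℝ 2 torusMeasure} {X : Lp E 2 torusMeasure}
    {i j : Fin 2} : IsWeakDeriv α v (fun x => entL i j (X x)) ↔
      ∀ k, fc (ent i j X) k = sym α k * fc v k := by
  rw [← isWeakDeriv_iff]
  exact ⟨fun h => h.congr .rfl (coeFn_ent i j X).symm, fun h => h.congr .rfl (coeFn_ent i j X)⟩

theorem exists_ne_zero_of_freq {k : Fin 2 → ℤ} (hk : k ≠ 0) : ∃ i, k i ≠ 0 := by
  by_contra! h
  exact hk (funext h)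

theorem one_le_sq_freq {k : Fin 2 → ℤ} (hk : k ≠ 0) : (1 : ℝ) ≤ (k 0 : ℝ) ^ 2 + (k 1 : ℝ) ^ 2 := by
  obtain ⟨i, hi⟩ := exists_ne_zero_of_freq hk
  have h1 : (1 : ℝ) ≤ (k i : ℝ) ^ 2 := by
    have : (1 : ℤ) ≤ k i ^ 2 := by
      have := sq_pos_of_ne_zero hi
      omega
    exact_mod_cast this
  fin_cases i
  · exact le_trans h1 (by simp [sq_nonneg])
  · exact le_trans h1 (by simp [sq_nonneg])

theorem norm_sym1 (i : Fin 2) (k : Fin 2 → ℤ) : ‖sym1 i k‖ = 2 * Real.pi * |(k i : ℝ)| := by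
  simp [sym1, abs_of_pos Real.pi_pos]

theorem sym1_mul_sym1 (i j : Fin 2) (k : Fin 2 → ℤ) :
    sym1 i k * sym1 j k = -(4 * Real.pi ^ 2) * (k i * k j) := by
  simp only [sym1]
  linear_combination (4 * Real.pi ^ 2 * (k i : ℂ) * k j) * Complex.I_sq

theorem norm_sym_le {α : ℕ × ℕ} (hα : α.1 + α.2 ≤ 2) {k : Fin 2 → ℤ} (hk : k ≠ 0) :
    ‖sym α k‖ ≤ 4 * Real.pi ^ 2 * ((k 0 : ℝ) ^ 2 + (k 1 : ℝ) ^ 2) := by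
  have h1 := one_le_sq_freq hk
  have hpi := Real.pi_gt_three
  rw [sym, norm_mul, norm_pow, norm_pow, norm_sym1, norm_sym1]
  set x := 2 * Real.pi * |(k 0 : ℝ)| with hx
  set y := 2 * Real.pi * |(k 1 : ℝ)| with hy
  have hx0 : 0 ≤ x := by positivity
  have hy0 : 0 ≤ y := by positivity
  have hR : 4 * Real.pi ^ 2 * ((k 0 : ℝ) ^ 2 + (k 1 : ℝ) ^ 2) = x ^ 2 + y ^ 2 := by
    rw [hx, hy, mul_pow, mul_pow, mul_pow, mul_pow, sq_abs, sq_abs]; ring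
  have hR1 : 1 ≤ x ^ 2 + y ^ 2 := by
    rw [← hR]; nlinarith
  rw [hR]
  obtain ⟨a, b⟩ := α
  simp only at hα ⊢
  have ha : a ≤ 2 := by omega
  have hb : b ≤ 2 := by omega
  interval_cases a <;> interval_cases b <;> first
    | (exfalso; omega)
    | nlinarith [sq_nonneg (x - 1), sq_nonneg (y - 1), sq_nonneg (x - y)]

theorem pw_of_rank_one {X : Lp E 2 torusMeasure} {c : (Fin 2 → ℤ) → ℂ}
    (h : ∀ i j k, fc (ent i j X) k = c k * (k i * k j)) (k : Fin 2 → ℤ) :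
    pw X k = ‖c k‖ ^ 2 * ((k 0 : ℝ) ^ 2 + (k 1 : ℝ) ^ 2) ^ 2 := by
  simp only [pw, h, norm_mul, mul_pow, Fin.sum_univ_two, Complex.norm_intCast, sq_abs]
  ring

/-- The symbol of ∂ᵢ∂ⱼ is −4π² kᵢ kⱼ, so v is recovered by dividing by −4π². Since |2πk| ≥ 1 off the
origin, every derivative of v of order at most two is dominated by the spectrum of `X`. -/
theorem mem_hessians_iff {X : Lp E 2 torusMeasure} :
    X ∈ hessians E ↔ ∃ c : (Fin 2 → ℤ) → ℂ, ∀ i j k, fc (ent i j X) k = c k * (k i * k j) := by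
  constructor
  · rintro ⟨v, -, -, h⟩
    refine ⟨fun k => -(4 * Real.pi ^ 2) * fc v k, fun i j k => ?_⟩
    rw [isWeakDeriv_entL_iff.1 (h i j), sym_pairIndex, sym1_mul_sym1]; ring
  · rintro ⟨c, hc⟩
    have hpi : (4 * Real.pi ^ 2 : ℂ) ≠ 0 := by
      have := Real.pi_ne_zero
      exact_mod_cast (by positivity : (4 * Real.pi ^ 2 : ℝ) ≠ 0)
    -- The value 0 at k = 0 is the mean-zero normalisation; `c 0` is arbitrary, since it only occurs
    -- multiplied by 0.
    let a : (Fin 2 → ℤ) → ℂ := fun k => if k = 0 then 0 else -(c k / (4 * Real.pi ^ 2))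
    have hsymc : ∀ k, k ≠ 0 → c (-k) = conj (c k) := by
      intro k hk
      obtain ⟨i, hi⟩ := exists_ne_zero_of_freq hk
      have h1 := fc_neg_freq (ent i i X) k
      rw [hc, hc] at h1
      simp only [Pi.neg_apply, map_mul, map_intCast] at h1
      push_cast at h1
      have h2 : ((k i : ℂ)) * k i ≠ 0 := by
        have : (k i : ℂ) ≠ 0 := by exact_mod_cast hi
        exact mul_ne_zero this this
      apply mul_right_cancel₀ h2
      linear_combination h1
    have hbound : ∀ α : ℕ × ℕ, α.1 + α.2 ≤ 2 → ∀ k, ‖sym α k‖ ^ 2 * ‖a k‖ ^ 2 ≤ pw X k := by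
      intro α hα k
      by_cases hk : k = 0
      · simp only [a, hk, if_true, norm_zero]
        simpa using pw_nonneg X 0
      · rw [pw_of_rank_one hc, ← mul_pow, ← mul_pow]
        refine pow_le_pow_left₀ (by positivity) ?_ 2
        have e : ‖a k‖ = ‖c k‖ / (4 * Real.pi ^ 2) := by
          simp only [a, hk, if_false, norm_neg, norm_div, norm_mul, norm_pow, Complex.norm_real]
          simp
        rw [e]
        have := norm_sym_le hα hk
        have hp : 0 < 4 * Real.pi ^ 2 := by have := Real.pi_pos; positivity
        rw [mul_div_assoc', div_le_iff₀ hp]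
        nlinarith [norm_nonneg (c k)]
    obtain ⟨v, hv⟩ := exists_fc_eq a
      ((hasSum_pw X).summable.of_nonneg_of_le (fun k => by positivity) fun k => by
        simpa [sym] using hbound (0, 0) (by simp) k)
      (fun k => by
        by_cases hk : k = 0
        · simp [a, hk]
        · have hk' : -k ≠ 0 := neg_ne_zero.2 hk
          have h2 : conj (2 : ℂ) = 2 := map_ofNat _ 2
          have h4 : conj (4 : ℂ) = 4 := map_ofNat _ 4
          simp only [a, hk, hk', if_false, hsymc k hk, map_neg, map_div₀, map_mul, map_pow,
            Complex.conj_ofReal, h4])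
    refine ⟨v, fun α hα => ?_, ?_, fun i j => ?_⟩
    · refine exists_isWeakDeriv ((hasSum_pw X).summable.of_nonneg_of_le
        (fun k => by positivity) fun k => ?_)
      rw [hv]; exact hbound α hα k
    · have h0 := hv 0
      have : fc v 0 = ((∫ x, v x ∂torusMeasure : ℝ) : ℂ) := by
        rw [← integral_complex_ofReal]
        unfold fc mFourierCoeff
        rw [neg_zero, mFourier_zero]
        simp
        rfl
      rw [this] at h0
      simpa [a] using h0
    · rw [isWeakDeriv_entL_iff]
      intro k
      rw [hc, hv, sym_pairIndex, sym1_mul_sym1]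
      by_cases hk : k = 0
      · simp [hk, a]
      · simp only [a, hk, if_false]
        field_simp

theorem hessians_sub {X Y : Lp E 2 torusMeasure} (hX : X ∈ hessians E) (hY : Y ∈ hessians E) :
    X - Y ∈ hessians E := by
  rw [mem_hessians_iff] at *
  obtain ⟨c, hc⟩ := hX
  obtain ⟨d, hd⟩ := hY
  exact ⟨fun k => c k - d k, fun i j k => by rw [ent_sub, fc_sub, hc, hd]; ring⟩

theorem hessians_diff {X : Lp E 2 torusMeasure} (hX : X ∈ hessians E) (h : T2) :
    diff h X ∈ hessians E := by
  rw [mem_hessians_iff] at *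
  obtain ⟨c, hc⟩ := hX
  exact ⟨fun k => (mFourier k h - 1) * c k, fun i j k => by rw [ent_diff, fc_diff, hc]; ring⟩

/-- The determinant of a Hessian has mean zero. -/
theorem hessians_inner {X : Lp E 2 torusMeasure} (hX : X ∈ hessians E) :
    inner ℝ (ent 0 0 X) (ent 1 1 X) = inner ℝ (ent 0 1 X) (ent 0 1 X) := by
  rw [mem_hessians_iff] at hX
  obtain ⟨c, hc⟩ := hX
  have h1 := hasSum_fc_mul (ent 0 0 X) (ent 1 1 X)
  have h2 := hasSum_fc_mul (ent 0 1 X) (ent 0 1 X)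
  -- The matrix k⊗k has zero determinant: k₀² · k₁² = (k₀k₁)², so the two series agree term by term.
  have : ∀ k, conj (fc (ent 0 0 X) k) * fc (ent 1 1 X) k =
      conj (fc (ent 0 1 X) k) * fc (ent 0 1 X) k := fun k => by
    rw [hc, hc, hc]
    simp only [map_mul, map_intCast]
    ring
  simp only [this] at h1
  exact_mod_cast h1.unique h2

/-- At each frequency the coefficient matrix is projected orthogonally onto the line spanned by k⊗k,
whose Frobenius norm is `q k` = |k|²; hence the quotient by `q k ^ 2`. Cauchy–Schwarz gives the last
conclusion, which transfers to all Sobolev norms. At k = 0 both `S` and `q` vanish, and division by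
zero gives the right value 0. -/
theorem exists_orthogonal_hessian (X : Lp E 2 torusMeasure) :
    ∃ Y ∈ hessians E, (∀ Z ∈ hessians E, inner ℝ (X - Y) Z = 0) ∧ ∀ k, pw Y k ≤ pw X k := by
  let q : (Fin 2 → ℤ) → ℝ := fun k => (k 0 : ℝ) ^ 2 + (k 1 : ℝ) ^ 2
  let S : (Fin 2 → ℤ) → ℂ := fun k => ∑ i, ∑ j, (k i : ℂ) * k j * fc (ent i j X) k
  let c : (Fin 2 → ℤ) → ℂ := fun k => S k / (q k : ℂ) ^ 2
  have hS : ∀ k, ‖S k‖ ^ 2 ≤ q k ^ 2 * pw X k := by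
    intro k
    have h1 : ‖S k‖ ≤ ∑ p : Fin 2 × Fin 2, (|(k p.1 : ℝ)| * |(k p.2 : ℝ)|) *
        ‖fc (ent p.1 p.2 X) k‖ := by
      rw [Fintype.sum_prod_type]
      refine (norm_sum_le _ _).trans (Finset.sum_le_sum fun i _ => ?_)
      refine (norm_sum_le _ _).trans (Finset.sum_le_sum fun j _ => ?_)
      simp
    have h2 := Finset.sum_mul_sq_le_sq_mul_sq (Finset.univ : Finset (Fin 2 × Fin 2))
      (fun p => |(k p.1 : ℝ)| * |(k p.2 : ℝ)|) (fun p => ‖fc (ent p.1 p.2 X) k‖)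
    refine (pow_le_pow_left₀ (norm_nonneg _) h1 2).trans (h2.trans (le_of_eq ?_))
    rw [Fintype.sum_prod_type, Fintype.sum_prod_type]
    congr 1
    simp only [Fin.sum_univ_two, mul_pow, sq_abs, q]
    ring
  have hq0 : q 0 = 0 := by simp [q]
  have hq : ∀ k, k ≠ 0 → q k ≠ 0 := fun k hk => by
    have := one_le_sq_freq hk
    exact (lt_of_lt_of_le one_pos this).ne'
  have hcle : ∀ k, ‖c k‖ ^ 2 * q k ^ 2 ≤ pw X k := by
    intro k
    by_cases hk : k = 0
    · rw [hk, hq0]; simpa using pw_nonneg X 0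
    · have h3 : 0 < q k ^ 2 := by have := hq k hk; positivity
      have e : ‖c k‖ ^ 2 * q k ^ 2 = ‖S k‖ ^ 2 / q k ^ 2 := by
        simp only [c, norm_div, norm_pow, Complex.norm_real, div_pow, Real.norm_eq_abs, sq_abs]
        field_simp
      rw [e, div_le_iff₀ h3]
      linarith [hS k]
  have hentry : ∀ i j k, ‖c k * (k i * k j)‖ ^ 2 ≤ pw X k := by
    intro i j k
    refine le_trans ?_ (hcle k)
    rw [norm_mul, mul_pow]
    refine mul_le_mul_of_nonneg_left ?_ (by positivity)
    rw [norm_mul, Complex.norm_intCast, Complex.norm_intCast]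
    refine pow_le_pow_left₀ (by positivity) ?_ 2
    have h0 := sq_abs (k 0 : ℝ)
    have h1 := sq_abs (k 1 : ℝ)
    simp only [q]
    rw [← h0, ← h1]
    have n0 := abs_nonneg (k 0 : ℝ)
    have n1 := abs_nonneg (k 1 : ℝ)
    fin_cases i <;> fin_cases j <;> simp <;>
      nlinarith [sq_nonneg (|(k 0 : ℝ)| - |(k 1 : ℝ)|)]
  have hex : ∀ i j, ∃ u : Lp ℝ 2 torusMeasure, ∀ k, fc u k = c k * (k i * k j) := by
    intro i j
    refine exists_fc_eq _ ((hasSum_pw X).summable.of_nonneg_of_le (fun k => by positivity)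
      (hentry i j)) fun k => ?_
    have hqn : q (-k) = q k := by simp [q]
    have hSn : S (-k) = conj (S k) := by
      simp only [S, map_sum, map_mul, fc_neg_freq, map_intCast, Pi.neg_apply]
      push_cast
      simp
    simp only [c, hqn, hSn, map_mul, map_div₀, map_pow, Complex.conj_ofReal,
      map_intCast, Pi.neg_apply]
    push_cast; ring
  choose u hu using hex
  obtain ⟨Y, hY⟩ := exists_field (E := E) u fun i j => eq_of_fc_eq fun k => by
    rw [hu, hu]; ring
  have hYc : ∀ i j k, fc (ent i j Y) k = c k * (k i * k j) := fun i j k => by rw [hY, hu]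
  refine ⟨Y, mem_hessians_iff.2 ⟨c, hYc⟩, fun Z hZ => ?_, fun k => ?_⟩
  · obtain ⟨d, hd⟩ := mem_hessians_iff.1 hZ
    have h1 := hasSum_inner_ent (X - Y) Z
    have h2 : ∀ k, ∑ i, ∑ j, conj (fc (ent i j (X - Y)) k) * fc (ent i j Z) k = 0 := by
      intro k
      have e : ∑ i, ∑ j, conj (fc (ent i j (X - Y)) k) * fc (ent i j Z) k =
          d k * conj (S k - c k * (q k : ℂ) ^ 2) := by
        simp only [ent_sub, fc_sub, hYc, hd, S, q, Fin.sum_univ_two, map_sub, map_add, map_mul,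
          map_intCast, map_pow]
        push_cast
        simp only [map_add, map_pow, map_intCast]
        ring
      rw [e]
      by_cases hk : k = 0
      · simp [hk, S, q]
      · have : (q k : ℂ) ≠ 0 := by exact_mod_cast hq k hk
        simp only [c]
        rw [div_mul_cancel₀ _ (pow_ne_zero 2 this)]
        simp
    simp only [h2] at h1
    exact_mod_cast h1.unique hasSum_zero
  · rw [pw_of_rank_one hYc]
    exact hcle k

/-! ### Uniform bounds -/

theorem norm_le_of_entL_le {A : E} {b : ℝ} (h : ∀ i j, |entL i j A| ≤ b) : ‖A‖ ≤ 2 * b := by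
  have hb : 0 ≤ b := (abs_nonneg _).trans (h 0 0)
  refine (sq_le_sq₀ (norm_nonneg _) (by positivity)).1 ?_
  rw [norm_sq_eq_sum_entL]
  have : ∀ i j, entL i j A ^ 2 ≤ b ^ 2 := fun i j => by
    rw [← sq_abs]; exact pow_le_pow_left₀ (abs_nonneg _) (h i j) 2
  simp only [Fin.sum_univ_two]
  linarith [this 0 0, this 0 1, this 1 0, this 1 1]

theorem ae_norm_le_tsum_sqrt_pw {X : Lp E 2 torusMeasure} (h : Summable fun k => √(pw X k)) :
    ∀ᵐ x ∂torusMeasure, ‖X x‖ ≤ 2 * ∑' k, √(pw X k) := by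
  have hle : ∀ i j k, ‖fc (ent i j X) k‖ ≤ √(pw X k) := fun i j k => by
    refine Real.le_sqrt_of_sq_le ?_
    refine le_trans ?_ (Finset.single_le_sum (f := fun i => ∑ j, ‖fc (ent i j X) k‖ ^ 2)
      (fun _ _ => by positivity) (Finset.mem_univ i))
    exact Finset.single_le_sum (f := fun j => ‖fc (ent i j X) k‖ ^ 2)
      (fun _ _ => by positivity) (Finset.mem_univ j)
  have hs : ∀ i j, Summable fun k => ‖fc (ent i j X) k‖ := fun i j =>
    h.of_nonneg_of_le (fun _ => norm_nonneg _) (hle i j)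
  have : ∀ᵐ x ∂torusMeasure, ∀ i j, |entL i j (X x)| ≤ ∑' k, √(pw X k) := by
    rw [ae_all_iff]; intro i
    rw [ae_all_iff]; intro j
    filter_upwards [ae_abs_le_tsum_fc (hs i j), coeFn_ent i j X] with x h1 h2
    rw [← h2]
    exact h1.trans ((hs i j).tsum_le_tsum (hle i j) h)
  filter_upwards [this] with x hx
  exact norm_le_of_entL_le hx

/-- The weight `1 + |2πk|²`. -/
def weight (k : Fin 2 → ℤ) : ℝ := 1 + (2 * Real.pi) ^ 2 * ∑ i, (k i : ℝ) ^ 2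

theorem weight_pos (k : Fin 2 → ℤ) : 0 < weight k := by unfold weight; positivity

theorem summable_one_add_sq_rpow : Summable fun n : ℤ => (1 + (n : ℝ) ^ 2) ^ (-(3 / 4) : ℝ) := by
  have h := Real.summable_abs_int_rpow (b := 3 / 2) (by norm_num)
  refine Summable.of_norm_bounded_eventually h ?_
  have : {n : ℤ | n = 0}.Finite := Set.finite_singleton 0
  filter_upwards [this.compl_mem_cofinite] with n hn
  have hn0 : (n : ℝ) ≠ 0 := by exact_mod_cast hn
  have hp : 0 < |(n : ℝ)| := abs_pos.2 hn0
  rw [Real.norm_of_nonneg (by positivity)]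
  have e : |(n : ℝ)| ^ (-(3 / 2) : ℝ) = (|(n : ℝ)| ^ 2) ^ (-(3 / 4) : ℝ) := by
    rw [← Real.rpow_natCast, ← Real.rpow_mul hp.le]; norm_num
  rw [e, sq_abs]
  exact Real.rpow_le_rpow_of_nonpos (by positivity) (by linarith) (by norm_num)

/-- This is where the exponent 3/2 exceeds half the dimension. The bound (1 + a)(1 + b) ≤ (1 + a +
b)² for a, b ≥ 0 dominates the sum by a product of two one-dimensional sums with exponent −3/4. -/
theorem summable_weight : Summable fun k => weight k ^ (-(3 / 2) : ℝ) := by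
  have h := summable_one_add_sq_rpow.mul_of_nonneg summable_one_add_sq_rpow
    (fun _ => by positivity) (fun _ => by positivity)
  have h2 := (finTwoArrowEquiv ℤ).summable_iff.2 h
  refine h2.of_nonneg_of_le (fun k => (Real.rpow_pos_of_pos (weight_pos k) _).le) fun k => ?_
  simp only [Function.comp, finTwoArrowEquiv_apply]
  rw [← Real.mul_rpow (by positivity) (by positivity)]
  have e : weight k ^ (-(3 / 2) : ℝ) = (weight k ^ 2) ^ (-(3 / 4) : ℝ) := by
    rw [← Real.rpow_natCast, ← Real.rpow_mul (weight_pos k).le]; norm_num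
  rw [e]
  refine Real.rpow_le_rpow_of_nonpos (by positivity) ?_ (by norm_num)
  have h3 : 1 + ((k 0 : ℝ) ^ 2 + (k 1 : ℝ) ^ 2) ≤ weight k := by
    unfold weight
    rw [Fin.sum_univ_two]
    have := Real.pi_gt_three
    have h4 : (1 : ℝ) ≤ (2 * Real.pi) ^ 2 := by nlinarith
    have h5 : 0 ≤ (k 0 : ℝ) ^ 2 + (k 1 : ℝ) ^ 2 := by positivity
    nlinarith
  change (1 + (k 0 : ℝ) ^ 2) * (1 + (k 1 : ℝ) ^ 2) ≤ weight k ^ 2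
  have h6 : 0 ≤ (k 0 : ℝ) ^ 2 := by positivity
  have h7 : 0 ≤ (k 1 : ℝ) ^ 2 := by positivity
  nlinarith

/-- Sobolev embedding into the absolutely convergent Fourier series. Young's inequality s ≤ δ/w + w
s²/δ replaces Cauchy–Schwarz; the `+ 1` is the contribution of the second term. -/
theorem sqrt_pw_summable {X : Lp E 2 torusMeasure} {δ : ℝ} (hδ : 0 < δ)
    (hs : Summable fun k => weight k ^ (3 / 2 : ℝ) * pw X k)
    (hle : ∑' k, weight k ^ (3 / 2 : ℝ) * pw X k ≤ δ ^ 2) :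
    (Summable fun k => √(pw X k)) ∧
      ∑' k, √(pw X k) ≤ δ * ((∑' k, weight k ^ (-(3 / 2) : ℝ)) + 1) := by
  have hb : ∀ k, √(pw X k) ≤ δ * weight k ^ (-(3 / 2) : ℝ) +
      δ⁻¹ * (weight k ^ (3 / 2 : ℝ) * pw X k) := fun k => by
    have hw := Real.rpow_pos_of_pos (weight_pos k) (3 / 2)
    rw [Real.rpow_neg (weight_pos k).le]
    set w := weight k ^ (3 / 2 : ℝ)
    set s := √(pw X k)
    have h1 : pw X k = s ^ 2 := (Real.sq_sqrt (pw_nonneg X k)).symm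
    have hs0 : 0 ≤ s := Real.sqrt_nonneg _
    rw [h1]
    have h2 : δ * w⁻¹ + δ⁻¹ * (w * s ^ 2) - s = (δ ^ 2 + w ^ 2 * s ^ 2 - s * δ * w) / (δ * w) := by
      field_simp
    have h3 : 0 ≤ (δ ^ 2 + w ^ 2 * s ^ 2 - s * δ * w) / (δ * w) := by
      refine div_nonneg ?_ (by positivity)
      nlinarith [sq_nonneg (δ - w * s), sq_nonneg δ, sq_nonneg (w * s)]
    linarith
  have hsum := (summable_weight.mul_left δ).add (hs.mul_left δ⁻¹)
  have h1 := hsum.of_nonneg_of_le (fun _ => Real.sqrt_nonneg _) hb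
  refine ⟨h1, (h1.tsum_le_tsum hb hsum).trans ?_⟩
  rw [(summable_weight.mul_left δ).tsum_add (hs.mul_left δ⁻¹), tsum_mul_left, tsum_mul_left,
    mul_add, mul_one]
  have : δ⁻¹ * ∑' k, weight k ^ (3 / 2 : ℝ) * pw X k ≤ δ⁻¹ * δ ^ 2 := by gcongr
  have e : δ⁻¹ * δ ^ 2 = δ := by field_simp
  linarith

end MongeAmpereTorus

end

noncomputable section

set_option linter.unusedSectionVars false

namespace MongeAmpereTorus

open SymSpace

variable {E : Type} [NormedAddCommGroup E] [InnerProductSpace ℝ E] [SymSpace E]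

/-! ### Algebra of symmetric matrices -/

/-- The determinant. -/
def detE (A : E) : ℝ := entL 0 0 A * entL 1 1 A - entL 0 1 A ^ 2

/-- The trace. -/
def trE (A : E) : ℝ := entL 0 0 A + entL 1 1 A

/-- The cofactor matrix, which depends linearly on the matrix. -/
def cof : E →ₗ[ℝ] E where
  toFun A := mkSym (entL 1 1 A) (-entL 0 1 A) (entL 0 0 A)
  map_add' A B := ext_entL fun i j => by
    fin_cases i <;> fin_cases j <;> simp [entL_mkSym] <;> ring
  map_smul' c A := ext_entL fun i j => by
    fin_cases i <;> fin_cases j <;> simp [entL_mkSym]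

theorem cof_apply (A : E) : cof A = mkSym (entL 1 1 A) (-entL 0 1 A) (entL 0 0 A) := rfl

@[simp] theorem entL_cof_00 (A : E) : entL 0 0 (cof A) = entL 1 1 A := by
  simp [cof_apply, entL_mkSym]
@[simp] theorem entL_cof_01 (A : E) : entL 0 1 (cof A) = -entL 0 1 A := by
  simp [cof_apply, entL_mkSym]
@[simp] theorem entL_cof_10 (A : E) : entL 1 0 (cof A) = -entL 0 1 A := by
  simp [cof_apply, entL_mkSym]
@[simp] theorem entL_cof_11 (A : E) : entL 1 1 (cof A) = entL 0 0 A := by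
  simp [cof_apply, entL_mkSym]

theorem inner_expand (A B : E) : inner ℝ A B =
    entL 0 0 A * entL 0 0 B + 2 * (entL 0 1 A * entL 0 1 B) + entL 1 1 A * entL 1 1 B := by
  rw [inner_eq_sum_entL]
  simp only [Fin.sum_univ_two]
  rw [entL_symm 1 0 A, entL_symm 1 0 B]; ring

theorem norm_sq_expand (A : E) : ‖A‖ ^ 2 =
    entL 0 0 A ^ 2 + 2 * entL 0 1 A ^ 2 + entL 1 1 A ^ 2 := by
  rw [← real_inner_self_eq_norm_sq, inner_expand]; ring

theorem cof_cof (A : E) : cof (cof A) = A := ext_entL fun i j => by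
  have := entL_symm 1 0 A
  fin_cases i <;> fin_cases j <;> simp [this]

theorem norm_cof (A : E) : ‖cof A‖ = ‖A‖ := by
  have : ‖cof A‖ ^ 2 = ‖A‖ ^ 2 := by
    rw [norm_sq_expand, norm_sq_expand]; simp; ring
  exact (sq_eq_sq₀ (norm_nonneg _) (norm_nonneg _)).1 this

theorem inner_cof_left (A B : E) : inner ℝ (cof A) B = inner ℝ A (cof B) := by
  rw [inner_expand, inner_expand]; simp; ring

theorem inner_cof_cof (A B : E) : inner ℝ (cof A) (cof B) = inner ℝ A B := by
  rw [inner_cof_left, cof_cof]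

theorem detE_add (A B : E) : detE (A + B) = detE A + inner ℝ (cof A) B + detE B := by
  rw [inner_expand]; simp [detE]; ring

theorem abs_two_detE_le (A : E) : 2 * |detE A| ≤ ‖A‖ ^ 2 := by
  rw [norm_sq_expand, detE]
  have h : |entL 0 0 A * entL 1 1 A - entL 0 1 A ^ 2| ≤
      (entL 0 0 A ^ 2 + 2 * entL 0 1 A ^ 2 + entL 1 1 A ^ 2) / 2 := by
    rw [abs_le]
    constructor <;> nlinarith [sq_nonneg (entL 0 0 A - entL 1 1 A),
      sq_nonneg (entL 0 0 A + entL 1 1 A), sq_nonneg (entL 0 1 A)]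
  linarith

/-- The determinant is quadratic with gradient `cof`, so the mean value formula is exact at the
midpoint. First differences therefore carry no quadratic error. -/
theorem detE_sub_eq (A B : E) :
    detE B - detE A = inner ℝ (cof ((1 / 2 : ℝ) • (A + B))) (B - A) := by
  rw [inner_expand]; simp [detE]; ring

theorem abs_detE_sub_le {A B : E} {b : ℝ} (hA : ‖A‖ ≤ b) (hB : ‖B‖ ≤ b) :
    |detE B - detE A| ≤ b * ‖B - A‖ := by
  rw [detE_sub_eq]
  refine (abs_real_inner_le_norm _ _).trans ?_
  rw [norm_cof, norm_smul]
  refine mul_le_mul_of_nonneg_right ?_ (norm_nonneg _)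
  have := norm_add_le A B
  rw [Real.norm_of_nonneg (by norm_num)]
  linarith

/-- `A` has its eigenvalues in `[ν, μ]`. -/
def Ell (ν μ : ℝ) (A : E) : Prop := ∀ a b : ℝ,
  ν * (a ^ 2 + b ^ 2) ≤ entL 0 0 A * a ^ 2 + 2 * entL 0 1 A * (a * b) + entL 1 1 A * b ^ 2 ∧
  entL 0 0 A * a ^ 2 + 2 * entL 0 1 A * (a * b) + entL 1 1 A * b ^ 2 ≤ μ * (a ^ 2 + b ^ 2)

/-- The quadratic form at ξ is the inner product with ξ⊗ξ, whose Frobenius norm is |ξ|². -/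
theorem Ell.perturb {ν μ η : ℝ} {A B : E} (h : Ell ν μ A) (hB : ‖B - A‖ ≤ η) :
    Ell (ν - η) (μ + η) B := by
  intro a b
  have h1 : |inner ℝ (B - A) (mkSym (a ^ 2) (a * b) (b ^ 2) : E)| ≤ η * (a ^ 2 + b ^ 2) := by
    refine (abs_real_inner_le_norm _ _).trans ?_
    have : ‖(mkSym (a ^ 2) (a * b) (b ^ 2) : E)‖ = a ^ 2 + b ^ 2 := by
      refine (sq_eq_sq₀ (norm_nonneg _) (by positivity)).1 ?_
      rw [norm_sq_expand]; simp [entL_mkSym]; ring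
    rw [this]
    exact mul_le_mul_of_nonneg_right hB (by positivity)
  rw [inner_expand, abs_le] at h1
  simp [entL_mkSym] at h1
  have := h a b
  constructor <;> nlinarith

theorem Ell.midpoint {ν μ : ℝ} {A B : E} (hA : Ell ν μ A) (hB : Ell ν μ B) :
    Ell ν μ ((1 / 2 : ℝ) • (A + B)) := by
  intro a b
  have h1 := hA a b
  have h2 := hB a b
  simp
  constructor <;> nlinarith

theorem Ell.mono {ν μ ν' μ' : ℝ} {A : E} (h : Ell ν μ A) (hν : ν' ≤ ν) (hμ : μ ≤ μ') :
    Ell ν' μ' A := fun a b =>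
  ⟨(mul_le_mul_of_nonneg_right hν (by positivity)).trans (h a b).1,
    (h a b).2.trans (mul_le_mul_of_nonneg_right hμ (by positivity))⟩

theorem Ell.entries {ν μ : ℝ} {A : E} (h : Ell ν μ A) :
    ν ≤ entL 0 0 A ∧ ν ≤ entL 1 1 A ∧ entL 0 0 A ≤ μ ∧ entL 1 1 A ≤ μ ∧
      entL 0 1 A ^ 2 ≤ (entL 0 0 A - ν) * (entL 1 1 A - ν) := by
  have h1 := h 1 0
  have h2 := h 0 1
  refine ⟨by simpa using h1.1, by simpa using h2.1, by simpa using h1.2, by simpa using h2.2, ?_⟩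
  have := discrim_le_zero (a := entL 0 0 A - ν) (b := 2 * entL 0 1 A) (c := entL 1 1 A - ν)
    fun x => by nlinarith [(h x 1).1]
  rw [discrim] at this
  nlinarith

theorem Ell.detE_ge {ν μ : ℝ} {A : E} (hν : 0 < ν) (h : Ell ν μ A) : ν ^ 2 ≤ detE A := by
  obtain ⟨h1, h2, -, -, h5⟩ := h.entries
  rw [detE]; nlinarith

theorem Ell.norm_ge {ν μ : ℝ} {A : E} (hν : 0 < ν) (h : Ell ν μ A) : ν ≤ ‖A‖ := by
  have h1 := h.detE_ge hν
  have h2 := abs_two_detE_le A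
  have h3 := le_abs_self (detE A)
  refine (sq_le_sq₀ hν.le (norm_nonneg _)).1 ?_
  nlinarith

theorem Ell.norm_le {ν μ : ℝ} {A : E} (hν : 0 < ν) (h : Ell ν μ A) : ‖A‖ ≤ 2 * μ := by
  obtain ⟨h1, h2, h3, h4, h5⟩ := h.entries
  have hd := h.detE_ge hν
  refine (sq_le_sq₀ (norm_nonneg _) (by linarith)).1 ?_
  rw [detE] at hd
  rw [norm_sq_expand]
  nlinarith

theorem Ell.detE_le {ν μ : ℝ} {A : E} (hν : 0 < ν) (h : Ell ν μ A) : detE A ≤ μ ^ 2 := by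
  obtain ⟨h1, h2, h3, h4, h5⟩ := h.entries
  rw [detE]; nlinarith [sq_nonneg (entL 0 1 A)]

theorem Ell.trE_pos {ν μ : ℝ} {A : E} (hν : 0 < ν) (h : Ell ν μ A) : 0 < trE A := by
  obtain ⟨h1, h2, -⟩ := h.entries
  rw [trE]; linarith

/-- For M positive semidefinite and H symmetric this says (tr MH)² ≥ 2 det M det H. It holds because
MH has real eigenvalues λ₁, λ₂, those of √M H √M, and the difference is λ₁² + λ₂². Multiplication by
P² makes it an explicit sum of squares. -/
theorem psd_two_by_two_inequality {P Q R a b c : ℝ} (hP : 0 ≤ P) (hD : Q ^ 2 ≤ P * R) :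
    0 ≤ (P * a + 2 * Q * b + R * c) ^ 2 - 2 * (P * R - Q ^ 2) * (a * c - b ^ 2) := by
  rcases hP.eq_or_lt with h | h
  · have hQ : Q = 0 := by
      rw [← h, zero_mul] at hD
      exact pow_eq_zero_iff two_ne_zero |>.1 (le_antisymm hD (sq_nonneg Q))
    rw [← h, hQ]; nlinarith [sq_nonneg (R * c)]
  · have h1 : P ^ 2 * ((P * a + 2 * Q * b + R * c) ^ 2 - 2 * (P * R - Q ^ 2) * (a * c - b ^ 2)) =
        (P ^ 2 * a + 2 * P * Q * b + Q ^ 2 * c) ^ 2 +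
          (P * R - Q ^ 2) * (2 * (P * b + Q * c) ^ 2 + (P * R - Q ^ 2) * c ^ 2) := by ring
    have hD' : 0 ≤ P * R - Q ^ 2 := by linarith
    have h2 : 0 ≤ P ^ 2 * ((P * a + 2 * Q * b + R * c) ^ 2 -
        2 * (P * R - Q ^ 2) * (a * c - b ^ 2)) := by rw [h1]; positivity
    exact nonneg_of_mul_nonneg_right h2 (by positivity)

/-- The pointwise form of the Cordes condition in two dimensions. -/
theorem Ell.inner_cof_sq_ge {ν μ : ℝ} {Z : E} (hν : 0 < ν) (h : Ell ν μ Z) (H : E) :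
    ν ^ 2 * ‖H‖ ^ 2 + 2 * detE Z * detE H ≤ inner ℝ (cof Z) H ^ 2 := by
  obtain ⟨h1, h2, -, -, h5⟩ := h.entries
  rw [norm_sq_expand, inner_expand]
  simp only [entL_cof_00, entL_cof_01, entL_cof_11, detE]
  set p := entL 0 0 Z
  set q := entL 0 1 Z
  set r := entL 1 1 Z
  set a := entL 0 0 H
  set b := entL 0 1 H
  set c := entL 1 1 H
  -- Split cof Z = M + νI with M positive semidefinite. The terms free of M give exactly ν²|H|²,
  -- from (tr H)² − 2 det H = |H|², and the terms quadratic in M are nonnegative by the previous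
  -- inequality.
  have key := psd_two_by_two_inequality (P := r - ν) (Q := -q) (R := p - ν) (a := a) (b := b)
    (c := c) (by linarith) (by nlinarith)
  -- The cross terms equal 2ν tr(MH²), by Cayley–Hamilton for H. Here tr(MH²) ≥ 0 is the sum of the
  -- form of M over the rows of H.
  have hx : 0 ≤ (r - ν) * (a ^ 2 + b ^ 2) + 2 * (-q) * (a * b + b * c) +
      (p - ν) * (b ^ 2 + c ^ 2) := by
    have hpsd : ∀ x y : ℝ, 0 ≤ (r - ν) * x ^ 2 + 2 * (-q) * (x * y) + (p - ν) * y ^ 2 := by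
      intro x y
      have := (h (-y) x).1
      nlinarith
    nlinarith [hpsd a b, hpsd b c]
  nlinarith

/-! ### Projection onto the tangent plane -/

/-- The component of `w` orthogonal to `N`. -/
def tanProj (N w : E) : E := w - (inner ℝ N w / ‖N‖ ^ 2) • N

theorem norm_tanProj_sq {N : E} (hN : N ≠ 0) (w : E) :
    ‖tanProj N w‖ ^ 2 = ‖w‖ ^ 2 - inner ℝ N w ^ 2 / ‖N‖ ^ 2 := by
  have hn : ‖N‖ ≠ 0 := norm_ne_zero_iff.2 hN
  rw [tanProj, norm_sub_sq_real, norm_smul, inner_smul_right, mul_pow, Real.norm_eq_abs, sq_abs,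
    real_inner_comm]
  field_simp; ring

theorem norm_tanProj_le {N : E} (hN : N ≠ 0) (w : E) : ‖tanProj N w‖ ≤ ‖w‖ := by
  refine (sq_le_sq₀ (norm_nonneg _) (norm_nonneg _)).1 ?_
  rw [norm_tanProj_sq hN]
  have : 0 ≤ inner ℝ N w ^ 2 / ‖N‖ ^ 2 := by positivity
  linarith

theorem tanProj_sub (N v w : E) : tanProj N (v - w) = tanProj N v - tanProj N w := by
  simp only [tanProj, inner_sub_right, sub_div, sub_smul]; abel

/-- The coefficient of `detE H` must not depend on Z, so that this term integrates to zero. Dividing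
the Cordes inequality by `detE Z` makes the coefficient equal to 2, and only then is the ratio of
`detE Z` to ‖Z‖² bounded below by the constant ν²/(4μ²). -/
theorem Ell.norm_tanProj_sq_le {ν μ : ℝ} {Z : E} (hν : 0 < ν) (h : Ell ν μ Z) (H : E) :
    ‖tanProj (cof Z) H‖ ^ 2 ≤ (1 - ν ^ 4 / (4 * μ ^ 4)) * ‖H‖ ^ 2 - ν ^ 2 / (2 * μ ^ 2) * detE H := by
  have hZ := h.norm_ge hν
  have hZ0 : 0 < ‖Z‖ := hν.trans_le hZ
  have hn : cof Z ≠ 0 := by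
    rw [← norm_ne_zero_iff, norm_cof]; exact hZ0.ne'
  rw [norm_tanProj_sq hn, norm_cof]
  have h1 := h.inner_cof_sq_ge hν H
  have hd := h.detE_ge hν
  have hd' := h.detE_le hν
  have hZ2 := h.norm_le hν
  have hμ : 0 < μ := by linarith
  have hdpos : 0 < detE Z := by nlinarith [pow_pos hν 2]
  have hZsq : ‖Z‖ ^ 2 ≤ 4 * μ ^ 2 := by nlinarith
  have hI : 0 ≤ inner ℝ (cof Z) H ^ 2 := sq_nonneg _
  have h2 : inner ℝ (cof Z) H ^ 2 / ‖Z‖ ^ 2 ≥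
      ν ^ 2 / (4 * μ ^ 2) * (inner ℝ (cof Z) H ^ 2 / detE Z) := by
    rw [ge_iff_le, div_mul_div_comm, div_le_div_iff₀ (by positivity) (by positivity)]
    calc ν ^ 2 * inner ℝ (cof Z) H ^ 2 * ‖Z‖ ^ 2 = (ν ^ 2 * ‖Z‖ ^ 2) * inner ℝ (cof Z) H ^ 2 := by
          ring
      _ ≤ (detE Z * (4 * μ ^ 2)) * inner ℝ (cof Z) H ^ 2 := by gcongr
      _ = _ := by ring
  have h3 : inner ℝ (cof Z) H ^ 2 / detE Z ≥ ν ^ 2 / μ ^ 2 * ‖H‖ ^ 2 + 2 * detE H := by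
    rw [ge_iff_le, le_div_iff₀ hdpos]
    have h4 : ν ^ 2 / μ ^ 2 * detE Z ≤ ν ^ 2 := by
      rw [div_mul_eq_mul_div, div_le_iff₀ (by positivity)]
      gcongr
    nlinarith [sq_nonneg ‖H‖]
  have h5 : ν ^ 2 / (4 * μ ^ 2) * (inner ℝ (cof Z) H ^ 2 / detE Z) ≥
      ν ^ 2 / (4 * μ ^ 2) * (ν ^ 2 / μ ^ 2 * ‖H‖ ^ 2 + 2 * detE H) :=
    mul_le_mul_of_nonneg_left h3 (by positivity)
  have h6 : ν ^ 2 / (4 * μ ^ 2) * (ν ^ 2 / μ ^ 2 * ‖H‖ ^ 2 + 2 * detE H) =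
      ν ^ 4 / (4 * μ ^ 4) * ‖H‖ ^ 2 + ν ^ 2 / (2 * μ ^ 2) * detE H := by
    field_simp; ring
  linarith

/-! ### Projection onto a level set of the determinant -/

theorem detE_sub_smul_cof (W : E) (t : ℝ) :
    detE (W - t • cof W) = (1 + t ^ 2) * detE W - t * ‖W‖ ^ 2 := by
  rw [norm_sq_expand]; simp [detE]; ring

theorem detE_smul (c : ℝ) (A : E) : detE (c • A) = c ^ 2 * detE A := by
  simp [detE]; ring

/-- Existence of critical points of the distance to a level set of the determinant. -/
theorem exists_critical {W : E} {φ : ℝ} (htr : 0 < trE W)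
    (h1 : φ / 4 ≤ detE W) (h2 : detE W ≤ 9 / 4 * φ) :
    ∃ (t : ℝ) (Z : E), |t| ≤ 1 / 2 ∧ W = Z + t • cof Z ∧ detE Z = φ ∧ 0 < trE Z := by
  -- Since `cof` is an involution, W = Z + t cof Z is solved by Z = (W − t cof W)/(1 − t²); `g t` is
  -- the determinant of this matrix.
  let g : ℝ → ℝ := fun t => ((1 + t ^ 2) * detE W - t * ‖W‖ ^ 2) / (1 - t ^ 2) ^ 2
  have hpos : ∀ t ∈ Set.Icc (-(1 / 2) : ℝ) (1 / 2), 0 < 1 - t ^ 2 := fun t ht => by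
    nlinarith [ht.1, ht.2]
  have hg : ContinuousOn g (Set.Icc (-(1 / 2) : ℝ) (1 / 2)) := by
    refine ContinuousOn.div (by fun_prop) (by fun_prop) fun t ht => ?_
    exact pow_ne_zero 2 (hpos t ht).ne'
  have hW := abs_two_detE_le W
  have hW' := le_abs_self (detE W)
  -- By ‖W‖² ≥ 2|det W|, the value at t = 1/2 is at most (4/9) det W and the value at t = −1/2 is at
  -- least 4 det W. These are the factors 9/4 and 1/4 of the hypotheses.
  have hmem : φ ∈ Set.Icc (g (1 / 2)) (g (-(1 / 2))) := by
    constructor <;> simp only [g] <;> norm_num <;> nlinarith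
  obtain ⟨t, ht, hgt⟩ := intermediate_value_Icc' (by norm_num) hg hmem
  have hp := hpos t ht
  refine ⟨t, (1 - t ^ 2)⁻¹ • (W - t • cof W), abs_le.2 ht, ?_, ?_, ?_⟩
  · rw [map_smul, map_sub, map_smul, cof_cof, smul_comm t, ← smul_add]
    have : W - t • cof W + t • (cof W - t • W) = (1 - t ^ 2) • W := by module
    rw [this, smul_smul, inv_mul_cancel₀ hp.ne', one_smul]
  · rw [detE_smul, detE_sub_smul_cof, ← hgt]
    simp only [g]; field_simp
  · have e : trE ((1 - t ^ 2)⁻¹ • (W - t • cof W)) = (1 - t ^ 2)⁻¹ * ((1 - t) * trE W) := by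
      simp [trE]; ring
    rw [e]
    have : 0 < 1 - t := by linarith [ht.2]
    positivity

/-- A critical point is the unique nearest point, with a quantitative gap. -/
theorem critical_gap {W Z Z' : E} {t : ℝ} (hW : W = Z + t • cof Z) (hd : detE Z' = detE Z) :
    ‖W - Z‖ ^ 2 + (1 - |t|) * ‖Z' - Z‖ ^ 2 ≤ ‖W - Z'‖ ^ 2 := by
  set d := Z' - Z with hdd
  have e1 : Z' = Z + d := by rw [hdd]; abel
  have h1 := detE_add Z d
  rw [← e1, hd] at h1
  have e2 : W - Z' = (W - Z) - d := by rw [e1]; abel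
  have e3 : W - Z = t • cof Z := by rw [hW]; abel
  rw [e2, norm_sub_sq_real (W - Z) d, e3, inner_smul_left]
  simp only [conj_trivial]
  -- Equality of the determinants makes the first-order term quadratic in d: the cross term of the
  -- expanded square is 2t det d, bounded by |t|‖d‖².
  have h2 : inner ℝ (cof Z) d = -detE d := by linarith
  rw [h2]
  have h3 := abs_two_detE_le d
  have h4 : -(|t| * |detE d|) ≤ t * detE d := by
    rw [← abs_mul]; exact neg_abs_le _
  nlinarith [abs_nonneg t]

/-- The linearised projection problem, solved for z. The tangential projection removes the unknown
multiplier variation l, and g determines the normal component. The two terms carrying t, one normal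
and the other t cof z, account for the factor 2. -/
theorem linear_bound {Z z w : E} {l t g : ℝ} (hZ : 0 < ‖Z‖)
    (hw : w = z + l • cof Z + t • cof z) (hg : inner ℝ (cof Z) z = g) :
    ‖z‖ ≤ ‖tanProj (cof Z) w‖ + |g| / ‖Z‖ + 2 * |t| * ‖z‖ := by
  have hn : ‖cof Z‖ ^ 2 ≠ 0 := by rw [norm_cof]; positivity
  have e : z = tanProj (cof Z) w + ((g + t * inner ℝ Z z) / ‖cof Z‖ ^ 2) • cof Z - t • cof z := by
    have hi : inner ℝ (cof Z) w = g + l * ‖cof Z‖ ^ 2 + t * inner ℝ Z z := by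
      rw [hw, inner_add_right, inner_add_right, inner_smul_right, inner_smul_right, hg,
        real_inner_self_eq_norm_sq, inner_cof_cof]
    have e2 : inner ℝ (cof Z) w / ‖cof Z‖ ^ 2 =
        (g + t * inner ℝ Z z) / ‖cof Z‖ ^ 2 + l := by
      rw [hi, add_right_comm, add_div, mul_div_cancel_right₀ _ hn]
    rw [tanProj, e2, hw, add_smul]; abel
  have h1 : ‖z‖ ≤ ‖tanProj (cof Z) w‖ + ‖((g + t * inner ℝ Z z) / ‖cof Z‖ ^ 2) • cof Z‖ +
      ‖t • cof z‖ := by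
    calc ‖z‖ = _ := congrArg norm e
      _ ≤ _ := (norm_sub_le _ _).trans (by gcongr; exact norm_add_le _ _)
  have h2 : ‖((g + t * inner ℝ Z z) / ‖cof Z‖ ^ 2) • cof Z‖ ≤ |g| / ‖Z‖ + |t| * ‖z‖ := by
    rw [norm_smul, norm_div, norm_pow, norm_norm, norm_cof, Real.norm_eq_abs]
    have h3 : |g + t * inner ℝ Z z| ≤ |g| + |t| * (‖Z‖ * ‖z‖) := by
      refine (abs_add_le _ _).trans ?_
      rw [abs_mul]
      gcongr
      exact abs_real_inner_le_norm _ _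
    calc _ = |g + t * inner ℝ Z z| / ‖Z‖ := by field_simp
      _ ≤ (|g| + |t| * (‖Z‖ * ‖z‖)) / ‖Z‖ := by gcongr
      _ = _ := by field_simp
  have h4 : ‖t • cof z‖ = |t| * ‖z‖ := by rw [norm_smul, norm_cof, Real.norm_eq_abs]
  linarith

/-- `Z` solves, with multiplier `t`, the projection problem with data `W` and level `det P`. -/
structure Critical (n m b Λ : ℝ) (P W Z : E) (t : ℝ) : Prop where
  norm_le : ‖P‖ ≤ b
  ell : Ell n m Z
  eq : W = Z + t • cof Z
  det_eq : detE Z = detE P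
  mult_le : |t| ≤ Λ

/-! ### Stability of the pointwise projection under first and second differences. -/

section Estimates

variable {n m b Λ : ℝ} {P W Z P' W' Z' : E} {t t' : ℝ}

/-- Subtracting the two equations and writing the products with midpoints gives exactly the system
of `linear_bound` at the midpoint of Z and Z', with multiplier (t + t')/2. -/
theorem Critical.first_difference (hn : 0 < n) (h : Critical n m b Λ P W Z t)
    (h' : Critical n m b Λ P' W' Z' t') :
    (1 - 2 * Λ) * ‖Z' - Z‖ ≤
      ‖tanProj (cof ((1 / 2 : ℝ) • (Z + Z'))) (W' - W)‖ + b / n * ‖P' - P‖ := by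
  have hmid := h.ell.midpoint h'.ell
  have hZ := hmid.norm_ge hn
  have hb : 0 ≤ b := (norm_nonneg _).trans h.norm_le
  have key := linear_bound (Z := (1 / 2 : ℝ) • (Z + Z')) (z := Z' - Z) (w := W' - W)
    (l := t' - t) (t := (t + t') / 2) (g := detE Z' - detE Z) (hn.trans_le hZ) (by
      rw [h.eq, h'.eq]
      simp only [map_smul, map_add, map_sub]
      module) (detE_sub_eq Z Z').symm
  have h1 : |detE Z' - detE Z| / ‖(1 / 2 : ℝ) • (Z + Z')‖ ≤ b / n * ‖P' - P‖ := by
    rw [h.det_eq, h'.det_eq, div_mul_eq_mul_div]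
    exact div_le_div₀ (by positivity) (abs_detE_sub_le h.norm_le h'.norm_le) hn hZ
  have h2 : |(t + t') / 2| ≤ Λ := by
    have := abs_le.1 h.mult_le
    have := abs_le.1 h'.mult_le
    rw [abs_le]; constructor <;> linarith
  nlinarith [norm_nonneg (Z' - Z)]

theorem Critical.lipschitz (hn : 0 < n) (hΛ : Λ ≤ 1 / 8) (h : Critical n m b Λ P W Z t)
    (h' : Critical n m b Λ P' W' Z' t') :
    ‖Z' - Z‖ ≤ 2 * (1 + b / n) * (‖W' - W‖ + ‖P' - P‖) := by
  have h1 := h.first_difference hn h'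
  have hmid := h.ell.midpoint h'.ell
  have hb : 0 ≤ b := (norm_nonneg _).trans h.norm_le
  have hb' : 0 ≤ b / n := by positivity
  have h2 := norm_tanProj_le (N := cof ((1 / 2 : ℝ) • (Z + Z'))) (by
    rw [← norm_ne_zero_iff, norm_cof]
    exact (hn.trans_le (hmid.norm_ge hn)).ne') (W' - W)
  have h3 : (1 / 2) * ‖Z' - Z‖ ≤ (1 - 2 * Λ) * ‖Z' - Z‖ := by gcongr; linarith
  nlinarith [norm_nonneg (W' - W), norm_nonneg (P' - P), mul_nonneg hb' (norm_nonneg (W' - W))]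

theorem Critical.multiplier_lipschitz (hn : 0 < n) (hΛ : Λ ≤ 1 / 8)
    (h : Critical n m b Λ P W Z t) (h' : Critical n m b Λ P' W' Z' t') :
    |t' - t| ≤ (1 + 4 * (1 + b / n)) / n * (‖W' - W‖ + ‖P' - P‖) := by
  have h1 := h.lipschitz hn hΛ h'
  have hZ := (h.ell.midpoint h'.ell).norm_ge hn
  have e : (t' - t) • cof ((1 / 2 : ℝ) • (Z + Z')) =
      (W' - W) - (Z' - Z) - ((t + t') / 2) • cof (Z' - Z) := by
    rw [h.eq, h'.eq]
    simp only [map_smul, map_add, map_sub]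
    module
  have h2 : ‖(t' - t) • cof ((1 / 2 : ℝ) • (Z + Z'))‖ ≤
      ‖W' - W‖ + ‖Z' - Z‖ + |(t + t') / 2| * ‖Z' - Z‖ := by
    rw [e]
    refine (norm_sub_le _ _).trans ?_
    rw [norm_smul, norm_cof, Real.norm_eq_abs]
    gcongr
    exact norm_sub_le _ _
  rw [norm_smul, norm_cof, Real.norm_eq_abs] at h2
  have h3 : |(t + t') / 2| ≤ 1 := by
    have := abs_le.1 h.mult_le
    have := abs_le.1 h'.mult_le
    rw [abs_le]; constructor <;> linarith
  rw [div_mul_eq_mul_div, le_div_iff₀ hn]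
  have h4 : |t' - t| * n ≤ |t' - t| * ‖(1 / 2 : ℝ) • (Z + Z')‖ := by gcongr
  nlinarith [norm_nonneg (Z' - Z), norm_nonneg (P' - P)]

end Estimates

/-- Expanding all four points about the fourth, the second difference solves the linear system
frozen at Z₄ up to products of first differences, which the Lipschitz bounds control. K depends on n
and b but not on Λ, so the smallness of Λ can be imposed after K is known. -/
theorem critical_second_difference {n b : ℝ} (m : ℝ) (hn : 0 < n) (hb : 0 ≤ b) :
    ∃ K : ℝ, 0 ≤ K ∧ ∀ Λ : ℝ, Λ ≤ 1 / 8 → ∀ (P₁ P₂ P₃ P₄ W₁ W₂ W₃ W₄ Z₁ Z₂ Z₃ Z₄ : E) (t₁ t₂ t₃ t₄ : ℝ),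
      Critical n m b Λ P₁ W₁ Z₁ t₁ → Critical n m b Λ P₂ W₂ Z₂ t₂ →
      Critical n m b Λ P₃ W₃ Z₃ t₃ → Critical n m b Λ P₄ W₄ Z₄ t₄ →
      (1 - 2 * Λ) * ‖Z₁ - Z₂ - Z₃ + Z₄‖ ≤ ‖tanProj (cof Z₄) (W₁ - W₂ - W₃ + W₄)‖ +
        K * ‖P₁ - P₂ - P₃ + P₄‖ + K * (‖W₁ - W₄‖ ^ 2 + ‖P₁ - P₄‖ ^ 2 + (‖W₂ - W₄‖ ^ 2 +
          ‖P₂ - P₄‖ ^ 2) + (‖W₃ - W₄‖ ^ 2 + ‖P₃ - P₄‖ ^ 2)) := by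
  set L := 2 * (1 + b / n) with hL
  set M := (1 + 4 * (1 + b / n)) / n with hM
  have hL0 : 0 ≤ L := by positivity
  have hM0 : 0 ≤ M := by positivity
  refine ⟨b / n + 2 * (M * L) + (L ^ 2 + 1 / 2) / n, by positivity, ?_⟩
  intro Λ hΛ P₁ P₂ P₃ P₄ W₁ W₂ W₃ W₄ Z₁ Z₂ Z₃ Z₄ t₁ t₂ t₃ t₄ h₁ h₂ h₃ h₄
  have hZ4 := h₄.ell.norm_ge hn
  have hZ4pos := hn.trans_le hZ4
  have hcof : cof Z₄ ≠ 0 := by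
    rw [← norm_ne_zero_iff, norm_cof]; exact hZ4pos.ne'
  -- The quadratic remainder left when each product tᵢ cof Zᵢ is expanded about (t₄, Z₄).
  set r := (t₁ - t₄) • cof (Z₁ - Z₄) - (t₂ - t₄) • cof (Z₂ - Z₄) - (t₃ - t₄) • cof (Z₃ - Z₄)
    with hr
  have hdet : ∀ A B : E, detE A = detE B + inner ℝ (cof B) (A - B) + detE (A - B) := fun A B => by
    rw [← detE_add]; congr 1; abel
  -- The same expansion of the determinant. It is used for both Z and P, whose determinants
  -- coincide, to bound the normal component by second differences of P and squares.
  have hsplit : ∀ A₁ A₂ A₃ A₄ : E, inner ℝ (cof A₄) (A₁ - A₂ - A₃ + A₄) =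
      detE A₁ - detE A₂ - detE A₃ + detE A₄ - (detE (A₁ - A₄) - detE (A₂ - A₄) -
        detE (A₃ - A₄)) := fun A₁ A₂ A₃ A₄ => by
    have : A₁ - A₂ - A₃ + A₄ = (A₁ - A₄) - (A₂ - A₄) - (A₃ - A₄) := by abel
    rw [this, inner_sub_right, inner_sub_right]
    linarith [hdet A₁ A₄, hdet A₂ A₄, hdet A₃ A₄]
  have key := linear_bound (Z := Z₄) (z := Z₁ - Z₂ - Z₃ + Z₄) (w := W₁ - W₂ - W₃ + W₄ - r)
    (l := t₁ - t₂ - t₃ + t₄) (t := t₄) hZ4pos (by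
      rw [hr, h₁.eq, h₂.eq, h₃.eq, h₄.eq]
      simp only [map_add, map_sub]
      module) rfl
  have hsm : ∀ (P W Z : E) (t : ℝ), Critical n m b Λ P W Z t →
      ‖(t - t₄) • cof (Z - Z₄)‖ ≤ 2 * (M * L) * (‖W - W₄‖ ^ 2 + ‖P - P₄‖ ^ 2) ∧
      |detE (Z - Z₄)| ≤ L ^ 2 * (‖W - W₄‖ ^ 2 + ‖P - P₄‖ ^ 2) ∧
      |detE (P - P₄)| ≤ 1 / 2 * (‖W - W₄‖ ^ 2 + ‖P - P₄‖ ^ 2) := by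
    intro P W Z t h
    have e1 := h₄.lipschitz hn hΛ h
    have e2 := h₄.multiplier_lipschitz hn hΛ h
    have e3 := abs_two_detE_le (Z - Z₄)
    have e4 := abs_two_detE_le (P - P₄)
    rw [← hL] at e1
    rw [← hM] at e2
    set u := ‖W - W₄‖
    set v := ‖P - P₄‖
    have hu : 0 ≤ u := norm_nonneg _
    have hv : 0 ≤ v := norm_nonneg _
    have huv : (u + v) ^ 2 ≤ 2 * (u ^ 2 + v ^ 2) := by nlinarith [sq_nonneg (u - v)]
    refine ⟨?_, ?_, by nlinarith [sq_nonneg u]⟩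
    · rw [norm_smul, norm_cof, Real.norm_eq_abs]
      calc _ ≤ (M * (u + v)) * (L * (u + v)) := by gcongr
        _ = M * L * (u + v) ^ 2 := by ring
        _ ≤ M * L * (2 * (u ^ 2 + v ^ 2)) := by gcongr
        _ = _ := by ring
    · have : ‖Z - Z₄‖ ^ 2 ≤ (L * (u + v)) ^ 2 := by gcongr
      nlinarith [sq_nonneg L]
  obtain ⟨a1, b1, c1⟩ := hsm _ _ _ _ h₁
  obtain ⟨a2, b2, c2⟩ := hsm _ _ _ _ h₂
  obtain ⟨a3, b3, c3⟩ := hsm _ _ _ _ h₃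
  set q₁ := ‖W₁ - W₄‖ ^ 2 + ‖P₁ - P₄‖ ^ 2
  set q₂ := ‖W₂ - W₄‖ ^ 2 + ‖P₂ - P₄‖ ^ 2
  set q₃ := ‖W₃ - W₄‖ ^ 2 + ‖P₃ - P₄‖ ^ 2
  have hrn : ‖r‖ ≤ 2 * (M * L) * (q₁ + q₂ + q₃) := by
    have : ‖r‖ ≤ ‖(t₁ - t₄) • cof (Z₁ - Z₄)‖ + ‖(t₂ - t₄) • cof (Z₂ - Z₄)‖ +
        ‖(t₃ - t₄) • cof (Z₃ - Z₄)‖ :=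
      (norm_sub_le _ _).trans (by gcongr; exact norm_sub_le _ _)
    linarith
  have hg : |inner ℝ (cof Z₄) (Z₁ - Z₂ - Z₃ + Z₄)| ≤ b * ‖P₁ - P₂ - P₃ + P₄‖ +
      (L ^ 2 + 1 / 2) * (q₁ + q₂ + q₃) := by
    have e1 := hsplit Z₁ Z₂ Z₃ Z₄
    have e2 := hsplit P₁ P₂ P₃ P₄
    rw [h₁.det_eq, h₂.det_eq, h₃.det_eq, h₄.det_eq] at e1
    have e3 : |inner ℝ (cof P₄) (P₁ - P₂ - P₃ + P₄)| ≤ b * ‖P₁ - P₂ - P₃ + P₄‖ := by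
      refine (abs_real_inner_le_norm _ _).trans ?_
      rw [norm_cof]
      exact mul_le_mul_of_nonneg_right h₄.norm_le (norm_nonneg _)
    rw [abs_le] at b1 b2 b3 c1 c2 c3 e3 ⊢
    constructor <;> linarith [b1.1, b1.2, b2.1, b2.2, b3.1, b3.2]
  have hdiv : |inner ℝ (cof Z₄) (Z₁ - Z₂ - Z₃ + Z₄)| / ‖Z₄‖ ≤
      b / n * ‖P₁ - P₂ - P₃ + P₄‖ + (L ^ 2 + 1 / 2) / n * (q₁ + q₂ + q₃) := by
    refine (div_le_div₀ (by positivity) hg hn hZ4).trans (le_of_eq ?_)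
    ring
  have htan : ‖tanProj (cof Z₄) (W₁ - W₂ - W₃ + W₄ - r)‖ ≤
      ‖tanProj (cof Z₄) (W₁ - W₂ - W₃ + W₄)‖ + ‖r‖ := by
    rw [tanProj_sub]
    exact (norm_sub_le _ _).trans (by gcongr; exact norm_tanProj_le hcof r)
  have ht4 : 2 * |t₄| * ‖Z₁ - Z₂ - Z₃ + Z₄‖ ≤ 2 * Λ * ‖Z₁ - Z₂ - Z₃ + Z₄‖ := by
    gcongr; exact h₄.mult_le
  have hq : 0 ≤ q₁ + q₂ + q₃ := by positivity
  have hx1 : 0 ≤ (2 * (M * L) + (L ^ 2 + 1 / 2) / n) * ‖P₁ - P₂ - P₃ + P₄‖ := by positivity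
  have hx2 : 0 ≤ b / n * (q₁ + q₂ + q₃) := by positivity
  have e : (‖W₁ - W₄‖ ^ 2 + ‖P₁ - P₄‖ ^ 2 + q₂ + q₃) = q₁ + q₂ + q₃ := rfl
  rw [e]
  have k1 : (b / n + 2 * (M * L) + (L ^ 2 + 1 / 2) / n) * ‖P₁ - P₂ - P₃ + P₄‖ =
      b / n * ‖P₁ - P₂ - P₃ + P₄‖ +
        (2 * (M * L) + (L ^ 2 + 1 / 2) / n) * ‖P₁ - P₂ - P₃ + P₄‖ := by ring
  have k2 : (b / n + 2 * (M * L) + (L ^ 2 + 1 / 2) / n) * (q₁ + q₂ + q₃) =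
      b / n * (q₁ + q₂ + q₃) + (2 * (M * L) * (q₁ + q₂ + q₃) +
        (L ^ 2 + 1 / 2) / n * (q₁ + q₂ + q₃)) := by ring
  rw [k1, k2, sub_mul, one_mul]
  linarith

/-- Solvability of the pointwise projection problem near the level set. -/
theorem exists_critical_near {ν μ η : ℝ} (hν : 0 < ν) (hη : 0 ≤ η) (h4 : 4 * η ≤ ν)
    (hs : (2 * μ + 1) * η ≤ 3 / 4 * ν ^ 2) (h1 : η ≤ 1) {P W : E} (hP : Ell ν μ P)
    (hW : ‖W - P‖ ≤ η) :
    ∃ (t : ℝ) (Z : E), Critical (ν / 2) (2 * μ) (2 * μ) (2 * η / ν) P W Z t ∧ 0 < trE Z ∧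
      |t| ≤ 1 / 2 ∧ ‖Z - P‖ ≤ 2 * η := by
  have hdP := hP.detE_ge hν
  have hnP := hP.norm_le hν
  obtain ⟨e1, -, e2, -⟩ := hP.entries
  have hμ : ν ≤ μ := e1.trans e2
  have hnW : ‖W‖ ≤ 2 * μ + 1 := by
    have : ‖W‖ ≤ ‖W - P‖ + ‖P‖ := by simpa using norm_add_le (W - P) P
    linarith
  have hd := abs_detE_sub_le (b := 2 * μ + 1) (by linarith) hnW (A := P) (B := W)
  -- As det P ≥ ν², this puts det W between 1/4 and 7/4 of det P, inside the range required by
  -- `exists_critical`.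
  have hd' : |detE W - detE P| ≤ 3 / 4 * ν ^ 2 :=
    hd.trans ((mul_le_mul_of_nonneg_left hW (by linarith)).trans hs)
  rw [abs_le] at hd'
  have hφ : 0 < detE P := by nlinarith [pow_pos hν 2]
  obtain ⟨t, Z, ht, hWZ, hdet, htr⟩ := exists_critical (φ := detE P)
    ((hP.perturb hW).trE_pos (by linarith)) (by linarith) (by linarith)
  -- P lies on the level set and is a competitor, so ‖W − Z‖ ≤ ‖W − P‖ ≤ η. With W − Z = t cof Z and
  -- ‖Z‖ ≥ ν/2 this also gives |t| ≤ 2η/ν.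
  have hgap := critical_gap hWZ (Z' := P) hdet.symm
  have hWZn : ‖W - Z‖ ≤ η := by
    refine le_trans ?_ hW
    refine (sq_le_sq₀ (norm_nonneg _) (norm_nonneg _)).1 ?_
    nlinarith [sq_nonneg ‖P - Z‖]
  have hZP : ‖Z - P‖ ≤ 2 * η := by
    have e : Z - P = (W - P) - (W - Z) := by abel
    rw [e]
    exact (norm_sub_le _ _).trans (by linarith)
  have hEll : Ell (ν / 2) (2 * μ) Z := (hP.perturb hZP).mono (by linarith) (by linarith)
  refine ⟨t, Z, ⟨hnP, hEll, hWZ, hdet, ?_⟩, htr, ht, hZP⟩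
  have e : W - Z = t • cof Z := by rw [hWZ]; abel
  rw [e, norm_smul, norm_cof, Real.norm_eq_abs] at hWZn
  have := hEll.norm_ge (by linarith)
  rw [le_div_iff₀ hν]
  nlinarith [abs_nonneg t]

end MongeAmpereTorus

end

noncomputable section

set_option linter.unusedSectionVars false

namespace MongeAmpereTorus

open SymSpace

variable {E : Type} [NormedAddCommGroup E] [InnerProductSpace ℝ E]

/-! ### Discrete Gagliardo–Nirenberg inequality -/

theorem norm_cube_sub_le (a c : E) :
    ‖‖a‖ ^ 2 • a - ‖c‖ ^ 2 • c‖ ≤ 3 / 2 * (‖a‖ ^ 2 + ‖c‖ ^ 2) * ‖a - c‖ := by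
  have e : ‖a‖ ^ 2 • a - ‖c‖ ^ 2 • c = ‖a‖ ^ 2 • (a - c) + ((‖a‖ - ‖c‖) * (‖a‖ + ‖c‖)) • c := by
    module
  rw [e]
  refine (norm_add_le _ _).trans ?_
  rw [norm_smul, norm_smul, norm_mul, norm_pow, norm_norm, Real.norm_eq_abs, Real.norm_eq_abs,
    abs_of_nonneg (by positivity : 0 ≤ ‖a‖ + ‖c‖)]
  have h := abs_norm_sub_norm_le a c
  have ha := norm_nonneg a
  have hc := norm_nonneg c
  have hd := norm_nonneg (a - c)
  have h1 : |‖a‖ - ‖c‖| * (‖a‖ + ‖c‖) * ‖c‖ ≤ ‖a - c‖ * (‖a‖ + ‖c‖) * ‖c‖ := by gcongr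
  have h2 : (‖a‖ + ‖c‖) * ‖c‖ ≤ 1 / 2 * ‖a‖ ^ 2 + 3 / 2 * ‖c‖ ^ 2 := by
    nlinarith [sq_nonneg (‖a‖ - ‖c‖)]
  nlinarith

theorem norm_sq_eq_integral (u : Lp E 2 torusMeasure) :
    ‖u‖ ^ 2 = ∫ x, ‖u x‖ ^ 2 ∂torusMeasure := by
  rw [← real_inner_self_eq_norm_sq, L2.inner_def]
  simp only [real_inner_self_eq_norm_sq]

theorem integrable_norm_sq (u : Lp E 2 torusMeasure) :
    Integrable (fun x => ‖u x‖ ^ 2) torusMeasure := by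
  simpa only [real_inner_self_eq_norm_sq] using L2.integrable_inner (𝕜 := ℝ) u u

/-- The norm of a field, as an `L²` function. -/
def normField (u : Lp E 2 torusMeasure) : Lp ℝ 2 torusMeasure := (Lp.memLp u).norm.toLp _

theorem coeFn_normField (u : Lp E 2 torusMeasure) :
    normField u =ᵐ[torusMeasure] fun x => ‖u x‖ := MemLp.coeFn_toLp _

theorem norm_normField (u : Lp E 2 torusMeasure) : ‖normField u‖ = ‖u‖ := by
  refine le_antisymm (Lp.norm_le_norm_of_ae_le ?_) (Lp.norm_le_norm_of_ae_le ?_)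
  all_goals filter_upwards [coeFn_normField u] with x hx; rw [hx, norm_norm]

theorem norm_shift (h : T2) (u : Lp E 2 torusMeasure) : ‖shift h u‖ = ‖u‖ :=
  Lp.norm_compMeasurePreserving u (measurePreserving_shift h)

theorem inner_shift_left (h : T2) (u v : Lp E 2 torusMeasure) :
    inner ℝ u (shift h v) = inner ℝ (shift (-h) u) v := by
  rw [L2.inner_def, L2.inner_def]
  rw [← integral_add_right_eq_self (μ := torusMeasure) (fun x => inner ℝ (shift (-h) u x) (v x)) h]
  refine integral_congr_ae ?_
  filter_upwards [coeFn_shift h v, ae_shift h (coeFn_shift (-h) u)] with x h1 h2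
  rw [h1, h2, add_neg_cancel_right]

/-- Discrete form of ∫|∇u|⁴ = −∫ u · div(|∇u|²∇u) ≤ 3 ‖u‖_∞ ∫ |∇u|² |D²u|. With s = |Δu|² and c =
|Δu|²Δu, one difference is moved from u onto c, `norm_cube_sub_le` bounds the difference of c, and
one factor ‖s‖ is cancelled after Cauchy–Schwarz. -/
theorem exists_sq_diff {u : Lp E 2 torusMeasure} {b : ℝ} (hb : ∀ᵐ x ∂torusMeasure, ‖u x‖ ≤ b)
    (h : T2) : ∃ s : Lp ℝ 2 torusMeasure, (s =ᵐ[torusMeasure] fun x => ‖diff h u x‖ ^ 2) ∧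
      ‖s‖ ≤ 3 * b * ‖diff h (diff (-h) u)‖ := by
  have hb0 : 0 ≤ b := by
    obtain ⟨x, hx⟩ := hb.exists
    exact (norm_nonneg _).trans hx
  have hbd : ∀ᵐ x ∂torusMeasure, ‖diff h u x‖ ≤ 2 * b := by
    filter_upwards [hb, ae_shift h hb, coeFn_diff h u] with x h1 h2 h3
    rw [h3]
    exact (norm_sub_le _ _).trans (by linarith)
  have hmeas : AEStronglyMeasurable (diff h u) torusMeasure := Lp.aestronglyMeasurable _
  have hs : MemLp (fun x => ‖diff h u x‖ ^ 2) 2 torusMeasure := by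
    refine MemLp.of_bound (hmeas.norm.pow 2) ((2 * b) ^ 2) ?_
    filter_upwards [hbd] with x hx
    rw [norm_pow, norm_norm]; gcongr
  have hc : MemLp (fun x => ‖diff h u x‖ ^ 2 • diff h u x) 2 torusMeasure := by
    refine MemLp.of_bound ((hmeas.norm.pow 2).smul hmeas) ((2 * b) ^ 2 * (2 * b)) ?_
    filter_upwards [hbd] with x hx
    rw [norm_smul, norm_pow, norm_norm]; gcongr
  set s := hs.toLp _ with hsdef
  set c := hc.toLp _ with hcdef
  have hsx := hs.coeFn_toLp
  have hcx := hc.coeFn_toLp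
  rw [← hsdef] at hsx
  rw [← hcdef] at hcx
  refine ⟨s, hsx, ?_⟩
  have h1 : ‖s‖ ^ 2 = inner ℝ c (diff h u) := by
    rw [norm_sq_eq_integral, L2.inner_def]
    refine integral_congr_ae ?_
    filter_upwards [hsx, hcx] with x e1 e2
    rw [e1, e2, inner_smul_left, real_inner_self_eq_norm_sq, norm_pow, norm_norm]
    simp only [conj_trivial]; ring
  have h2 : inner ℝ c (diff h u) = inner ℝ (shift (-h) c - c) u := by
    rw [inner_sub_left, ← inner_shift_left, diff, inner_sub_right]
  set D := diff h (diff (-h) u) with hD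
  have h3 : inner ℝ (shift (-h) c - c) u ≤
      inner ℝ (normField D) ((3 / 2 * b) • (shift (-h) s + s)) := by
    rw [L2.inner_def, L2.inner_def]
    refine integral_mono_ae (L2.integrable_inner (𝕜 := ℝ) _ _) (L2.integrable_inner (𝕜 := ℝ) _ _) ?_
    filter_upwards [hb, Lp.coeFn_sub (shift (-h) c) c, coeFn_shift (-h) c, ae_shift (-h) hcx, hcx,
      coeFn_normField D, Lp.coeFn_smul (3 / 2 * b) (shift (-h) s + s),
      Lp.coeFn_add (shift (-h) s) s, coeFn_shift (-h) s, ae_shift (-h) hsx, hsx,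
      coeFn_diff_diff h (-h) u, ae_shift (-h) (coeFn_diff h u), coeFn_diff h u]
      with x e1 e2 e3 e4 e5 e6 e7 e8 e9 e10 e11 e12 e13 e14
    have eD : ‖D x‖ = ‖diff h u (x + -h) - diff h u x‖ := by
      rw [hD, e12, e13, e14]
      congr 1
      rw [add_neg_cancel, add_zero, neg_add_cancel_right]; abel
    simp only [RCLike.inner_apply, conj_trivial]
    rw [e2, Pi.sub_apply, e3, e4, e5, e6, e7, Pi.smul_apply, e8, Pi.add_apply, e9, e10, e11, eD,
      smul_eq_mul]
    calc _ ≤ ‖‖diff h u (x + -h)‖ ^ 2 • diff h u (x + -h) - ‖diff h u x‖ ^ 2 • diff h u x‖ *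
          ‖u x‖ := real_inner_le_norm _ _
      _ ≤ (3 / 2 * (‖diff h u (x + -h)‖ ^ 2 + ‖diff h u x‖ ^ 2) *
          ‖diff h u (x + -h) - diff h u x‖) * b := by
          gcongr
          exact norm_cube_sub_le _ _
      _ = _ := by ring
  have h4 : inner ℝ (normField D) ((3 / 2 * b) • (shift (-h) s + s)) ≤ 3 * b * ‖D‖ * ‖s‖ := by
    refine (real_inner_le_norm _ _).trans ?_
    rw [norm_normField, norm_smul, Real.norm_of_nonneg (by positivity)]
    have : ‖shift (-h) s + s‖ ≤ 2 * ‖s‖ := by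
      refine (norm_add_le _ _).trans ?_
      rw [norm_shift]; linarith
    calc _ ≤ ‖D‖ * (3 / 2 * b * (2 * ‖s‖)) := by gcongr
      _ = _ := by ring
  have h5 : ‖s‖ * ‖s‖ ≤ 3 * b * ‖D‖ * ‖s‖ := by
    rw [← sq, h1, h2]; exact h3.trans h4
  rcases (norm_nonneg s).eq_or_lt with h6 | h6
  · rw [← h6]; positivity
  · exact le_of_mul_le_mul_right h5 h6

/-! ### Contraction of Hessians under the tangential projection -/

variable [SymSpace E] [CompleteSpace E]

theorem continuous_cof : Continuous (cof : E → E) :=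
  (⟨cof, norm_cof⟩ : E →ₗᵢ[ℝ] E).continuous

theorem aestronglyMeasurable_tanProj {N w : T2 → E} (hN : AEStronglyMeasurable N torusMeasure)
    (hw : AEStronglyMeasurable w torusMeasure) :
    AEStronglyMeasurable (fun x => tanProj (N x) (w x)) torusMeasure := by
  unfold tanProj
  refine hw.sub (AEStronglyMeasurable.smul ?_ hN)
  exact ((hN.inner (𝕜 := ℝ) hw).aemeasurable.div (hN.norm.aemeasurable.pow_const 2)).aestronglyMeasurable

/-- Tangential projections strictly contract Hessians. -/
theorem exists_tanProj_field {n m : ℝ} (hn : 0 < n) {Z : T2 → E}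
    (hZm : AEStronglyMeasurable Z torusMeasure) (hZ : ∀ᵐ x ∂torusMeasure, Ell n m (Z x))
    {H : Lp E 2 torusMeasure} (hH : H ∈ hessians E) :
    ∃ s : Lp ℝ 2 torusMeasure, (s =ᵐ[torusMeasure] fun x => ‖tanProj (cof (Z x)) (H x)‖) ∧
      ‖s‖ ≤ √(1 - n ^ 4 / (4 * m ^ 4)) * ‖H‖ := by
  have hne : ∀ᵐ x ∂torusMeasure, cof (Z x) ≠ 0 := by
    filter_upwards [hZ] with x hx
    rw [← norm_ne_zero_iff, norm_cof]
    exact (hn.trans_le (hx.norm_ge hn)).ne'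
  have hmeas : AEStronglyMeasurable (fun x => tanProj (cof (Z x)) (H x)) torusMeasure :=
    aestronglyMeasurable_tanProj (continuous_cof.comp_aestronglyMeasurable hZm)
      (Lp.aestronglyMeasurable _)
  have hmem : MemLp (fun x => ‖tanProj (cof (Z x)) (H x)‖) 2 torusMeasure := by
    refine (Lp.memLp H).mono hmeas.norm ?_
    filter_upwards [hne] with x hx
    rw [norm_norm]; exact norm_tanProj_le hx _
  refine ⟨hmem.toLp _, hmem.coeFn_toLp, ?_⟩
  set θ := 1 - n ^ 4 / (4 * m ^ 4)
  have hdet : ∫ x, detE (H x) ∂torusMeasure = 0 := by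
    have i1 := L2.integrable_inner (𝕜 := ℝ) (ent 0 0 H) (ent 1 1 H)
    have i2 := L2.integrable_inner (𝕜 := ℝ) (ent 0 1 H) (ent 0 1 H)
    have e := hessians_inner hH
    rw [L2.inner_def, L2.inner_def, ← sub_eq_zero, ← integral_sub i1 i2] at e
    rw [← e]
    refine integral_congr_ae ?_
    filter_upwards [coeFn_ent 0 0 H, coeFn_ent 1 1 H, coeFn_ent 0 1 H] with x h1 h2 h3
    rw [h1, h2, h3]
    simp [detE]; ring
  have hdi : Integrable (fun x => detE (H x)) torusMeasure := by
    have i1 := L2.integrable_inner (𝕜 := ℝ) (ent 0 0 H) (ent 1 1 H)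
    have i2 := L2.integrable_inner (𝕜 := ℝ) (ent 0 1 H) (ent 0 1 H)
    refine (i1.sub i2).congr ?_
    filter_upwards [coeFn_ent 0 0 H, coeFn_ent 1 1 H, coeFn_ent 0 1 H] with x h1 h2 h3
    rw [Pi.sub_apply, h1, h2, h3]
    simp [detE]; ring
  have hint : ‖hmem.toLp _‖ ^ 2 ≤ θ * ‖H‖ ^ 2 := by
    have h1 : ‖hmem.toLp _‖ ^ 2 = ∫ x, ‖hmem.toLp _ x‖ ^ 2 ∂torusMeasure := norm_sq_eq_integral _
    rw [h1]
    have h2 : ∫ x, ‖hmem.toLp _ x‖ ^ 2 ∂torusMeasure ≤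
        ∫ x, (θ * ‖H x‖ ^ 2 - n ^ 2 / (2 * m ^ 2) * detE (H x)) ∂torusMeasure := by
      refine integral_mono_ae (integrable_norm_sq (hmem.toLp _))
        (((integrable_norm_sq H).const_mul _).sub (hdi.const_mul _)) ?_
      filter_upwards [hmem.coeFn_toLp, hZ] with x e1 e2
      rw [e1, norm_norm]
      exact e2.norm_tanProj_sq_le hn (H x)
    refine h2.trans (le_of_eq ?_)
    rw [integral_sub ((integrable_norm_sq H).const_mul _) (hdi.const_mul _), integral_const_mul,
      integral_const_mul, hdet, mul_zero, sub_zero, ← norm_sq_eq_integral]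
  by_cases hθ : 0 ≤ θ
  · refine (sq_le_sq₀ (norm_nonneg _) (by positivity)).1 ?_
    rw [mul_pow, Real.sq_sqrt hθ]; exact hint
  -- If θ is negative, the real square root is 0 by convention; the integral bound then forces the
  -- field to vanish, so no comparison of n with m is needed.
  · rw [Real.sqrt_eq_zero_of_nonpos (le_of_not_ge hθ), zero_mul]
    have : ‖hmem.toLp _‖ ^ 2 ≤ 0 :=
      hint.trans (mul_nonpos_of_nonpos_of_nonneg (le_of_not_ge hθ) (sq_nonneg _))
    exact (pow_eq_zero_iff two_ne_zero |>.1 (le_antisymm this (sq_nonneg _))).le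

/-! ### Projection onto the determinant constraint -/

/-- The identity matrix. -/
def idE (E : Type) [NormedAddCommGroup E] [InnerProductSpace ℝ E] [SymSpace E] : E := mkSym 1 0 1

/-- The fields `Q` for which `I + Q` is positive definite with determinant `f`. -/
def levelSet (E : Type) [NormedAddCommGroup E] [InnerProductSpace ℝ E] [SymSpace E]
    (f : T2 → ℝ) : Set (Lp E 2 torusMeasure) :=
  {Q | ∀ᵐ x ∂torusMeasure, detE (idE E + Q x) = f x ∧ 0 < trE (idE E + Q x) ∧
    0 < detE (idE E + Q x)}

/-- The integral of `critical_gap`, with 1 − |t| ≥ 1/2. The quantitative gap yields uniqueness of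
the nearest point. -/
theorem levelSet_gap {f : T2 → ℝ} {Y Z Z' : Lp E 2 torusMeasure} (hZ : Z ∈ levelSet E f)
    (hZ' : Z' ∈ levelSet E f)
    (h : ∀ᵐ x ∂torusMeasure, ∃ t : ℝ, |t| ≤ 1 / 2 ∧
      idE E + Y x = (idE E + Z x) + t • cof (idE E + Z x)) :
    ‖Y - Z‖ ^ 2 + 1 / 2 * ‖Z' - Z‖ ^ 2 ≤ ‖Y - Z'‖ ^ 2 := by
  rw [norm_sq_eq_integral, norm_sq_eq_integral (Z' - Z), norm_sq_eq_integral (Y - Z'),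
    ← integral_const_mul, ← integral_add (integrable_norm_sq _) ((integrable_norm_sq _).const_mul _)]
  refine integral_mono_ae ((integrable_norm_sq _).add ((integrable_norm_sq _).const_mul _))
    (integrable_norm_sq _) ?_
  filter_upwards [h, hZ, hZ', Lp.coeFn_sub Y Z, Lp.coeFn_sub Z' Z, Lp.coeFn_sub Y Z']
    with x ⟨t, ht, e⟩ h1 h2 h3 h4 h5
  have := critical_gap e (Z' := idE E + Z' x) (by rw [h1.1, h2.1])
  simp only [add_sub_add_left_eq_sub] at this
  rw [h3, h4, h5]
  simp only [Pi.sub_apply]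
  nlinarith [sq_nonneg ‖Z' x - Z x‖]

/-- The point is measurability. Any choice of pointwise solutions is Lipschitz in the data by
`Critical.lipschitz`, so it extends to a continuous map that can be composed with the measurable
data. Square integrability follows since the result stays within 2η of P. -/
theorem exists_critical_field [FiniteDimensional ℝ E] {ν μ η : ℝ} (hν : 0 < ν) (hη : 0 ≤ η)
    (h4 : 4 * η ≤ ν) (hs : (2 * μ + 1) * η ≤ 3 / 4 * ν ^ 2) (h1 : η ≤ 1) (hΛ : 2 * η / ν ≤ 1 / 8)
    {P Y : Lp E 2 torusMeasure} (hP : ∀ᵐ x ∂torusMeasure, Ell ν μ (idE E + P x))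
    (hY : ∀ᵐ x ∂torusMeasure, ‖Y x - P x‖ ≤ η) :
    ∃ Z : Lp E 2 torusMeasure, ∀ᵐ x ∂torusMeasure, ∃ t : ℝ,
      Critical (ν / 2) (2 * μ) (2 * μ) (2 * η / ν) (idE E + P x) (idE E + Y x) (idE E + Z x) t ∧
        0 < trE (idE E + Z x) ∧ |t| ≤ 1 / 2 ∧ ‖Z x - P x‖ ≤ 2 * η := by
  let S : Set (E × E) := {p | Ell ν μ p.1 ∧ ‖p.2 - p.1‖ ≤ η}
  have hex : ∀ p : E × E, ∃ Z : E, p ∈ S → ∃ t : ℝ,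
      Critical (ν / 2) (2 * μ) (2 * μ) (2 * η / ν) p.1 p.2 Z t ∧ 0 < trE Z ∧ |t| ≤ 1 / 2 ∧
        ‖Z - p.1‖ ≤ 2 * η := by
    intro p
    by_cases hp : p ∈ S
    · obtain ⟨t, Z, h⟩ := exists_critical_near hν hη h4 hs h1 hp.1 hp.2
      exact ⟨Z, fun _ => ⟨t, h⟩⟩
    · exact ⟨0, fun h => absurd h hp⟩
  choose G hG using hex
  by_cases hS : S.Nonempty
  swap
  · obtain ⟨x, hx1, hx2⟩ := (hP.and hY).exists
    exact absurd ⟨(idE E + P x, idE E + Y x), hx1, by simpa using hx2⟩ hS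
  have hμ : 0 ≤ μ := by
    obtain ⟨p, hp⟩ := hS
    obtain ⟨e1, -, e2, -⟩ := hp.1.entries
    linarith
  set L : ℝ := 2 * (1 + (2 * μ) / (ν / 2)) * 2 with hL
  have hL0 : 0 ≤ L := by positivity
  have hlip : LipschitzOnWith L.toNNReal G S := by
    refine LipschitzOnWith.of_dist_le_mul fun p hp q hq => ?_
    obtain ⟨t, ht, -⟩ := hG p hp
    obtain ⟨t', ht', -⟩ := hG q hq
    have := ht'.lipschitz (by linarith) hΛ ht
    rw [Real.coe_toNNReal _ hL0, dist_eq_norm, dist_eq_norm]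
    have n1 : ‖p.1 - q.1‖ ≤ ‖p - q‖ := norm_fst_le (p - q)
    have n2 : ‖p.2 - q.2‖ ≤ ‖p - q‖ := norm_snd_le (p - q)
    calc _ ≤ _ := this
      _ ≤ 2 * (1 + (2 * μ) / (ν / 2)) * (‖p - q‖ + ‖p - q‖) := by gcongr
      _ = _ := by rw [hL]; ring
  obtain ⟨g, hg, hgG⟩ := hlip.extend_finite_dimension
  let F : T2 → E := fun x => g (idE E + P x, idE E + Y x) - idE E
  have hFm : AEStronglyMeasurable F torusMeasure :=
    (hg.continuous.comp_aestronglyMeasurable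
      ((aestronglyMeasurable_const.add (Lp.aestronglyMeasurable P)).prodMk
        (aestronglyMeasurable_const.add (Lp.aestronglyMeasurable Y)))).sub
      aestronglyMeasurable_const
  have hFx : ∀ᵐ x ∂torusMeasure, ∃ t : ℝ,
      Critical (ν / 2) (2 * μ) (2 * μ) (2 * η / ν) (idE E + P x) (idE E + Y x) (idE E + F x) t ∧
        0 < trE (idE E + F x) ∧ |t| ≤ 1 / 2 ∧ ‖F x - P x‖ ≤ 2 * η := by
    filter_upwards [hP, hY] with x hx1 hx2
    have hmem : (idE E + P x, idE E + Y x) ∈ S := ⟨hx1, by simpa using hx2⟩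
    obtain ⟨t, a1, a2, a3, a4⟩ := hG _ hmem
    have e : idE E + F x = G (idE E + P x, idE E + Y x) := by
      rw [hgG hmem]; simp only [F]; abel
    have e2 : F x - P x = G (idE E + P x, idE E + Y x) - (idE E + P x) := by rw [← e]; abel
    refine ⟨t, ?_, ?_, a3, ?_⟩
    · rw [e]; exact a1
    · rw [e]; exact a2
    · rw [e2]; exact a4
  have hF : MemLp F 2 torusMeasure := by
    have h0 : MemLp (fun x => F x - P x) 2 torusMeasure :=
      MemLp.of_bound (hFm.sub (Lp.aestronglyMeasurable P)) (2 * η) (by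
        filter_upwards [hFx] with x ⟨t, _, _, _, h⟩ using h)
    have := h0.add (Lp.memLp P)
    refine this.ae_eq (.of_forall fun x => ?_)
    simp
  refine ⟨hF.toLp F, ?_⟩
  filter_upwards [hFx, hF.coeFn_toLp] with x hx e
  rw [e]; exact hx

end MongeAmpereTorus

end

noncomputable section

set_option linter.unusedSectionVars false

namespace MongeAmpereTorus

open SymSpace

variable {E : Type} [NormedAddCommGroup E] [InnerProductSpace ℝ E] [SymSpace E] [CompleteSpace E]

/-! ### Estimates for differences of the projected field -/

section

variable {n m b Λ : ℝ} {P Y Z : Lp E 2 torusMeasure}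

/-- `Z` is the pointwise projection of `Y` onto the level set of the determinant through `P`. -/
def CriticalField (n m b Λ : ℝ) (P Y Z : Lp E 2 torusMeasure) : Prop :=
  ∀ᵐ x ∂torusMeasure, ∃ t : ℝ,
    Critical n m b Λ (idE E + P x) (idE E + Y x) (idE E + Z x) t

/-- The contraction is applied to the Hessian field `diff a Y`, with the projection direction taken
at the midpoint of I + Z and its translate. -/
theorem norm_diff_critical_le (hn : 0 < n) (hb : 0 ≤ b) (hΛ : Λ ≤ 1 / 8)
    (h : CriticalField n m b Λ P Y Z) (hY : Y ∈ hessians E) (a : T2) :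
    (1 - 2 * Λ) * ‖diff a Z‖ ≤ √(1 - n ^ 4 / (4 * m ^ 4)) * ‖diff a Y‖ + b / n * ‖diff a P‖ := by
  obtain ⟨s, hs, hsn⟩ := exists_tanProj_field (n := n) (m := m) hn
    (Z := fun x => (1 / 2 : ℝ) • ((idE E + Z x) + (idE E + shift a Z x)))
    (((aestronglyMeasurable_const.add (Lp.aestronglyMeasurable Z)).add
      (aestronglyMeasurable_const.add (Lp.aestronglyMeasurable (shift a Z)))).const_smul _)
    (by
      filter_upwards [h, ae_shift a h, coeFn_shift a Z] with x ⟨t, h1⟩ ⟨t', h2⟩ h3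
      rw [h3]
      exact h1.ell.midpoint h2.ell) (hessians_diff hY a)
  have hle : ‖(1 - 2 * Λ) • diff a Z‖ ≤ ‖s + (b / n) • normField (diff a P)‖ := by
    refine Lp.norm_le_norm_of_ae_le ?_
    filter_upwards [h, ae_shift a h, coeFn_shift a Z, hs, coeFn_diff a Y, coeFn_diff a Z,
      coeFn_diff a P, coeFn_normField (diff a P), Lp.coeFn_smul (1 - 2 * Λ) (diff a Z),
      Lp.coeFn_add s ((b / n) • normField (diff a P)),
      Lp.coeFn_smul (b / n) (normField (diff a P))]
      with x ⟨t, h1⟩ ⟨t', h2⟩ h3 h4 h5 h6 h7 h8 h9 h10 h11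
    have key := h1.first_difference hn h2
    simp only [add_sub_add_left_eq_sub] at key
    rw [h3, h5] at h4
    rw [h9, h10, Pi.smul_apply, Pi.add_apply, h11, Pi.smul_apply, h8, h4, norm_smul, h6, h7,
      Real.norm_of_nonneg (by linarith), smul_eq_mul]
    exact key.trans (le_abs_self _)
  rw [norm_smul, Real.norm_of_nonneg (by linarith)] at hle
  refine hle.trans ((norm_add_le _ _).trans ?_)
  rw [norm_smul, norm_normField, Real.norm_of_nonneg (by positivity)]
  linarith

/-- The four points are x + a + c, x + a, x + c and x. The squared first differences are taken along
a + c, a and c, and `exists_sq_diff` bounds each by a repeated difference in that same direction.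
The factors 6 and 9 are 2 · 3 and 3 · 3. -/
theorem norm_diff_diff_critical_le {K η b₁ : ℝ} (hn : 0 < n) (hΛ : Λ ≤ 1 / 8) (hK0 : 0 ≤ K)
    (hK : ∀ Λ : ℝ, Λ ≤ 1 / 8 → ∀ (P₁ P₂ P₃ P₄ W₁ W₂ W₃ W₄ Z₁ Z₂ Z₃ Z₄ : E) (t₁ t₂ t₃ t₄ : ℝ),
      Critical n m b Λ P₁ W₁ Z₁ t₁ → Critical n m b Λ P₂ W₂ Z₂ t₂ →
      Critical n m b Λ P₃ W₃ Z₃ t₃ → Critical n m b Λ P₄ W₄ Z₄ t₄ →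
      (1 - 2 * Λ) * ‖Z₁ - Z₂ - Z₃ + Z₄‖ ≤ ‖tanProj (cof Z₄) (W₁ - W₂ - W₃ + W₄)‖ +
        K * ‖P₁ - P₂ - P₃ + P₄‖ + K * (‖W₁ - W₄‖ ^ 2 + ‖P₁ - P₄‖ ^ 2 + (‖W₂ - W₄‖ ^ 2 +
          ‖P₂ - P₄‖ ^ 2) + (‖W₃ - W₄‖ ^ 2 + ‖P₃ - P₄‖ ^ 2)))
    (h : CriticalField n m b Λ P Y Z) (hY : Y ∈ hessians E)
    (hD : ∀ᵐ x ∂torusMeasure, ‖(Y - P) x‖ ≤ η) (hP : ∀ᵐ x ∂torusMeasure, ‖P x‖ ≤ b₁)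
    (a c : T2) :
    (1 - 2 * Λ) * ‖diff a (diff c Z)‖ ≤
      √(1 - n ^ 4 / (4 * m ^ 4)) * ‖diff a (diff c Y)‖ + K * ‖diff a (diff c P)‖ +
        K * (6 * η * (‖diff (a + c) (diff (a + c) (Y - P))‖ + ‖diff a (diff a (Y - P))‖ +
            ‖diff c (diff c (Y - P))‖) +
          9 * b₁ * (‖diff (a + c) (diff (a + c) P)‖ + ‖diff a (diff a P)‖ +
            ‖diff c (diff c P)‖)) := by
  obtain ⟨s, hs, hsn⟩ := exists_tanProj_field (n := n) (m := m) hn (Z := fun x => idE E + Z x)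
    (aestronglyMeasurable_const.add (Lp.aestronglyMeasurable Z))
    (by filter_upwards [h] with x ⟨t, h1⟩ using h1.ell) (hessians_diff (hessians_diff hY c) a)
  obtain ⟨d₁, hd₁, hdn₁⟩ := exists_sq_diff hD (a + c)
  obtain ⟨d₂, hd₂, hdn₂⟩ := exists_sq_diff hD a
  obtain ⟨d₃, hd₃, hdn₃⟩ := exists_sq_diff hD c
  obtain ⟨p₁, hp₁, hpn₁⟩ := exists_sq_diff hP (a + c)
  obtain ⟨p₂, hp₂, hpn₂⟩ := exists_sq_diff hP a
  obtain ⟨p₃, hp₃, hpn₃⟩ := exists_sq_diff hP c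
  rw [diff_neg_norm] at hdn₁ hdn₂ hdn₃ hpn₁ hpn₂ hpn₃
  set q := diff a (diff c P) with hq
  let F : Lp ℝ 2 torusMeasure :=
    s + K • normField q + K • ((2 : ℝ) • (d₁ + d₂ + d₃) + (3 : ℝ) • (p₁ + p₂ + p₃))
  have hF : F =ᵐ[torusMeasure] fun x => s x + K * ‖q x‖ +
      K * (2 * (d₁ x + d₂ x + d₃ x) + 3 * (p₁ x + p₂ x + p₃ x)) := by
    filter_upwards [Lp.coeFn_add (s + K • normField q)
        (K • ((2 : ℝ) • (d₁ + d₂ + d₃) + (3 : ℝ) • (p₁ + p₂ + p₃))),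
      Lp.coeFn_add s (K • normField q), Lp.coeFn_smul K (normField q), coeFn_normField q,
      Lp.coeFn_smul K ((2 : ℝ) • (d₁ + d₂ + d₃) + (3 : ℝ) • (p₁ + p₂ + p₃)),
      Lp.coeFn_add ((2 : ℝ) • (d₁ + d₂ + d₃)) ((3 : ℝ) • (p₁ + p₂ + p₃)),
      Lp.coeFn_smul (2 : ℝ) (d₁ + d₂ + d₃), Lp.coeFn_smul (3 : ℝ) (p₁ + p₂ + p₃),
      Lp.coeFn_add (d₁ + d₂) d₃, Lp.coeFn_add d₁ d₂, Lp.coeFn_add (p₁ + p₂) p₃,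
      Lp.coeFn_add p₁ p₂] with x e1 e2 e3 e4 e5 e6 e7 e8 e9 e10 e11 e12
    simp only [F]
    rw [e1, Pi.add_apply, e2, Pi.add_apply, e3, Pi.smul_apply, e4, e5, Pi.smul_apply, e6,
      Pi.add_apply, e7, Pi.smul_apply, e8, Pi.smul_apply, e9, Pi.add_apply, e10, Pi.add_apply,
      e11, Pi.add_apply, e12, Pi.add_apply]
    simp only [smul_eq_mul]
  have hle : ‖(1 - 2 * Λ) • diff a (diff c Z)‖ ≤ ‖F‖ := by
    refine Lp.norm_le_norm_of_ae_le ?_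
    filter_upwards [hF, Lp.coeFn_smul (1 - 2 * Λ) (diff a (diff c Z)), h, ae_shift a h,
      ae_shift c h, ae_shift (a + c) h, coeFn_diff_diff a c Z, coeFn_diff_diff a c Y,
      coeFn_diff_diff a c P, hs, hd₁.and (coeFn_diff (a + c) (Y - P)),
      hd₂.and (coeFn_diff a (Y - P)), hd₃.and (coeFn_diff c (Y - P)),
      hp₁.and (coeFn_diff (a + c) P), hp₂.and (coeFn_diff a P), hp₃.and (coeFn_diff c P),
      Lp.coeFn_sub Y P, ae_shift a (Lp.coeFn_sub Y P), ae_shift c (Lp.coeFn_sub Y P),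
      ae_shift (a + c) (Lp.coeFn_sub Y P)]
      with x eF eZ ⟨t₄, h₄⟩ ⟨t₂, h₂⟩ ⟨t₃, h₃⟩ ⟨t₁, h₁⟩ eDZ eDY eDP es
        ed₁ ed₂ ed₃ ep₁ ep₂ ep₃ x₄ x₂ x₃ x₁
    have key := hK Λ hΛ _ _ _ _ _ _ _ _ _ _ _ _ _ _ _ _ h₁ h₂ h₃ h₄
    have e4 : ∀ u v w z : E, (idE E + u) - (idE E + v) - (idE E + w) + (idE E + z) =
        u - v - w + z := fun u v w z => by abel
    rw [e4, e4, e4] at key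
    simp only [add_sub_add_left_eq_sub] at key
    rw [eDY] at es
    rw [eF, eZ, Pi.smul_apply, norm_smul, Real.norm_of_nonneg (by linarith), eDZ, es, hq, eDP,
      ed₁.1, ed₁.2, ed₂.1, ed₂.2, ed₃.1, ed₃.2, ep₁.1, ep₁.2, ep₂.1, ep₂.2, ep₃.1, ep₃.2,
      x₁, x₂, x₃, x₄]
    simp only [Pi.sub_apply]
    -- Differences of Y are split into those of Y − P and those of P: only Y − P has a small sup
    -- norm, and the P terms end in the additive constant.
    have hsq : ∀ u v w z : E, ‖u - z‖ ^ 2 + ‖v - w‖ ^ 2 ≤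
        2 * ‖(u - v) - (z - w)‖ ^ 2 + 3 * ‖v - w‖ ^ 2 := fun u v w z => by
      have e : u - z = ((u - v) - (z - w)) + (v - w) := by abel
      have h1 : ‖u - z‖ ≤ ‖(u - v) - (z - w)‖ + ‖v - w‖ := by
        conv_lhs => rw [e]
        exact norm_add_le _ _
      nlinarith [norm_nonneg (u - z), sq_nonneg (‖(u - v) - (z - w)‖ - ‖v - w‖)]
    refine key.trans (le_trans ?_ (le_abs_self _))
    have r1 := hsq (Y (x + (a + c))) (P (x + (a + c))) (P x) (Y x)
    have r2 := hsq (Y (x + a)) (P (x + a)) (P x) (Y x)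
    have r3 := hsq (Y (x + c)) (P (x + c)) (P x) (Y x)
    have r4 := mul_le_mul_of_nonneg_left (add_le_add (add_le_add r1 r2) r3) hK0
    linarith
  rw [norm_smul, Real.norm_of_nonneg (by linarith)] at hle
  have hFn : ‖F‖ ≤ ‖s‖ + K * ‖q‖ + K * (2 * (‖d₁‖ + ‖d₂‖ + ‖d₃‖) + 3 * (‖p₁‖ + ‖p₂‖ + ‖p₃‖)) := by
    simp only [F]
    refine (norm_add₃_le).trans ?_
    rw [norm_smul, norm_normField, norm_smul, Real.norm_of_nonneg hK0]
    gcongr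
    refine (norm_add_le _ _).trans ?_
    rw [norm_smul, norm_smul, Real.norm_of_nonneg (by norm_num), Real.norm_of_nonneg (by norm_num)]
    gcongr <;> exact norm_add₃_le
  refine hle.trans (hFn.trans ?_)
  have : 2 * (‖d₁‖ + ‖d₂‖ + ‖d₃‖) + 3 * (‖p₁‖ + ‖p₂‖ + ‖p₃‖) ≤
      6 * η * (‖diff (a + c) (diff (a + c) (Y - P))‖ + ‖diff a (diff a (Y - P))‖ +
            ‖diff c (diff c (Y - P))‖) +
          9 * b₁ * (‖diff (a + c) (diff (a + c) P)‖ + ‖diff a (diff a P)‖ +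
            ‖diff c (diff c P)‖) := by linarith
  gcongr

end

/-! ### Sobolev seminorms -/

theorem MemH.hasDeriv {X : Lp E 2 torusMeasure} (h : MemH 2 X) {α : ℕ × ℕ}
    (hα : α.1 + α.2 ≤ 2) : HasDeriv α X := h α hα

theorem pairIndex_mem (i j : Fin 2) : pairIndex i j ∈ Finset.HasAntidiagonal.antidiagonal 2 := by
  fin_cases i <;> fin_cases j <;> simp [pairIndex, unitIndex]

theorem unitIndex_mem (i : Fin 2) : unitIndex i ∈ Finset.HasAntidiagonal.antidiagonal 1 := by
  fin_cases i <;> simp [unitIndex]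

theorem exists_unitIndex {α : ℕ × ℕ} (h : α.1 + α.2 = 1) : ∃ i, α = unitIndex i := by
  obtain ⟨a, b⟩ := α
  simp only at h
  rcases Nat.eq_zero_or_pos a with ha | ha
  · exact ⟨1, by simp [unitIndex]; omega⟩
  · exact ⟨0, by simp [unitIndex]; omega⟩

theorem exists_pairIndex {α : ℕ × ℕ} (h : α.1 + α.2 = 2) : ∃ i j, α = pairIndex i j := by
  obtain ⟨a, b⟩ := α
  simp only at h
  have : a = 0 ∨ a = 1 ∨ a = 2 := by omega
  rcases this with ha | ha | ha
  · exact ⟨1, 1, by simp [pairIndex, unitIndex]; omega⟩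
  · exact ⟨0, 1, by simp [pairIndex, unitIndex]; omega⟩
  · exact ⟨0, 0, by simp [pairIndex, unitIndex]; omega⟩

theorem norm_weakDeriv_le_seminormH {m : ℕ} {α : ℕ × ℕ}
    (h : α ∈ Finset.HasAntidiagonal.antidiagonal m) (X : Lp E 2 torusMeasure) :
    ‖weakDeriv α X‖ ≤ seminormH m X :=
  Real.le_sqrt_of_sq_le
    (Finset.single_le_sum (f := fun α => ‖weakDeriv α X‖ ^ 2) (fun _ _ => by positivity) h)

theorem seminormH_mono {m : ℕ} {X Y : Lp E 2 torusMeasure}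
    (h : ∀ α ∈ Finset.HasAntidiagonal.antidiagonal m, ‖weakDeriv α Y‖ ≤ ‖weakDeriv α X‖) :
    seminormH m Y ≤ seminormH m X :=
  Real.sqrt_le_sqrt (Finset.sum_le_sum fun α hα => pow_le_pow_left₀ (norm_nonneg _) (h α hα) 2)

theorem seminormH_nonneg (m : ℕ) (X : Lp E 2 torusMeasure) : 0 ≤ seminormH m X :=
  Real.sqrt_nonneg _

/-- The factor θ is kept exactly, which strict contraction requires; only the constant doubles,
since there are at most four multi-indices of order m ≤ 3. -/
theorem seminormH_le_of_forall {m : ℕ} (hm : m ≤ 3) {X Y : Lp E 2 torusMeasure} {θ c : ℝ}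
    (hθ : 0 ≤ θ) (hc : 0 ≤ c)
    (h : ∀ α ∈ Finset.HasAntidiagonal.antidiagonal m,
      ‖weakDeriv α Y‖ ≤ θ * ‖weakDeriv α X‖ + c) :
    seminormH m Y ≤ θ * seminormH m X + 2 * c := by
  have hcard : ((Finset.HasAntidiagonal.antidiagonal m).card : ℝ) ≤ 4 := by
    rw [Finset.Nat.card_antidiagonal]
    exact_mod_cast Nat.succ_le_succ hm
  set s := Finset.HasAntidiagonal.antidiagonal m
  have hX0 := seminormH_nonneg m X
  have hXsq : seminormH m X ^ 2 = ∑ α ∈ s, ‖weakDeriv α X‖ ^ 2 :=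
    Real.sq_sqrt (Finset.sum_nonneg fun _ _ => by positivity)
  have hsum : ∑ α ∈ s, ‖weakDeriv α X‖ ≤ 2 * seminormH m X := by
    refine (sq_le_sq₀ (Finset.sum_nonneg fun _ _ => norm_nonneg _) (by positivity)).1 ?_
    have := sq_sum_le_card_mul_sum_sq (s := s) (f := fun α => ‖weakDeriv α X‖)
    rw [← hXsq] at this
    nlinarith [sq_nonneg (seminormH m X)]
  rw [seminormH, Real.sqrt_le_left (by positivity)]
  calc ∑ α ∈ s, ‖weakDeriv α Y‖ ^ 2 ≤ ∑ α ∈ s, (θ * ‖weakDeriv α X‖ + c) ^ 2 :=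
        Finset.sum_le_sum fun α hα => pow_le_pow_left₀ (norm_nonneg _) (h α hα) 2
    _ = θ ^ 2 * ∑ α ∈ s, ‖weakDeriv α X‖ ^ 2 + 2 * θ * c * ∑ α ∈ s, ‖weakDeriv α X‖ +
        s.card * c ^ 2 := by
      rw [Finset.mul_sum, Finset.mul_sum, ← nsmul_eq_mul, ← Finset.sum_const,
        ← Finset.sum_add_distrib, ← Finset.sum_add_distrib]
      exact Finset.sum_congr rfl fun _ _ => by ring
    _ ≤ θ ^ 2 * seminormH m X ^ 2 + 2 * θ * c * (2 * seminormH m X) + 4 * c ^ 2 := by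
      rw [hXsq]; gcongr
    _ = _ := by ring

theorem norm_diff_diff_self_le {X : Lp E 2 torusMeasure} (h : MemH 2 X) (i : Fin 2) (t : ℝ) :
    ‖diff (axis i t) (diff (axis i t) X)‖ ≤ t ^ 2 * seminormH 2 X :=
  (norm_diff_diff_le (h.hasDeriv (Finset.HasAntidiagonal.mem_antidiagonal.1 (pairIndex_mem i i)).le) t).trans
    (mul_le_mul_of_nonneg_left (norm_weakDeriv_le_seminormH (pairIndex_mem i i) X) (sq_nonneg t))

theorem norm_diff_diff_diagonal_le {X : Lp E 2 torusMeasure} (h : MemH 2 X) (i j : Fin 2) (t : ℝ) :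
    ‖diff (axis i t + axis j t) (diff (axis i t + axis j t) X)‖ ≤ t ^ 2 * (4 * seminormH 2 X) := by
  have hd := fun i j => h.hasDeriv (Finset.HasAntidiagonal.mem_antidiagonal.1 (pairIndex_mem i j)).le
  refine (norm_diff_diff_add_le (hd i i) (hd i j) (hd j j) t).trans
    (mul_le_mul_of_nonneg_left ?_ (sq_nonneg t))
  have := fun i j => norm_weakDeriv_le_seminormH (pairIndex_mem i j) X
  linarith [this i i, this i j, this j j]

/-- Weak derivatives of the projected field. -/
theorem CriticalField.hasDeriv_unitIndex {n m b Λ : ℝ} {P Y Z : Lp E 2 torusMeasure}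
    (hn : 0 < n) (hb : 0 ≤ b) (hΛ : Λ ≤ 1 / 8) (h : CriticalField n m b Λ P Y Z)
    (hY : Y ∈ hessians E) (hPH : MemH 2 P) (hYH : MemH 2 Y) (i : Fin 2) :
    HasDeriv (unitIndex i) Z ∧ ‖weakDeriv (unitIndex i) Z‖ ≤
      (√(1 - n ^ 4 / (4 * m ^ 4)) * ‖weakDeriv (unitIndex i) Y‖ +
        b / n * ‖weakDeriv (unitIndex i) P‖) / (1 - 2 * Λ) := by
  have hd : (unitIndex i).1 + (unitIndex i).2 ≤ 2 := by
    have := Finset.HasAntidiagonal.mem_antidiagonal.1 (unitIndex_mem i); omega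
  have hp : 0 < 1 - 2 * Λ := by linarith
  refine hasDeriv_of_norm_diff_le (by positivity) fun t ht => ?_
  rw [mul_div_assoc', le_div_iff₀ hp, mul_comm]
  refine (norm_diff_critical_le hn hb hΛ h hY _).trans ?_
  have h1 := norm_diff_le (hYH.hasDeriv hd) t
  have h2 := norm_diff_le (hPH.hasDeriv hd) t
  rw [abs_of_pos ht] at h1 h2
  calc _ ≤ √(1 - n ^ 4 / (4 * m ^ 4)) * (t * ‖weakDeriv (unitIndex i) Y‖) +
        b / n * (t * ‖weakDeriv (unitIndex i) P‖) := by gcongr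
    _ = _ := by ring

/-- K and C are fixed before Λ, η, Y and Z, so that η can later be chosen to make Kη small. -/
theorem CriticalField.exists_hasDeriv_pairIndex {n b b₁ : ℝ} (m : ℝ) (hn : 0 < n) (hb : 0 ≤ b)
    {P : Lp E 2 torusMeasure} (hPH : MemH 2 P) (hP : ∀ᵐ x ∂torusMeasure, ‖P x‖ ≤ b₁) :
    ∃ K C : ℝ, 0 ≤ K ∧ 0 ≤ C ∧ ∀ (Λ η : ℝ) (Y Z : Lp E 2 torusMeasure), Λ ≤ 1 / 8 →
      CriticalField n m b Λ P Y Z → Y ∈ hessians E → MemH 2 Y → MemH 2 (Y - P) →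
      (∀ᵐ x ∂torusMeasure, ‖(Y - P) x‖ ≤ η) → ∀ i j : Fin 2,
        HasDeriv (pairIndex i j) Z ∧ ‖weakDeriv (pairIndex i j) Z‖ ≤
          (√(1 - n ^ 4 / (4 * m ^ 4)) * ‖weakDeriv (pairIndex i j) Y‖ +
            K * η * seminormH 2 (Y - P) + C) / (1 - 2 * Λ) := by
  obtain ⟨K, hK0, hK⟩ := critical_second_difference (E := E) m hn hb
  have hb₁ : 0 ≤ b₁ := by
    obtain ⟨x, hx⟩ := hP.exists
    exact (norm_nonneg _).trans hx
  have hSP := seminormH_nonneg 2 P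
  -- The diagonal second difference costs 4 seminorms and the two axial ones cost 1 each; hence 36 =
  -- 6 · 6 and 54 = 9 · 6.
  refine ⟨36 * K, (K + 54 * K * b₁) * seminormH 2 P, by positivity, by positivity, ?_⟩
  intro Λ η Y Z hΛ h hY hYH hDH hD i j
  have hη : 0 ≤ η := by
    obtain ⟨x, hx⟩ := hD.exists
    exact (norm_nonneg _).trans hx
  have hp : 0 < 1 - 2 * Λ := by linarith
  have hd : (pairIndex i j).1 + (pairIndex i j).2 ≤ 2 :=
    (Finset.HasAntidiagonal.mem_antidiagonal.1 (pairIndex_mem i j)).le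
  have hSD := seminormH_nonneg 2 (Y - P)
  refine hasDeriv_of_norm_diff_diff_le (by positivity) fun t ht => ?_
  rw [mul_div_assoc', le_div_iff₀ hp, mul_comm]
  refine (norm_diff_diff_critical_le hn hΛ hK0 hK h hY hD hP _ _).trans ?_
  have h1 := norm_diff_diff_le (hYH.hasDeriv hd) t
  have h2 := (norm_diff_diff_le (hPH.hasDeriv hd) t).trans
    (mul_le_mul_of_nonneg_left (norm_weakDeriv_le_seminormH (pairIndex_mem i j) P) (sq_nonneg t))
  have h3 := norm_diff_diff_diagonal_le hDH i j t
  have h4 := norm_diff_diff_self_le hDH i t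
  have h5 := norm_diff_diff_self_le hDH j t
  have h6 := norm_diff_diff_diagonal_le hPH i j t
  have h7 := norm_diff_diff_self_le hPH i t
  have h8 := norm_diff_diff_self_le hPH j t
  calc _ ≤ √(1 - n ^ 4 / (4 * m ^ 4)) * (t ^ 2 * ‖weakDeriv (pairIndex i j) Y‖) +
        K * (t ^ 2 * seminormH 2 P) +
        K * (6 * η * (t ^ 2 * (4 * seminormH 2 (Y - P)) + t ^ 2 * seminormH 2 (Y - P) +
          t ^ 2 * seminormH 2 (Y - P)) + 9 * b₁ * (t ^ 2 * (4 * seminormH 2 P) +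
          t ^ 2 * seminormH 2 P + t ^ 2 * seminormH 2 P)) := by gcongr
    _ = _ := by ring

theorem hasDeriv_zero (X : Lp E 2 torusMeasure) : HasDeriv (0, 0) X :=
  ⟨X, isWeakDeriv_field_iff.2 fun i j k => by simp [sym]⟩

theorem memH_two_of {X : Lp E 2 torusMeasure} (h1 : ∀ i, HasDeriv (unitIndex i) X)
    (h2 : ∀ i j, HasDeriv (pairIndex i j) X) : MemH 2 X := by
  intro α hα
  have : α.1 + α.2 = 0 ∨ α.1 + α.2 = 1 ∨ α.1 + α.2 = 2 := by omega
  rcases this with h | h | h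
  · have e : α = (0, 0) := by ext <;> simp <;> omega
    rw [e]; exact hasDeriv_zero X
  · obtain ⟨i, rfl⟩ := exists_unitIndex h; exact h1 i
  · obtain ⟨i, j, rfl⟩ := exists_pairIndex h; exact h2 i j

theorem MemH.sub {X Y : Lp E 2 torusMeasure} (hX : MemH 2 X) (hY : MemH 2 Y) : MemH 2 (X - Y) :=
  fun _ hα => (hX.hasDeriv hα).sub (hY.hasDeriv hα)

theorem MemH.of_pw_le {X Y : Lp E 2 torusMeasure} (hX : MemH 2 X) (h : ∀ k, pw Y k ≤ pw X k) :
    MemH 2 Y := fun _ hα => ((hX.hasDeriv hα).of_pw_le h).1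

end MongeAmpereTorus

end

noncomputable section

set_option linter.unusedSectionVars false

namespace MongeAmpereTorus

open SymSpace

variable {E : Type} [NormedAddCommGroup E] [InnerProductSpace ℝ E] [SymSpace E] [CompleteSpace E]

/-! ### The iteration near a solution -/

/-- The last condition pays for both losses: 4Λ = 8η/ν from dividing by 1 − 2Λ, and 4Kη from the
quadratic terms. Together they use half of the gap 1 − θ. -/
theorem exists_small_radius {ν μ θ K : ℝ} (hν : 0 < ν) (hμ : 0 < μ) (hθ : θ < 1) (hK : 0 ≤ K) :
    ∃ η : ℝ, 0 < η ∧ 4 * η ≤ ν ∧ (2 * μ + 1) * η ≤ 3 / 4 * ν ^ 2 ∧ η ≤ 1 ∧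
      2 * η / ν ≤ 1 / 8 ∧ (8 / ν + 4 * K) * η ≤ (1 - θ) / 2 := by
  have h1 : ∀ a b : ℝ, 0 < a → 0 < b → ∀ᶠ η in nhdsWithin (0 : ℝ) (Set.Ioi 0), a * η ≤ b := by
    intro a b ha hb
    have : ∀ᶠ η in nhds (0 : ℝ), a * η < b :=
      (continuous_const.mul continuous_id).continuousAt.eventually_lt continuousAt_const (by simpa)
    exact (this.filter_mono nhdsWithin_le_nhds).mono fun _ h => h.le
  have h8 : 0 < 8 / ν + 4 * K := by positivity
  have hall := (h1 4 ν (by norm_num) hν).and ((h1 (2 * μ + 1) (3 / 4 * ν ^ 2) (by positivity)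
    (by positivity)).and ((h1 1 1 one_pos one_pos).and ((h1 (2 / ν) (1 / 8) (by positivity)
    (by norm_num)).and ((h1 (8 / ν + 4 * K) ((1 - θ) / 2) h8 (by linarith)).and
    self_mem_nhdsWithin))))
  obtain ⟨η, a1, a2, a3, a4, a5, a6⟩ := hall.exists
  refine ⟨η, a6, a1, a2, by simpa using a3, ?_, a5⟩
  rwa [div_mul_eq_mul_div] at a4

/-- Here z, y, p, x stand for the norms of one derivative of Z, Y, P and X − P, `sD` and `s` for the
seminorms of D and X − P, and κ for 1/(1 − 2Λ). -/
theorem absorb_estimate {z y p x sD s θ κ K M A Λ : ℝ} (hθ0 : 0 ≤ θ) (hθ1 : θ ≤ 1) (hx : 0 ≤ x)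
    (hA : 0 ≤ A) (hK : 0 ≤ K) (hsD : 0 ≤ sD) (hM : 0 ≤ M) (hκ0 : 0 ≤ κ) (hκ : κ ≤ 1 + 4 * Λ)
    (hκ2 : κ ≤ 2) (hz : z ≤ (θ * y + K * sD + M) * κ) (hy : y ≤ x + A) (hp : p ≤ A)
    (hs : sD ≤ s) : z + p ≤ θ * (1 + 4 * Λ) * x + (2 * K * s + (2 * (A + M) + A)) := by
  have t1 : θ * y * κ ≤ θ * (x + A) * κ := by gcongr
  have t2 : θ * x * κ ≤ θ * x * (1 + 4 * Λ) := by gcongr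
  have t3 : θ * A * κ ≤ 1 * A * 2 := by gcongr
  have t4 : K * sD * κ ≤ K * s * 2 :=
    mul_le_mul (mul_le_mul_of_nonneg_left hs hK) hκ2 hκ0 (mul_nonneg hK (hsD.trans hs))
  have t5 : M * κ ≤ M * 2 := by gcongr
  nlinarith

set_option maxHeartbeats 400000 in
/-- Near a uniformly elliptic solution `P`, both projections are uniquely defined and their
composition satisfies contraction estimates for the derivatives of order one and two. -/
theorem exists_projections_and_estimates [FiniteDimensional ℝ E] {f : T2 → ℝ}
    {P : Lp E 2 torusMeasure} (hPB : P ∈ levelSet E f) (hPV : P ∈ hessians E) (hPH : MemH 2 P)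
    {ν μ : ℝ} (hν : 0 < ν) (hEll : ∀ᵐ x ∂torusMeasure, Ell ν μ (idE E + P x)) :
    ∃ ε δ C : ℝ, 0 < ε ∧ 0 < δ ∧ 0 < C ∧ ∀ X : Lp E 2 torusMeasure, MemH 2 X →
      (Summable fun k => weight k ^ (3 / 2 : ℝ) * pw (X - P) k) →
      ∑' k, weight k ^ (3 / 2 : ℝ) * pw (X - P) k ≤ δ ^ 2 →
      ∃ Y Z : Lp E 2 torusMeasure,
        Y ∈ hessians E ∧ (∀ Y' ∈ hessians E, Y' ≠ Y → ‖X - Y‖ < ‖X - Y'‖) ∧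
        Z ∈ levelSet E f ∧ (∀ Z' ∈ levelSet E f, Z' ≠ Z → ‖Y - Z‖ < ‖Y - Z'‖) ∧
        MemH 2 Z ∧ ∀ m ∈ ({1, 2} : Set ℕ),
          seminormH m (Z - P) ≤ (1 - ε) * seminormH m (X - P) + C := by
  have hμ : 0 < μ := by
    obtain ⟨x, hx⟩ := hEll.exists
    obtain ⟨e1, -, e2, -⟩ := hx.entries
    linarith
  set n := ν / 2 with hn_def
  set m := 2 * μ with hm_def
  have hn : 0 < n := by positivity
  have hm : 0 < m := by positivity
  set b₁ := m + ‖idE E‖ with hb₁_def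
  have hPbd : ∀ᵐ x ∂torusMeasure, ‖P x‖ ≤ b₁ := by
    filter_upwards [hEll] with x hx
    have e : P x = (idE E + P x) - idE E := by abel
    rw [e]
    exact (norm_sub_le _ _).trans (by rw [hb₁_def]; gcongr; exact hx.norm_le hν)
  obtain ⟨K, C, hK0, hC0, hKC⟩ :=
    CriticalField.exists_hasDeriv_pairIndex (b := m) m hn hm.le hPH hPbd
  set θ := √(1 - n ^ 4 / (4 * m ^ 4)) with hθ_def
  have hθ0 : 0 ≤ θ := Real.sqrt_nonneg _
  have hθ1 : θ < 1 := by
    rw [hθ_def, Real.sqrt_lt' one_pos]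
    have : 0 < n ^ 4 / (4 * m ^ 4) := by positivity
    linarith
  obtain ⟨η, hη, a1, a2, a3, a4, a5⟩ := exists_small_radius hν hμ hθ1 hK0
  set Λ := 2 * η / ν with hΛ_def
  have hΛ0 : 0 ≤ Λ := by positivity
  -- The total coefficient of the seminorm of X − P. The term 4Kη is 2Kη doubled by
  -- `seminormH_le_of_forall`.
  have hcoef : θ * (1 + 4 * Λ) + 4 * K * η ≤ 1 - (1 - θ) / 2 := by
    have h1 : θ * (4 * Λ) ≤ 1 * (4 * Λ) := mul_le_mul_of_nonneg_right hθ1.le (by linarith)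
    have h2 : 4 * Λ = 8 / ν * η := by rw [hΛ_def]; ring
    linarith
  set S := (∑' k, weight k ^ (-(3 / 2) : ℝ)) + 1 with hS_def
  have hS : 0 < S := by
    have : 0 ≤ ∑' k, weight k ^ (-(3 / 2) : ℝ) :=
      tsum_nonneg fun k => (Real.rpow_pos_of_pos (weight_pos k) _).le
    linarith
  -- Chosen so that the sup bound 2δS on D equals η.
  set δ := η / (2 * S) with hδ_def
  have hδ : 0 < δ := by positivity
  set A := seminormH 1 P + seminormH 2 P with hA_def
  have hA1 : 0 ≤ seminormH 1 P := seminormH_nonneg 1 P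
  have hA2 : 0 ≤ seminormH 2 P := seminormH_nonneg 2 P
  set c₀ := 2 * (A + m / n * A + C) + A with hc₀_def
  have hc₀ : 0 ≤ c₀ := by positivity
  refine ⟨(1 - θ) / 2, δ, 2 * c₀ + 1, by linarith, hδ, by linarith, ?_⟩
  intro X hXH hsum hle
  -- Projecting X − P rather than X is harmless because P is itself a Hessian, and it makes the
  -- smallness of X − P available.
  obtain ⟨D, hDV, hDorth, hDpw⟩ := exists_orthogonal_hessian (X - P)
  have hXPH : MemH 2 (X - P) := hXH.sub hPH
  have hDH : MemH 2 D := hXPH.of_pw_le hDpw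
  have hDbd : ∀ᵐ x ∂torusMeasure, ‖D x‖ ≤ η := by
    have hle' : ∀ k, weight k ^ (3 / 2 : ℝ) * pw D k ≤ weight k ^ (3 / 2 : ℝ) * pw (X - P) k :=
      fun k => mul_le_mul_of_nonneg_left (hDpw k) (Real.rpow_pos_of_pos (weight_pos k) _).le
    have hsD := hsum.of_nonneg_of_le (fun k => mul_nonneg
      (Real.rpow_pos_of_pos (weight_pos k) _).le (pw_nonneg D k)) hle'
    obtain ⟨h1, h2⟩ := sqrt_pw_summable hδ hsD ((hsD.tsum_le_tsum hle' hsum).trans hle)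
    filter_upwards [ae_norm_le_tsum_sqrt_pw h1] with x hx
    refine hx.trans ((mul_le_mul_of_nonneg_left h2 zero_le_two).trans (le_of_eq ?_))
    rw [hδ_def]; field_simp; rfl
  set Y := D + P with hY_def
  have hYD : Y - P = D := by rw [hY_def]; abel
  have hYV : Y ∈ hessians E := by
    -- The closure properties are stated for differences, so the sum D + P is written as D − (−P).
    have : Y = D - (P - P - P) := by rw [hY_def]; abel
    rw [this]
    exact hessians_sub hDV (hessians_sub (hessians_sub hPV hPV) hPV)
  have hYH : MemH 2 Y := by
    have : Y = D - (P - P - P) := by rw [hY_def]; abel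
    rw [this]
    exact hDH.sub ((hPH.sub hPH).sub hPH)
  have hYx : ∀ᵐ x ∂torusMeasure, ‖(Y - P) x‖ ≤ η := by rw [hYD]; exact hDbd
  have hYx' : ∀ᵐ x ∂torusMeasure, ‖Y x - P x‖ ≤ η := by
    filter_upwards [hYx, Lp.coeFn_sub Y P] with x h1 h2
    rwa [h2] at h1
  obtain ⟨Z, hZ⟩ := exists_critical_field hν hη.le a1 a2 a3 a4 hEll hYx'
  have hcrit : CriticalField n m m Λ P Y Z := hZ.mono fun x ⟨t, h, _⟩ => ⟨t, h⟩
  have hZB : Z ∈ levelSet E f := by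
    have h3 : ∀ᵐ x ∂torusMeasure, detE (idE E + P x) = f x ∧ 0 < trE (idE E + P x) ∧
        0 < detE (idE E + P x) := hPB
    change ∀ᵐ x ∂torusMeasure, detE (idE E + Z x) = f x ∧ 0 < trE (idE E + Z x) ∧
        0 < detE (idE E + Z x)
    filter_upwards [hZ, h3] with x ⟨t, h1, h2, _⟩ h3
    rw [h1.det_eq]
    exact ⟨h3.1, h2, h3.2.2⟩
  have hder1 := fun i => hcrit.hasDeriv_unitIndex hn hm.le a4 hYV hPH hYH i
  have hder2 := fun i j => hKC Λ η Y Z a4 hcrit hYV hYH (by rw [hYD]; exact hDH) hYx i j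
  have hZH : MemH 2 Z := memH_two_of (fun i => (hder1 i).1) fun i j => (hder2 i j).1
  refine ⟨Y, Z, hYV, fun Y' hY' hne => ?_, hZB, fun Z' hZ' hne => ?_, hZH, fun l hl => ?_⟩
  · have h1 : inner ℝ (X - Y) (Y - Y') = 0 := by
      have : X - Y = X - P - D := by rw [hY_def]; abel
      rw [this]
      exact hDorth _ (hessians_sub hYV hY')
    have e : X - Y' = (X - Y) + (Y - Y') := by abel
    have h2 := norm_add_sq_real (X - Y) (Y - Y')
    rw [h1, ← e] at h2
    have h3 : 0 < ‖Y - Y'‖ := norm_pos_iff.2 (sub_ne_zero.2 hne.symm)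
    refine (sq_lt_sq₀ (norm_nonneg _) (norm_nonneg _)).1 ?_
    nlinarith
  · have h1 := levelSet_gap (Y := Y) hZB hZ' (hZ.mono fun x ⟨t, h, _, h3, _⟩ => ⟨t, h3, h.eq⟩)
    have h3 : 0 < ‖Z' - Z‖ := norm_pos_iff.2 (sub_ne_zero.2 hne)
    refine (sq_lt_sq₀ (norm_nonneg _) (norm_nonneg _)).1 ?_
    nlinarith
  · have hl2 : l ≤ 2 := by rcases hl with rfl | rfl <;> norm_num
    have hl1 : 1 ≤ l := by rcases hl with rfl | rfl <;> norm_num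
    have hinv : 1 / (1 - 2 * Λ) ≤ 1 + 4 * Λ := by
      rw [div_le_iff₀ (by linarith)]; nlinarith
    have hinv2 : 1 / (1 - 2 * Λ) ≤ 2 := hinv.trans (by linarith)
    have hinv0 : 0 ≤ 1 / (1 - 2 * Λ) := by
      have : 0 < 1 - 2 * Λ := by linarith
      positivity
    have hSl := seminormH_nonneg l (X - P)
    have hSD : seminormH l D ≤ seminormH l (X - P) := seminormH_mono fun α hα => by
      have := Finset.HasAntidiagonal.mem_antidiagonal.1 hα
      exact ((hXPH.hasDeriv (by omega)).of_pw_le hDpw).2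
    -- Both orders are put in one form; for order one the quadratic term is absent and a nonnegative
    -- quantity is added.
    have hcommon : ∀ α ∈ Finset.HasAntidiagonal.antidiagonal l, ‖weakDeriv α Z‖ ≤
        (θ * ‖weakDeriv α Y‖ + K * η * seminormH l D + (m / n * A + C)) * (1 / (1 - 2 * Λ)) := by
      intro α hα
      have hα' := Finset.HasAntidiagonal.mem_antidiagonal.1 hα
      rcases hl with rfl | rfl
      · obtain ⟨i, rfl⟩ := exists_unitIndex hα'
        refine (hder1 i).2.trans ?_
        rw [div_eq_mul_one_div]
        refine mul_le_mul_of_nonneg_right ?_ hinv0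
        have h1 := (norm_weakDeriv_le_seminormH hα P)
        have h2 : m / n * ‖weakDeriv (unitIndex i) P‖ ≤ m / n * A := by
          gcongr; linarith
        have h3 : 0 ≤ K * η * seminormH 1 D := by
          have := seminormH_nonneg 1 D
          positivity
        linarith
      · obtain ⟨i, j, rfl⟩ := exists_pairIndex hα'
        refine (hder2 i j).2.trans ?_
        rw [div_eq_mul_one_div, hYD]
        refine mul_le_mul_of_nonneg_right ?_ hinv0
        have : 0 ≤ m / n * A := by positivity
        linarith
    have hA0 : 0 ≤ A := add_nonneg hA1 hA2
    have hM0 : 0 ≤ m / n * A + C := add_nonneg (mul_nonneg (div_pos hm hn).le hA0) hC0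
    have hs0 : 0 ≤ seminormH l D := seminormH_nonneg l D
    have hα : ∀ α ∈ Finset.HasAntidiagonal.antidiagonal l, ‖weakDeriv α (Z - P)‖ ≤
        θ * (1 + 4 * Λ) * ‖weakDeriv α (X - P)‖ +
          (2 * K * η * seminormH l (X - P) + c₀) := by
      intro α hα
      have hα' := Finset.HasAntidiagonal.mem_antidiagonal.1 hα
      have hα2 : α.1 + α.2 ≤ 2 := by omega
      have hPα : ‖weakDeriv α P‖ ≤ A := by
        have := norm_weakDeriv_le_seminormH hα P
        rcases hl with rfl | rfl <;> linarith
      have hYα : ‖weakDeriv α Y‖ ≤ ‖weakDeriv α (X - P)‖ + A := by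
        have h1 := HasDeriv.weakDeriv_sub (hYH.hasDeriv hα2) (hPH.hasDeriv hα2)
        rw [hYD] at h1
        have h2 : weakDeriv α Y = weakDeriv α D + weakDeriv α P := by rw [h1]; abel
        rw [h2]
        refine (norm_add_le _ _).trans (add_le_add ?_ hPα)
        exact ((hXPH.hasDeriv hα2).of_pw_le hDpw).2
      rw [HasDeriv.weakDeriv_sub (hZH.hasDeriv hα2) (hPH.hasDeriv hα2)]
      refine (norm_sub_le _ _).trans ?_
      have := absorb_estimate hθ0 hθ1.le (norm_nonneg _) hA0 (mul_nonneg hK0 hη.le) hs0 hM0 hinv0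
        hinv hinv2 (hcommon α hα) hYα hPα hSD
      linarith
    have hKη : 0 ≤ 2 * K * η * seminormH l (X - P) :=
      mul_nonneg (mul_nonneg (mul_nonneg zero_le_two hK0) hη.le) hSl
    have hfin := seminormH_le_of_forall (by omega) (mul_nonneg hθ0 (by linarith)) (add_nonneg hKη hc₀) hα
    refine hfin.trans ?_
    have := mul_le_mul_of_nonneg_right hcoef hSl
    linarith

/-! ### The concrete space of symmetric matrices -/

/-- Entries of symmetric matrices. -/
def symMatEnt (i j : Fin 2) : SymMat →L[ℝ] ℝ :=
  (EuclideanSpace.proj (𝕜 := ℝ) (i, j)).comp symSubmodule.subtypeL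

instance : SymSpace SymMat where
  entL := symMatEnt
  mkSym p q r := ⟨WithLp.toLp 2 fun ij => !![p, q; q, r] ij.1 ij.2, by
    intro i j; fin_cases i <;> fin_cases j <;> rfl⟩
  entL_symm i j A := A.2 i j
  entL_mkSym _ _ _ _ _ := rfl
  inner_eq_sum_entL A B := by
    rw [Submodule.coe_inner, PiLp.inner_apply, Fintype.sum_prod_type]
    simp [symMatEnt, mul_comm]

theorem entL_eq_toMat (i j : Fin 2) (A : SymMat) : entL i j A = toMat A i j := rfl

theorem toMat_idE : toMat (idE SymMat) = 1 := by
  ext i j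
  fin_cases i <;> fin_cases j <;> rfl

theorem one_add_toMat (A : SymMat) : 1 + toMat A = toMat (idE SymMat + A) := by
  rw [← toMat_idE]; rfl

theorem det_toMat (A : SymMat) : (toMat A).det = detE A := by
  rw [Matrix.det_fin_two, detE]
  have := entL_symm 1 0 A
  simp only [entL_eq_toMat] at *
  rw [this]; ring

theorem posDef_toMat_iff (A : SymMat) : (toMat A).PosDef ↔ 0 < trE A ∧ 0 < detE A := by
  have hs : toMat A 1 0 = toMat A 0 1 := entL_symm 1 0 A
  constructor
  · intro h
    refine ⟨?_, ?_⟩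
    · have h0 : 0 < toMat A 0 0 := h.diag_pos
      have h1 : 0 < toMat A 1 1 := h.diag_pos
      exact add_pos h0 h1
    · rw [← det_toMat]; exact h.det_pos
  · rintro ⟨h1, h2⟩
    rw [trE, entL_eq_toMat, entL_eq_toMat] at h1
    rw [detE, entL_eq_toMat, entL_eq_toMat, entL_eq_toMat] at h2
    refine Matrix.PosDef.of_dotProduct_mulVec_pos (by
      have := isSymm_toMat A
      rw [Matrix.IsHermitian, Matrix.conjTranspose_eq_transpose_of_trivial]; exact this) ?_
    intro x hx
    simp only [star_trivial, dotProduct, Matrix.mulVec, Fin.sum_univ_two, hs]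
    set p := toMat A 0 0
    set q := toMat A 0 1
    set r := toMat A 1 1
    -- Otherwise pr > q² ≥ 0 would make p and r both negative, against the positive trace.
    have hp : 0 < p := by
      by_contra hp
      nlinarith [sq_nonneg q]
    have hx' : x 0 ≠ 0 ∨ x 1 ≠ 0 := by
      by_contra! hc
      exact hx (by ext i; fin_cases i <;> simp [hc])
    have key : 0 < p * (x 0 * (p * x 0 + q * x 1) + x 1 * (q * x 0 + r * x 1)) := by
      have e : p * (x 0 * (p * x 0 + q * x 1) + x 1 * (q * x 0 + r * x 1)) =
          (p * x 0 + q * x 1) ^ 2 + (p * r - q ^ 2) * x 1 ^ 2 := by ring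
      rw [e]
      by_cases h1x : x 1 = 0
      · have h0x : x 0 ≠ 0 := hx'.resolve_right (by simpa using h1x)
        rw [h1x]
        have := mul_pos hp hp
        have := sq_pos_of_ne_zero h0x
        nlinarith
      · have := sq_pos_of_ne_zero h1x
        have := mul_pos h2 this
        nlinarith [sq_nonneg (p * x 0 + q * x 1)]
    exact pos_of_mul_pos_right key hp.le

theorem setB_eq_levelSet (f : T2 → ℝ) : setB f = levelSet SymMat f := by
  ext Q
  change (∀ᵐ x ∂torusMeasure, (1 + toMat (Q x)).det = f x ∧ (1 + toMat (Q x)).PosDef) ↔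
    ∀ᵐ x ∂torusMeasure, detE (idE SymMat + Q x) = f x ∧ 0 < trE (idE SymMat + Q x) ∧
      0 < detE (idE SymMat + Q x)
  refine Filter.eventually_congr (.of_forall fun x => ?_)
  rw [one_add_toMat, det_toMat, posDef_toMat_iff]

theorem UniformlyElliptic.ell {P : MatField}
    (h : UniformlyElliptic fun x => 1 + toMat (P x)) :
    ∃ ν μ : ℝ, 0 < ν ∧ ∀ᵐ x ∂torusMeasure, Ell ν μ (idE SymMat + P x) := by
  obtain ⟨ν, μ, hν, -, h⟩ := h
  refine ⟨ν, μ, hν, ?_⟩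
  filter_upwards [h] with x hx a b
  have := hx ![a, b]
  rw [one_add_toMat] at this
  have hs : toMat (idE SymMat + P x) 1 0 = toMat (idE SymMat + P x) 0 1 := by
    have := entL_symm 1 0 (idE SymMat + P x)
    simpa only [entL_eq_toMat] using this
  simp only [dotProduct, Matrix.mulVec, Fin.sum_univ_two, hs, Matrix.cons_val_zero,
    Matrix.cons_val_one] at this
  simp only [entL_eq_toMat]
  constructor <;> nlinarith [this.1, this.2]

/-- Finiteness of the extended norm supplies summability, and squaring cancels the exponent 1/2. -/
theorem sobolevNorm_lt_iff_aux {s δ : ℝ} {X : MatField}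
    (h : sobolevNorm s X < ENNReal.ofReal δ) :
    (Summable fun k => weight k ^ s * pw (E := SymMat) X k) ∧
      ∑' k, weight k ^ s * pw (E := SymMat) X k ≤ δ ^ 2 := by
  have hδ : 0 < δ := ENNReal.ofReal_pos.1 (lt_of_le_of_lt zero_le h)
  have hterm : ∀ k, (1 + (2 * Real.pi) ^ 2 * ∑ i, (k i : ℝ) ^ 2) ^ s *
      ∑ i, ∑ j, ‖UnitAddTorus.mFourierCoeff (fun x => ((toMat (X x) i j : ℝ) : ℂ)) k‖ ^ 2 =
        weight k ^ s * pw (E := SymMat) X k := by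
    intro k
    have : ∀ i j, UnitAddTorus.mFourierCoeff (fun x => ((toMat (X x) i j : ℝ) : ℂ)) k =
        fc (ent (E := SymMat) i j X) k := fun i j => (fc_congr (coeFn_ent (E := SymMat) i j X) k).symm
    simp only [this]; rfl
  rw [sobolevNorm] at h
  simp only [hterm] at h
  have hnn : ∀ k, 0 ≤ weight k ^ s * pw (E := SymMat) X k := fun k =>
    mul_nonneg (Real.rpow_pos_of_pos (weight_pos k) _).le (pw_nonneg _ _)
  set T := ∑' k, ENNReal.ofReal (weight k ^ s * pw (E := SymMat) X k)
  have hT : T ≤ ENNReal.ofReal (δ ^ 2) := by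
    have h2 := ENNReal.rpow_le_rpow h.le (zero_le_two (α := ℝ))
    rw [← ENNReal.rpow_mul] at h2
    norm_num at h2
    rwa [ENNReal.ofReal_pow hδ.le]
  have hs : Summable fun k => weight k ^ s * pw (E := SymMat) X k := by
    have := ENNReal.summable_toReal (hT.trans_lt ENNReal.ofReal_lt_top).ne
    simpa only [ENNReal.toReal_ofReal (hnn _)] using this
  refine ⟨hs, ?_⟩
  rw [← ENNReal.ofReal_le_ofReal_iff (by positivity), ENNReal.ofReal_tsum_of_nonneg hnn hs]
  exact hT

/-! ### Metric projections and the conclusion. -/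

theorem metricProj_eq {S : Set MatField} {X Y : MatField} (hY : Y ∈ S)
    (h : ∀ Y' ∈ S, Y' ≠ Y → ‖X - Y‖ < ‖X - Y'‖) :
    (∃! Y, IsNearestPoint S X Y) ∧ metricProj S X = Y := by
  have h1 : IsNearestPoint S X Y := ⟨hY, fun Z hZ => by
    by_cases e : Z = Y
    · rw [e]
    · exact (h Z hZ e).le⟩
  have h2 : ∀ Z, IsNearestPoint S X Z → Z = Y := fun Z hZ => by
    by_contra e
    exact absurd (hZ.2 Y hY) (not_le.2 (h Z hZ.1 e))
  refine ⟨⟨Y, h1, h2⟩, ?_⟩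
  have hex : ∃ Y, IsNearestPoint S X Y := ⟨Y, h1⟩
  rw [metricProj, dif_pos hex]
  exact h2 _ hex.choose_spec

theorem metricProj_self {S : Set MatField} {X : MatField} (hX : X ∈ S) : metricProj S X = X := by
  refine (metricProj_eq hX fun Y _ hne => ?_).2
  have h0 : X - X = (0 : MatField) := sub_self X
  rw [h0]
  have h1 : ‖(0 : MatField)‖ = 0 := norm_zero (E := MatField)
  rw [h1]
  exact norm_pos_iff (E := MatField).2 (sub_ne_zero.2 hne.symm)

end MongeAmpereTorus

end

theorem lemma4p3
    (f : MongeAmpereTorus.T2 → ℝ) (P : MongeAmpereTorus.MatField)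
    (hPB : P ∈ MongeAmpereTorus.setB f)
    (hPV : P ∈ MongeAmpereTorus.setV)
    (hPH : MongeAmpereTorus.MemH 2 P)
    (hA1 : MongeAmpereTorus.UniformlyElliptic fun x => 1 + MongeAmpereTorus.toMat (P x)) :
    ∃ ε δ C : ℝ, 0 < ε ∧ 0 < δ ∧ 0 < C ∧
      ∀ X : MongeAmpereTorus.MatField, MongeAmpereTorus.MemH 2 X →
        MongeAmpereTorus.sobolevNorm (3 / 2) (X - P) < ENNReal.ofReal δ →
          -- both projections are well defined at the points where they are applied
          (∃! Y, MongeAmpereTorus.IsNearestPoint MongeAmpereTorus.setV X Y) ∧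
          (∃! Z, MongeAmpereTorus.IsNearestPoint (MongeAmpereTorus.setB f)
            (MongeAmpereTorus.metricProj MongeAmpereTorus.setV X) Z) ∧
          -- the derivatives of the image exist
          MongeAmpereTorus.MemH 2 (MongeAmpereTorus.iterMap f X) ∧
          -- the two estimates
          MongeAmpereTorus.seminormH 1
              (MongeAmpereTorus.iterMap f X - MongeAmpereTorus.iterMap f P) ≤
            (1 - ε) * MongeAmpereTorus.seminormH 1 (X - P) + C ∧
          MongeAmpereTorus.seminormH 2
              (MongeAmpereTorus.iterMap f X - MongeAmpereTorus.iterMap f P) ≤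
            (1 - ε) * MongeAmpereTorus.seminormH 2 (X - P) + C := by
  open MongeAmpereTorus in
  obtain ⟨ν, μ, hν, hEll⟩ := hA1.ell
  -- P lies in both sets, so each projection fixes it.
  have hPP : iterMap f P = P := by
    rw [iterMap, metricProj_self hPV, metricProj_self hPB]
  rw [hPP]
  have hPB' : P ∈ levelSet SymMat f := by rw [← setB_eq_levelSet]; exact hPB
  -- `setV` and `hessians SymMat` agree by unfolding, whereas `setB` has to be rewritten, its
  -- positivity being expressed through trace and determinant.
  obtain ⟨ε, δ, C, hε, hδ, hC, h⟩ :=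
    exists_projections_and_estimates (E := SymMat) hPB' hPV hPH hν hEll
  refine ⟨ε, δ, C, hε, hδ, hC, fun X hX hXδ => ?_⟩
  obtain ⟨hs, hle⟩ := sobolevNorm_lt_iff_aux hXδ
  obtain ⟨Y, Z, hY, hYn, hZ, hZn, hZH, hest⟩ := h X hX hs hle
  obtain ⟨huY, eY⟩ := metricProj_eq (S := setV) hY hYn
  rw [← setB_eq_levelSet] at hZ hZn
  obtain ⟨huZ, eZ⟩ := metricProj_eq hZ hZn
  rw [iterMap, eY, eZ]
  exact ⟨huY, huZ, hZH, hest 1 (by simp), hest 2 (by simp)⟩
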